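/- Proposition 4.1. Let $e,h,f$ be the standard basis of $\mathfrak{sl}_2=\mathfrak{sl}_2(\mathbb C)$, and let $W_1,\dots,W_n$ be irreducible $\mathfrak{sl}_2$-modules of finite dimensions $a_1,\dots,a_n$. Let $F$ be the space of $W_1\otimes\cdots\otimes W_n$-valued polynomials in $z_1,\dots,z_n$. It is a $\mathbb C[z_1,\dots,z_n]$-module, and $\mathfrak{sl}_2\otimes\mathbb C[t]$ acts on it by $xt^k\mapsto\sum_i z_i^k x^{(i)}$, where $x^{(i)}$ is the action of $x\in\mathfrak{sl}_2$ on the $i$-th tensor factor. For $i<j$ let $s_{ij}=\min(a_i,a_j)-1$, and let $W_i\otimes W_j=\bigoplus_{k=0}^{s_{ij}}U^{(i,j)}_k$ be the decomposition into irreducible components, $\dim U_k^{(i,j)}=a_i+a_j-1-2k$. Put $$V^{(i,j)}(l)=\bigoplus_{0\le k\le \min(l,s_{ij})}U^{(i,j)}_k,\qquad \widehat V^{(i,j)}(l)=\bigoplus_{\max(0,s_{ij}-l)\le k\le s_{ij}}U^{(i,j)}_{k}.$$ Let $F^c\subset F$ be the set of those $g$ such that, for all $i<j$, in the expansion $g=\sum_k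 s^kg_k$ with $s=z_i-z_j$, where $g_k$ is a polynomial in $z_i+z_j$ and the $z_p$, $p\ne i,j$, all values of $g_k$ lie in the image of $V^{(i,j)}(k)\otimes\bigotimes_{p\ne i,j}W_p$ in $W_1\otimes\cdots\otimes W_n$. Let $\widehat F^c\subset F$ be defined in the same way, with $\widehat V^{(i,j)}$ in place of $V^{(i,j)}$. For each $i$ let $u_i,v_i\in W_i$ be a highest and a lowest vector, i.e. non-zero vectors with $f u_i=0$ and $e v_i=0$. (The convention is that $\mathfrak n_-=\mathbb Cf$ annihilates the highest vector.) Then there is exactly one $\mathfrak{sl}_2$-invariant bilinear form $\beta_i$ on $W_i$ with $\beta_i(u_i,v_i)=1$. Let $\langle\cdot,\cdot\rangle$ be the product of the forms $\beta_i$ on $W_1\otimes\cdots\otimes W_n$, and for $g,h\in F$ put $\chi(g,h)(z_1,\dots,z_n)=\langle g(z_1,\dots,z_n),h(z_1,\dots,z_n)\rangle$. Then $F^c$ and $\widehat F^c$ are $\mathbb C[z_1,\dots,z_n]$-submodules and $\mathfrak{sl}_2\otimes\mathbb C[t]$-submodules of $F$, and for all $g\in F^c$, $h\in\widehat F^c$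 the polynomial $\chi(g,h)$ is divisible by $D=\prod_{1\le i<j\le n}(z_i-z_j)^{\min(a_i,a_j)-1}$. For $T=(t_1,\dots,t_n)\in\mathbb C^n$ let $R(T)$ be the ideal of $\mathbb C[z_1,\dots,z_n]$ generated by the $z_i-t_i$, and let $M(T)=F^c/R(T)F^c$, $L(T)=\widehat F^c/R(T)\widehat F^c$. Then for every $T\in\mathbb C^n$ $$(\bar g,\bar h)_T=\frac{\chi(g,h)}{D}(t_1,\dots,t_n)$$ is a well-defined pairing of $M(T)$ and $L(T)$, and $\bar h\mapsto(\,\cdot\,,\bar h)_T$ is an isomorphism $L(T)\cong M(T)^*$ of $\mathfrak{sl}_2\otimes\mathbb C[t]$-modules, where $M(T)^*$ is the full dual space with the contragredient action. -/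

import Mathlib

set_option maxSynthPendingDepth 3

open scoped TensorProduct

noncomputable section

namespace FusionSl2

/-- The Lie algebra `sl₂(ℂ)`. -/
abbrev Sl2 : Type := LieAlgebra.SpecialLinear.sl (Fin 2) ℂ

/-- The current algebra `𝔤 ⊗ ℂ[t]`; `p ⊗ₜ x` stands for `x p(t)`, and
`[x p, y q] = [x, y] p q`. -/
abbrev Current (𝔤 : Type*) [LieRing 𝔤] [LieAlgebra ℂ 𝔤] : Type _ := Polynomial ℂ ⊗[ℂ] 𝔤

/-- The polynomial ring `ℂ[z₁, …, zₙ]`. -/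
abbrev Pol (n : ℕ) : Type := MvPolynomial (Fin n) ℂ

section Functional

variable {n : ℕ} (W : Fin n → Type*) [∀ i, AddCommGroup (W i)] [∀ i, Module ℂ (W i)]

/-- The tensor product `W₁ ⊗ ⋯ ⊗ Wₙ`. -/
abbrev Tens : Type _ := ⨂[ℂ] i, W i

/-- The space `F` of `W₁ ⊗ ⋯ ⊗ Wₙ`-valued polynomials in `z₁, …, zₙ`. -/
abbrev ValPol : Type _ := Pol n ⊗[ℂ] Tens W

instance : AddCommGroup (ValPol W) := inferInstance

instance : Module (Pol n) (ValPol W) := inferInstance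

instance : Module ℂ (ValPol W) := inferInstance

instance : IsScalarTower ℂ (Pol n) (ValPol W) := inferInstance

variable {W}

/-- The value at `Z ∈ ℂⁿ` of a vector-valued polynomial. -/
def evalAt (Z : Fin n → ℂ) : ValPol W →ₗ[ℂ] Tens W :=
  (TensorProduct.lid ℂ (Tens W)).toLinearMap ∘ₗ
    LinearMap.rTensor (Tens W) (MvPolynomial.aeval Z).toLinearMap

/-- The map `W_i ⊗ W_j → W₁ ⊗ ⋯ ⊗ Wₙ` which inserts a tensor at the places `i ≠ j` into the pure
tensor with the entries `w p` at the other places `p` (the entries `w i`, `w j` play no role). -/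
def insertPair {i j : Fin n} (hij : i ≠ j) (w : ∀ p, W p) : W i ⊗[ℂ] W j →ₗ[ℂ] Tens W :=
  TensorProduct.lift <| LinearMap.mk₂ ℂ
    (fun x y => PiTensorProduct.tprod ℂ (Function.update (Function.update w i x) j y))
    (fun x x' y => by
      simp only [Function.update_comm hij, MultilinearMap.map_update_add])
    (fun c x y => by
      simp only [Function.update_comm hij, MultilinearMap.map_update_smul])
    (fun x y y' => by simp only [MultilinearMap.map_update_add])
    (fun c x y => by simp only [MultilinearMap.map_update_smul])

/-- The subspace `σ(U ⊗ L)` of `W₁ ⊗ ⋯ ⊗ Wₙ`, for `U ⊆ W_i ⊗ W_j` and `L` the tensor product of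
the `W_p` with `p ≠ i, j`. -/
def pairImage {i j : Fin n} (hij : i ≠ j) (U : Submodule ℂ (W i ⊗[ℂ] W j)) :
    Submodule ℂ (Tens W) :=
  ⨆ w : ∀ p, W p, U.map (insertPair hij w)

/-- The polynomials in `t = z_i + z_j` and the `z_p`, `p ≠ i, j`. -/
def transversePol (i j : Fin n) : Subalgebra ℂ (Pol n) :=
  Algebra.adjoin ℂ
    ({MvPolynomial.X i + MvPolynomial.X j} ∪ MvPolynomial.X '' {p | p ≠ i ∧ p ≠ j})

variable (W) in
/-- The vector-valued polynomials in `t = z_i + z_j` and the `z_p`, `p ≠ i, j`. -/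
def transverse (i j : Fin n) : Submodule ℂ (ValPol W) :=
  LinearMap.range (LinearMap.rTensor (Tens W) (transversePol i j).val.toLinearMap)

/-- The condition on the diagonal `z_i = z_j`: in the expansion `f = ∑ₖ sᵏ fₖ(t, …)` with
`s = z_i - z_j`, `t = z_i + z_j`, all values of `fₖ` lie in `σ(V(k) ⊗ L)`. -/
def DiagCondition {i j : Fin n} (hij : i ≠ j) (V : ℕ → Submodule ℂ (W i ⊗[ℂ] W j))
    (f : ValPol W) : Prop :=
  ∃ g : ℕ →₀ ValPol W,
    f = g.sum (fun k x => (MvPolynomial.X i - MvPolynomial.X j : Pol n) ^ k • x) ∧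
    ∀ k, g k ∈ transverse W i j ∧ ∀ Z : Fin n → ℂ, evalAt Z (g k) ∈ pairImage hij (V k)


theorem DiagCondition.zero {i j : Fin n} (hij : i ≠ j) (V : ℕ → Submodule ℂ (W i ⊗[ℂ] W j)) :
    DiagCondition hij V 0 :=
  ⟨0, by simp, fun k => ⟨by simp, fun Z => by simp⟩⟩

theorem DiagCondition.add {i j : Fin n} {hij : i ≠ j} {V : ℕ → Submodule ℂ (W i ⊗[ℂ] W j)}
    {f f' : ValPol W} (hf : DiagCondition hij V f) (hf' : DiagCondition hij V f') :
    DiagCondition hij V (f + f') := by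
  obtain ⟨g, rfl, hg⟩ := hf
  obtain ⟨g', rfl, hg'⟩ := hf'
  refine ⟨g + g', ?_, fun k => ⟨?_, fun Z => ?_⟩⟩
  · rw [Finsupp.sum_add_index'] <;> simp [smul_add]
  · exact Submodule.add_mem _ (hg k).1 (hg' k).1
  · rw [Finsupp.add_apply, map_add]
    exact Submodule.add_mem _ ((hg k).2 Z) ((hg' k).2 Z)

theorem evalAt_smul (Z : Fin n → ℂ) (p : Pol n) (x : ValPol W) :
    evalAt Z (p • x) = MvPolynomial.aeval Z p • evalAt Z x := by
  induction x using TensorProduct.induction_on with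
  | zero => simp
  | tmul q w => simp [evalAt, TensorProduct.smul_tmul', mul_smul]
  | add x y hx hy => simp only [smul_add, map_add, hx, hy]

theorem DiagCondition.smul_transverse {i j : Fin n} {hij : i ≠ j}
    {V : ℕ → Submodule ℂ (W i ⊗[ℂ] W j)} {f : ValPol W} (hf : DiagCondition hij V f)
    {q : Pol n} (hq : q ∈ transversePol i j) : DiagCondition hij V (q • f) := by
  obtain ⟨g, rfl, hg⟩ := hf
  refine ⟨g.mapRange (fun x => q • x) (smul_zero q), ?_, fun k => ⟨?_, fun Z => ?_⟩⟩
  · rw [Finsupp.sum_mapRange_index (by simp), Finsupp.smul_sum]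
    simp only [smul_smul, mul_comm]
  · rw [Finsupp.mapRange_apply]
    obtain ⟨y, hy⟩ := (hg k).1
    rw [← hy]
    clear hy
    induction y using TensorProduct.induction_on with
    | zero => simp
    | tmul r w =>
      refine ⟨((⟨q, hq⟩ : transversePol i j) * r) ⊗ₜ w, ?_⟩
      simp [TensorProduct.smul_tmul']
    | add x y hx hy =>
      rw [map_add, smul_add]
      exact Submodule.add_mem _ hx hy
  · rw [Finsupp.mapRange_apply, evalAt_smul]
    exact Submodule.smul_mem _ _ ((hg k).2 Z)

theorem pairImage_mono {i j : Fin n} (hij : i ≠ j) {U U' : Submodule ℂ (W i ⊗[ℂ] W j)}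
    (h : U ≤ U') : pairImage hij U ≤ pairImage hij U' :=
  iSup_mono fun _ => Submodule.map_mono h

theorem DiagCondition.smul_diff {i j : Fin n} {hij : i ≠ j}
    {V : ℕ → Submodule ℂ (W i ⊗[ℂ] W j)} (hV : Monotone V) {f : ValPol W}
    (hf : DiagCondition hij V f) :
    DiagCondition hij V ((MvPolynomial.X i - MvPolynomial.X j : Pol n) • f) := by
  obtain ⟨g, rfl, hg⟩ := hf
  refine ⟨g.embDomain ⟨Nat.succ, Nat.succ_injective⟩, ?_, fun k => ?_⟩
  · rw [Finsupp.sum_embDomain, Finsupp.smul_sum]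
    simp only [smul_smul, Function.Embedding.coeFn_mk, Nat.succ_eq_add_one, pow_succ']
  · cases k with
    | zero =>
      rw [Finsupp.embDomain_of_notMem_range _ _ _ (by simp)]
      exact ⟨by simp, fun Z => by simp⟩
    | succ k =>
      have h : g.embDomain ⟨Nat.succ, Nat.succ_injective⟩ (k + 1) = g k :=
        Finsupp.embDomain_apply_self ⟨Nat.succ, Nat.succ_injective⟩ g k
      rw [h]
      exact ⟨(hg k).1, fun Z => pairImage_mono hij (hV k.le_succ) ((hg k).2 Z)⟩

theorem DiagCondition.smul {i j : Fin n} {hij : i ≠ j}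
    {V : ℕ → Submodule ℂ (W i ⊗[ℂ] W j)} (hV : Monotone V) (p : Pol n) {f : ValPol W}
    (hf : DiagCondition hij V f) : DiagCondition hij V (p • f) := by
  induction p using MvPolynomial.induction_on generalizing f with
  | C c => exact hf.smul_transverse (Subalgebra.algebraMap_mem _ c)
  | add p q hp hq => rw [add_smul]; exact (hp hf).add (hq hf)
  | mul_X p l hp =>
    rw [mul_smul]
    apply hp
    have ht : (MvPolynomial.X i + MvPolynomial.X j : Pol n) ∈ transversePol i j :=
      Algebra.subset_adjoin (Or.inl rfl)
    have hc : (MvPolynomial.C (1 / 2 : ℂ) : Pol n) ∈ transversePol i j :=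
      Subalgebra.algebraMap_mem _ _
    have h2 : (MvPolynomial.C (1 / 2 : ℂ) : Pol n) * 2 = 1 := by
      rw [← map_ofNat (MvPolynomial.C : ℂ →+* Pol n) 2, ← map_mul]
      norm_num
    by_cases hi : l = i
    · subst hi
      have e : (MvPolynomial.X l : Pol n) = MvPolynomial.C (1 / 2 : ℂ) *
          (MvPolynomial.X l + MvPolynomial.X j) + MvPolynomial.C (1 / 2 : ℂ) *
          (MvPolynomial.X l - MvPolynomial.X j) := by
        linear_combination (-MvPolynomial.X l) * h2
      rw [e, add_smul, mul_smul, mul_smul]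
      exact ((hf.smul_transverse ht).smul_transverse hc).add
        ((hf.smul_diff hV).smul_transverse hc)
    · by_cases hj : l = j
      · subst hj
        have e : (MvPolynomial.X l : Pol n) = MvPolynomial.C (1 / 2 : ℂ) *
            (MvPolynomial.X i + MvPolynomial.X l) + MvPolynomial.C (-1 : ℂ) *
            (MvPolynomial.C (1 / 2 : ℂ) * (MvPolynomial.X i - MvPolynomial.X l)) := by
          rw [map_neg, map_one]
          linear_combination (-MvPolynomial.X l) * h2
        rw [e, add_smul, mul_smul, mul_smul, mul_smul]
        exact ((hf.smul_transverse ht).smul_transverse hc).add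
          (((hf.smul_diff hV).smul_transverse hc).smul_transverse
            (Subalgebra.algebraMap_mem _ _))
      · exact hf.smul_transverse (Algebra.subset_adjoin (Or.inr ⟨l, ⟨hi, hj⟩, rfl⟩))

/-- The `ℂ[z₁, …, zₙ]`-module of the vector-valued polynomials which satisfy the diagonal
conditions for a choice of increasing filtrations `V i j` on the `W_i ⊗ W_j`, `i < j`. -/
def conditioned (V : ∀ i j : Fin n, ℕ →o Submodule ℂ (W i ⊗[ℂ] W j)) :
    Submodule (Pol n) (ValPol W) where
  carrier := {f | ∀ (i j : Fin n) (hij : i < j), DiagCondition hij.ne (V i j) f}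
  zero_mem' := fun i j hij => DiagCondition.zero hij.ne (V i j)
  add_mem' := fun hf hf' i j hij => (hf i j hij).add (hf' i j hij)
  smul_mem' := fun p _ hf i j hij => (hf i j hij).smul (V i j).monotone p

/-- The submodule `R(T) P`, where `R(T)` is the ideal of `ℂ[z₁, …, zₙ]` generated by the
`z_i - t_i`. -/
def idealMul (P : Submodule (Pol n) (ValPol W)) (T : Fin n → ℂ) : Submodule (Pol n) P :=
  Ideal.span (Set.range fun i => (MvPolynomial.X i - MvPolynomial.C (T i) : Pol n)) •
    (⊤ : Submodule (Pol n) P)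

end Functional

section CurrentAction

variable {n : ℕ} {W : Fin n → Type*} [∀ i, AddCommGroup (W i)] [∀ i, Module ℂ (W i)]

/-- An endomorphism of `W_i` acting on the `i`-th factor of `W₁ ⊗ ⋯ ⊗ Wₙ`. -/
def atSite (i : Fin n) : Module.End ℂ (W i) →ₗ[ℂ] Module.End ℂ (Tens W) :=
  (PiTensorProduct.mapMultilinear ℂ W W).toLinearMap (fun _ => LinearMap.id) i

theorem atSite_apply (i : Fin n) (A : Module.End ℂ (W i)) :
    atSite i A = PiTensorProduct.map (Function.update (fun _ => LinearMap.id) i A) := rfl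

theorem atSite_mul (i : Fin n) (A B : Module.End ℂ (W i)) :
    atSite i (A * B) = atSite (W := W) i A * atSite i B := by
  simp only [atSite_apply]
  rw [← PiTensorProduct.map_mul]
  congr 1
  funext p
  by_cases h : p = i
  · subst h; simp
  · simp only [Function.update_of_ne h]; rfl

theorem atSite_commute {i j : Fin n} (h : i ≠ j) (A : Module.End ℂ (W i))
    (B : Module.End ℂ (W j)) : atSite (W := W) i A * atSite j B = atSite j B * atSite i A := by
  simp only [atSite_apply]
  rw [← PiTensorProduct.map_mul, ← PiTensorProduct.map_mul]
  congr 1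
  funext p
  by_cases hi : p = i
  · subst hi; simp only [Function.update_self, Function.update_of_ne h]; rfl
  · by_cases hj : p = j
    · subst hj; simp only [Function.update_self, Function.update_of_ne hi]; rfl
    · simp only [Function.update_of_ne hi, Function.update_of_ne hj]

variable {𝔤 : Type*} [LieRing 𝔤] [LieAlgebra ℂ 𝔤]
  [∀ i, LieRingModule 𝔤 (W i)] [∀ i, LieModule ℂ 𝔤 (W i)]

theorem sum_smul_commutator {ι S A : Type*} [Fintype ι] [CommRing S] [Ring A] [Algebra S A]
    (c d : ι → S) (X Y : ι → A) (h : ∀ i j, i ≠ j → X i * Y j = Y j * X i) :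
    (∑ i, c i • X i) * (∑ i, d i • Y i) - (∑ i, d i • Y i) * (∑ i, c i • X i) =
      ∑ i, (c i * d i) • (X i * Y i - Y i * X i) := by
  classical
  rw [Finset.sum_mul_sum, Finset.sum_mul_sum, Finset.sum_comm (f := fun i j =>
    d i • Y i * c j • X j), ← Finset.sum_sub_distrib]
  refine Finset.sum_congr rfl fun i _ => ?_
  rw [← Finset.sum_sub_distrib, Finset.sum_eq_single i]
  · rw [smul_mul_smul_comm, smul_mul_smul_comm, mul_comm (d i), smul_sub]
  · intro j _ hj
    rw [smul_mul_smul_comm, smul_mul_smul_comm, mul_comm (d j), h i j hj.symm, sub_self]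
  · exact fun h => absurd (Finset.mem_univ i) h

/-- An endomorphism of `W_i` acting on the values of vector-valued polynomials through the `i`-th
factor of `W₁ ⊗ ⋯ ⊗ Wₙ`. -/
def onSite (i : Fin n) : Module.End ℂ (W i) →ₗ[ℂ] Module.End (Pol n) (ValPol W) :=
  LinearMap.baseChangeHom ℂ (Pol n) (Tens W) (Tens W) ∘ₗ atSite i

theorem onSite_apply (i : Fin n) (A : Module.End ℂ (W i)) :
    onSite i A = LinearMap.baseChange (Pol n) (atSite (W := W) i A) := rfl

theorem onSite_mul (i : Fin n) (A B : Module.End ℂ (W i)) :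
    onSite (W := W) i (A * B) = onSite i A * onSite i B := by
  rw [onSite_apply, atSite_mul, Module.End.mul_eq_comp, LinearMap.baseChange_comp]
  rfl

theorem onSite_commute {i j : Fin n} (h : i ≠ j) (A : Module.End ℂ (W i))
    (B : Module.End ℂ (W j)) : onSite (W := W) i A * onSite j B = onSite j B * onSite i A := by
  rw [onSite_apply, onSite_apply, Module.End.mul_eq_comp, Module.End.mul_eq_comp,
    ← LinearMap.baseChange_comp, ← LinearMap.baseChange_comp, ← Module.End.mul_eq_comp,
    ← Module.End.mul_eq_comp, atSite_commute h]

theorem toEnd_lie {M : Type*} [AddCommGroup M] [Module ℂ M] [LieRingModule 𝔤 M]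
    [LieModule ℂ 𝔤 M] (x y : 𝔤) :
    (LieModule.toEnd ℂ 𝔤 M ⁅x, y⁆ : Module.End ℂ M) =
      LieModule.toEnd ℂ 𝔤 M x * LieModule.toEnd ℂ 𝔤 M y -
        LieModule.toEnd ℂ 𝔤 M y * LieModule.toEnd ℂ 𝔤 M x := by
  ext m
  simp

variable (W 𝔤) in
/-- The action of the current algebra on the vector-valued polynomials: on
`F = ⨂ᵢ (ℂ[z_i] ⊗ W_i)`, `x tᵏ` acts on `ℂ[z_i] ⊗ W_i` by `f ⊗ v ↦ z_iᵏ f ⊗ x v`. Thus `p ⊗ₜ x` acts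
by `∑ᵢ p(z_i) x⁽ⁱ⁾`, with `x⁽ⁱ⁾` the action of `x` on the `i`-th tensor factor. It commutes with the
multiplication by polynomials. -/
def currentAct : Current 𝔤 →ₗ[ℂ] Module.End (Pol n) (ValPol W) :=
  ∑ i, TensorProduct.lift (LinearMap.mk₂ ℂ
    (fun (p : Polynomial ℂ) (x : 𝔤) => (Polynomial.aeval (MvPolynomial.X i : Pol n) p) •
      onSite i (LieModule.toEnd ℂ 𝔤 (W i) x))
    (fun p q x => by rw [map_add, add_smul])
    (fun c p x => by rw [map_smul, smul_assoc])
    (fun p x y => by rw [map_add, map_add, smul_add])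
    (fun c p x => by rw [map_smul, map_smul, smul_comm]))

theorem currentAct_tmul (p : Polynomial ℂ) (x : 𝔤) :
    currentAct W 𝔤 (p ⊗ₜ x) = ∑ i, (Polynomial.aeval (MvPolynomial.X i : Pol n) p) •
      onSite (W := W) i (LieModule.toEnd ℂ 𝔤 (W i) x) := by
  simp [currentAct, LinearMap.sum_apply]

theorem currentAct_lie (a b : Current 𝔤) :
    currentAct W 𝔤 ⁅a, b⁆ =
      currentAct W 𝔤 a * currentAct W 𝔤 b - currentAct W 𝔤 b * currentAct W 𝔤 a := by
  induction a using TensorProduct.induction_on with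
  | zero => simp
  | add a a' ha ha' => simp only [add_lie, map_add, ha, ha', add_mul, mul_add]; abel
  | tmul p x =>
    induction b using TensorProduct.induction_on with
    | zero => simp
    | add b b' hb hb' => simp only [lie_add, map_add, hb, hb', add_mul, mul_add]; abel
    | tmul q y =>
      rw [LieAlgebra.ExtendScalars.bracket_tmul, currentAct_tmul, currentAct_tmul,
        currentAct_tmul, sum_smul_commutator _ _ _ _ fun i j h => onSite_commute h _ _]
      refine Finset.sum_congr rfl fun i _ => ?_
      rw [toEnd_lie, map_sub, onSite_mul, onSite_mul, map_mul]

variable (𝔤) in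
/-- A `ℂ[z₁, …, zₙ]`-submodule of `F` which is stable under the current algebra. -/
def IsCurrentStable (P : Submodule (Pol n) (ValPol W)) : Prop :=
  ∀ x : Current 𝔤, ∀ f ∈ P, currentAct W 𝔤 x f ∈ P

namespace IsCurrentStable

variable {P : Submodule (Pol n) (ValPol W)} (hP : IsCurrentStable 𝔤 P) (T : Fin n → ℂ)

/-- The fibre `P / R(T) P` at `T ∈ ℂⁿ` of a current-stable submodule `P`; it is made into a module
over the current algebra below. -/
def FiberAt (_hP : IsCurrentStable 𝔤 P) (T : Fin n → ℂ) : Type _ := P ⧸ idealMul P T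

instance : AddCommGroup (hP.FiberAt T) := inferInstanceAs (AddCommGroup (P ⧸ idealMul P T))

instance : Module (Pol n) (hP.FiberAt T) := inferInstanceAs (Module (Pol n) (P ⧸ idealMul P T))

instance : Module ℂ (hP.FiberAt T) := inferInstanceAs (Module ℂ (P ⧸ idealMul P T))

instance : IsScalarTower ℂ (Pol n) (hP.FiberAt T) :=
  inferInstanceAs (IsScalarTower ℂ (Pol n) (P ⧸ idealMul P T))

/-- The class of an element in the fibre. -/
def toFiber : P →ₗ[Pol n] hP.FiberAt T :=
  Submodule.mkQ (idealMul P T)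

theorem toFiber_surjective : Function.Surjective (hP.toFiber T) := Submodule.mkQ_surjective _

/-- The action of an element of the current algebra on the fibre, `x [f] = [x f]`. -/
def fiberAct (x : Current 𝔤) : Module.End (Pol n) (hP.FiberAt T) :=
  Submodule.mapQ _ _ ((currentAct W 𝔤 x).restrict (hP x)) (by
    unfold idealMul
    rw [← Submodule.map_le_iff_le_comap, Submodule.map_smul'']
    exact Submodule.smul_mono le_rfl le_top)

theorem fiberAct_toFiber (x : Current 𝔤) (f : P) :
    hP.fiberAct T x (hP.toFiber T f) =
      hP.toFiber T ⟨currentAct W 𝔤 x f, hP x f f.2⟩ := rfl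

instance : LieRingModule (Current 𝔤) (hP.FiberAt T) where
  bracket x m := hP.fiberAct T x m
  add_lie x y m := by
    obtain ⟨f, rfl⟩ := hP.toFiber_surjective T m
    simp only [fiberAct_toFiber]
    rw [← map_add]
    congr 1
    ext
    simp
  lie_add x m m' := map_add (hP.fiberAct T x) m m'
  leibniz_lie x y m := by
    obtain ⟨f, rfl⟩ := hP.toFiber_surjective T m
    simp only [fiberAct_toFiber]
    rw [← map_add]
    congr 1
    ext
    simp [currentAct_lie]

theorem lie_toFiber (x : Current 𝔤) (f : P) :
    ⁅x, hP.toFiber T f⁆ = hP.toFiber T ⟨currentAct W 𝔤 x f, hP x f f.2⟩ := rfl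

instance : LieModule ℂ (Current 𝔤) (hP.FiberAt T) where
  smul_lie c x m := by
    obtain ⟨f, rfl⟩ := hP.toFiber_surjective T m
    rw [lie_toFiber, lie_toFiber, ← algebraMap_smul (Pol n) c (hP.toFiber T _)]
    refine Eq.trans ?_ ((hP.toFiber T).map_smul (algebraMap ℂ (Pol n) c) _)
    congr 1
    apply Subtype.ext
    change currentAct W 𝔤 (c • x) f = algebraMap ℂ (Pol n) c • currentAct W 𝔤 x f
    rw [map_smul, LinearMap.smul_apply, algebraMap_smul]
  lie_smul c x m := by
    rw [← algebraMap_smul (Pol n) c m, ← algebraMap_smul (Pol n) c ⁅x, m⁆]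
    exact map_smul (hP.fiberAct T x) _ m

end IsCurrentStable
end CurrentAction

section ClebschGordan

variable {n : ℕ} (W : Fin n → Type*) [∀ i, AddCommGroup (W i)] [∀ i, Module ℂ (W i)]
  [∀ i, LieRingModule Sl2 (W i)] [∀ i, LieModule ℂ Sl2 (W i)]

/-- For `M`, `N` of dimensions `a`, `b`: the sum of the irreducible submodules of `M ⊗ N` of the
dimensions `a + b - 1 - 2k`, with `k` in a set `K` of natural numbers, `k ≤ min(a, b) - 1`. -/
def componentSum (M N : Type*) [AddCommGroup M] [Module ℂ M] [LieRingModule Sl2 M]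
    [LieModule ℂ Sl2 M] [AddCommGroup N] [Module ℂ N] [LieRingModule Sl2 N] [LieModule ℂ Sl2 N]
    (K : Set ℕ) : LieSubmodule ℂ Sl2 (M ⊗[ℂ] N) :=
  sSup {U | LieModule.IsIrreducible ℂ Sl2 U ∧
    ∃ k ∈ K, k < min (Module.finrank ℂ M) (Module.finrank ℂ N) ∧
      Module.finrank ℂ U + 1 + 2 * k = Module.finrank ℂ M + Module.finrank ℂ N}

theorem componentSum_mono (M N : Type*) [AddCommGroup M] [Module ℂ M] [LieRingModule Sl2 M]
    [LieModule ℂ Sl2 M] [AddCommGroup N] [Module ℂ N] [LieRingModule Sl2 N] [LieModule ℂ Sl2 N]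
    {K K' : Set ℕ} (h : K ⊆ K') : componentSum M N K ≤ componentSum M N K' :=
  sSup_le_sSup fun _ ⟨hU, k, hk, hk'⟩ => ⟨hU, k, h hk, hk'⟩

/-- The Clebsch–Gordan filtration: `V(l)` is the sum of the components of `W_i ⊗ W_j` of the
dimensions `a_i + a_j - 1 - 2k` with `0 ≤ k ≤ l`. -/
def cgFiltration (i j : Fin n) : ℕ →o Submodule ℂ (W i ⊗[ℂ] W j) where
  toFun l := (componentSum (W i) (W j) {k | k ≤ l}).toSubmodule
  monotone' _ _ h := componentSum_mono _ _ fun _ hk => le_trans hk h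

/-- The opposite filtration: with `s = min(a_i, a_j) - 1`, `V(l)` is the sum of the components of
`W_i ⊗ W_j` of the dimensions `a_i + a_j - 1 - 2k` with `s - l ≤ k ≤ s`. -/
def oppFiltration (i j : Fin n) : ℕ →o Submodule ℂ (W i ⊗[ℂ] W j) where
  toFun l := (componentSum (W i) (W j)
    {k | min (Module.finrank ℂ (W i)) (Module.finrank ℂ (W j)) - 1 ≤ k + l}).toSubmodule
  monotone' _ _ h := componentSum_mono _ _ fun _ hk => le_trans hk (Nat.add_le_add_left h _)

/-- The space `F^c`. -/
def Fc : Submodule (Pol n) (ValPol W) := conditioned (cgFiltration W)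

/-- The space `F̂^c`. -/
def FcHat : Submodule (Pol n) (ValPol W) := conditioned (oppFiltration W)

/-- `u` is a highest vector: it is non-zero and killed by `𝔫₋` (here `𝔫₊ = ℂe` creates the module
from its highest vector). -/
def IsHighest {M : Type*} [AddCommGroup M] [LieRingModule Sl2 M] (u : M) : Prop :=
  u ≠ 0 ∧ ⁅LieAlgebra.SpecialLinear.single (R := ℂ) (1 : Fin 2) 0 one_ne_zero 1, u⁆ = 0

/-- `v` is a lowest vector: it is non-zero and killed by `𝔫₊ = ℂe`. -/
def IsLowest {M : Type*} [AddCommGroup M] [LieRingModule Sl2 M] (v : M) : Prop :=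
  v ≠ 0 ∧ ⁅LieAlgebra.SpecialLinear.single (R := ℂ) (0 : Fin 2) 1 zero_ne_one 1, v⁆ = 0

end ClebschGordan

section Pairing

variable {n : ℕ} {W : Fin n → Type*} [∀ i, AddCommGroup (W i)] [∀ i, Module ℂ (W i)]

/-- The product form `⟨x₁ ⊗ ⋯ ⊗ xₙ, y₁ ⊗ ⋯ ⊗ yₙ⟩ = ∏ᵢ βᵢ(xᵢ, yᵢ)`. -/
def prodForm (β : ∀ i, LinearMap.BilinForm ℂ (W i)) : LinearMap.BilinForm ℂ (Tens W) :=
  (PiTensorProduct.map₂ β).compr₂ (PiTensorProduct.lift (MultilinearMap.mkPiAlgebra ℂ (Fin n) ℂ))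

theorem prodForm_tprod (β : ∀ i, LinearMap.BilinForm ℂ (W i)) (x y : ∀ i, W i) :
    prodForm β (PiTensorProduct.tprod ℂ x) (PiTensorProduct.tprod ℂ y) =
      ∏ i, β i (x i) (y i) := by
  simp [prodForm, PiTensorProduct.map₂_tprod_tprod]

/-- The pairing `χ` of vector-valued polynomials, `χ(f, h)(Z) = ⟨f(Z), h(Z)⟩`. -/
def chi (β : ∀ i, LinearMap.BilinForm ℂ (W i)) : LinearMap.BilinForm (Pol n) (ValPol W) :=
  LinearMap.BilinForm.baseChange (Pol n) (prodForm β)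

theorem eval_chi (β : ∀ i, LinearMap.BilinForm ℂ (W i)) (f h : ValPol W) (Z : Fin n → ℂ) :
    MvPolynomial.eval Z (chi β f h) = prodForm β (evalAt Z f) (evalAt Z h) := by
  induction f using TensorProduct.induction_on with
  | zero => simp
  | add f f' hf hf' => simp only [map_add, LinearMap.add_apply, hf, hf']
  | tmul p x =>
    induction h using TensorProduct.induction_on with
    | zero => simp
    | add f f' hf hf' => simp only [map_add, hf, hf']
    | tmul q y =>
      simp [chi, evalAt, MvPolynomial.smul_eq_C_mul, MvPolynomial.aeval_eq_eval]
      ring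

variable (W) in
/-- The polynomial `∏_{i<j} (z_i - z_j)^{min(a_i, a_j) - 1}`. -/
def diagDenominator : Pol n :=
  ∏ i, ∏ j ∈ Finset.Ioi i, (MvPolynomial.X i - MvPolynomial.X j) ^
    (min (Module.finrank ℂ (W i)) (Module.finrank ℂ (W j)) - 1)

end Pairing

end FusionSl2
end

noncomputable section

namespace FusionSl2

/-! ### Fusion relations: a bound on the number of spanning monomials -/

section Spanning

/-! Write Δ for the product of all z_i - z_j with i < j, and s for z_i - z_j at a chosen diagonal.
Casimir eigenvalues show that V(k) and V̂(l) are orthogonal when k + l < s_ij, so χ vanishes to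
order s_ij along each diagonal; the linear forms are pairwise coprime, hence D divides χ. Stability
under the current algebra holds because p(z_i) x^(i) + p(z_j) x^(j) is the diagonal action of x
times p(z_j), plus a multiple of s x^(i): the operator x^(i) moves the filtration by one step and
the factor s pays for it. The main point is that χ/D is perfect over ℂ[z₁, …, zₙ]; given finite dual
families, the statement about fibres is formal (`exists_fiberEquiv`).

Perfectness goes through the submodule N = `fusionSpan u` generated from u₁ ⊗ ⋯ ⊗ uₙ by polynomials
and the currents of e. It lies in F^c, and three facts about it carry the proof.

N is free of rank ∏ a_i (`nonempty_fusionBasis`). The m-th power of ∏_j (ζ - z_j) · ∑_i e^(i)/(ζ -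
z_i) is divisible by ∏_j (ζ - z_j)^(m - a_j + 1) (exponents truncated at 0), since (e^(i))^(a_i) =
0. At z = 0 this says that low coefficients of the powers vanish. The polynomial ring modulo these
relations is spanned by ∏ a_i monomials (`FusionRelations.exists_spansModulo`), and graded Nakayama
lifts this to N. Conversely N contains Δ^M F, a free module of the same rank, so the generators form
a basis.

Near a generic point of a diagonal N is large (`exists_pairImage_le_conductor`). Up to factors prime
to s, the currents provide e^(i) + e^(j), s e^(i) and the remaining e^(q), while V(k) is spanned by
the vectors (e^(i) + e^(j))^a (e^(i))^p (u_i ⊗ u_j) with p ≤ k. So N contains s^k t, up to such a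
factor, for every t with entries from V(k) at i, j.

Every linear form φ on N satisfies D φ = χ(·, h) with h ∈ F̂^c (`exists_mem_FcHat_of_linearForm`).
Since V(s_ij) is everything, D φ has no poles along the diagonals and is given by some h ∈ F; since
s^(s_ij) divides the pairing of h with s^k t for t in V(k), and V̂(l) contains all that is
orthogonal to V(s_ij - l - 1), this h lies in F̂^c.

Applied to the coordinate forms of a basis of N this yields the dual family in F̂^c. Multiplication
by Δ^M maps F into N and F is torsion-free, so an element of F^c is determined by its pairings with
that family, and an element of F̂^c by its pairings with N (`exists_dual_families`). -/

open Polynomial in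
theorem coeff_mul_mem_of_forall_le {R : Type*} [CommRing R] (I : Ideal R) (z : R) (H P : R[X])
    (d : ℕ) (h : ∀ i ≤ d, z * P.coeff i ∈ I) : z * (H * P).coeff d ∈ I := by
  rw [coeff_mul, Finset.mul_sum]
  refine I.sum_mem fun x hx => ?_
  rw [mul_left_comm]
  exact I.mul_mem_left _ (h _ (by have := Finset.HasAntidiagonal.mem_antidiagonal.1 hx; omega))

theorem mem_of_natCast_succ_mul_mem {R : Type*} [CommRing R] [Algebra ℂ R] (I : Ideal R) (m : ℕ)
    (x : R) (h : ((m : R) + 1) * x ∈ I) : x ∈ I := by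
  have hm : (m : ℂ) + 1 ≠ 0 := Nat.cast_add_one_ne_zero m
  have : x = algebraMap ℂ R ((m : ℂ) + 1)⁻¹ * (((m : R) + 1) * x) := by
    rw [← mul_assoc, show ((m : R) + 1) = algebraMap ℂ R ((m : ℂ) + 1) by simp, ← map_mul,
      inv_mul_cancel₀ hm, map_one, one_mul]
  rw [this]
  exact I.mul_mem_left _ h

open Polynomial in
/-- If the coefficients of the powers `E ^ m` below a linear bound in `m` of slope at least two
are killed by `z` modulo `I`, then `z * E(0)` kills two more coefficients of every power. -/
theorem coeff_pow_mem_step {R : Type*} [CommRing R] [Algebra ℂ R] (I : Ideal R) (E : R[X])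
    (z : R) {K S σ : ℕ} (hK : 2 ≤ K)
    (h : ∀ m r, r + S < K * m + σ → z * (E ^ m).coeff r ∈ I) (m r : ℕ)
    (hr : r + S < K * m + σ + 2) : z * E.coeff 0 * (E ^ m).coeff r ∈ I := by
  set a := E.coeff 0 with ha
  obtain ⟨F, hF⟩ : ∃ F : R[X], E = C a + X * F := ⟨E.divX, by rw [add_comm, X_mul_divX_add]⟩
  -- Here K ≥ 2 matters: replacing m by m + 1 raises the bound by K, which covers the two extra
  -- degrees.
  have h1 : z * (E ^ (m + 1)).coeff r ∈ I := h _ _ (by rw [mul_add]; omega)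
  have hE : (E ^ (m + 1)) = C a * E ^ m + X * (F * E ^ m) := by
    rw [pow_succ']; nth_rewrite 1 [hF]; ring
  cases r with
  | zero => simpa [hE, mul_assoc] using h1
  | succ r =>
    obtain ⟨H, hH⟩ : ∃ H : R[X], F = C (F.coeff 0) + X * H := ⟨F.divX, by
      rw [add_comm, X_mul_divX_add]⟩
    set b := F.coeff 0
    -- With c_k the coefficients of E^m, expanding E^(m+1) = E · E^m only controls the sum a c_(r+1)
    -- + b c_r modulo lower terms. In the derivative (m+1) E' E^m the constant a no longer occurs as
    -- a factor, so comparing coefficients there isolates b c_r.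
    have hD : (derivative (E ^ (m + 1))) =
        C ((m : R) + 1) * (C b * E ^ m + X * ((2 * H + X * derivative H) * E ^ m)) := by
      rw [derivative_pow, hF, hH]
      simp
      ring
    have h2 : ((r : R) + 1) * (z * (E ^ (m + 1)).coeff (r + 1)) ∈ I := I.mul_mem_left _ h1
    have h3 : z * (b * (E ^ m).coeff r + (X * ((2 * H + X * derivative H) * E ^ m)).coeff r) ∈
        I := by
      apply mem_of_natCast_succ_mul_mem I m
      have := congrArg (fun p => p.coeff r) hD
      simp only [coeff_derivative, coeff_C_mul, coeff_add] at this
      convert h2 using 1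
      linear_combination -z * this
    have hlow : ∀ G : R[X], z * (X * (G * E ^ m)).coeff r ∈ I := by
      intro G
      cases r with
      | zero => simp
      | succ r =>
        rw [coeff_X_mul]
        exact coeff_mul_mem_of_forall_le I z _ _ _ fun i hi => h _ _ (by omega)
    have h4 : z * (b * (E ^ m).coeff r) ∈ I := by
      have := I.sub_mem h3 (hlow (2 * H + X * derivative H))
      rwa [← mul_sub, add_sub_cancel_right] at this
    have h5 : z * (a * (E ^ m).coeff (r + 1) + (b * (E ^ m).coeff r +
        (X * (H * E ^ m)).coeff r)) ∈ I := by
      convert h1 using 2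
      rw [hE, coeff_add, coeff_C_mul, coeff_X_mul, hH, add_mul, coeff_add, coeff_C_mul,
        ← mul_assoc X H]
    have := I.sub_mem (I.sub_mem h5 h4) (hlow H)
    convert this using 1
    ring

theorem coeff_pow_mem_iterate {R : Type*} [CommRing R] [Algebra ℂ R] (I : Ideal R)
    (E : Polynomial R) {K S : ℕ} (hK : 2 ≤ K)
    (h : ∀ m r, r + S < K * m → (E ^ m).coeff r ∈ I) (s m r : ℕ)
    (hr : r + S < K * m + 2 * s) : E.coeff 0 ^ s * (E ^ m).coeff r ∈ I := by
  induction s generalizing m r with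
  | zero => simpa using h m r (by simpa using hr)
  | succ s ih =>
    rw [pow_succ]
    exact coeff_pow_mem_step I E _ hK ih m r (by omega)

open Polynomial in
-- In the binomial expansion of (E(0) + ζF)^m a term contributing in degree r uses ζF at most r
-- times, hence carries at least m - r ≥ s factors E(0).
theorem coeff_pow_mem_span_coeff_zero {R : Type*} [CommRing R] (E : R[X]) (s m r : ℕ)
    (h : r + s ≤ m) : (E ^ m).coeff r ∈ Ideal.span {E.coeff 0 ^ s} := by
  obtain ⟨F, hF⟩ : ∃ F : R[X], E = C (E.coeff 0) + X * F :=
    ⟨E.divX, by rw [add_comm, X_mul_divX_add]⟩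
  rw [hF, add_pow, finsetSum_coeff]
  refine Ideal.sum_mem _ fun k hk => ?_
  rw [Ideal.mem_span_singleton]
  by_cases hks : s ≤ k
  · rw [mul_assoc, ← C_pow, coeff_C_mul]
    simpa using (pow_dvd_pow (E.coeff 0) hks).mul_right _
  · have : (C (E.coeff 0) ^ k * (X * F) ^ (m - k) * (m.choose k : R[X])) =
      X ^ (m - k) * (C (E.coeff 0) ^ k * F ^ (m - k) * (m.choose k : R[X])) := by ring
    rw [this, coeff_X_pow_mul', if_neg (by omega)]
    exact dvd_zero _

/-- The polynomial ring in countably many variables. -/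
abbrev VarRing : Type := MvPolynomial ℕ ℂ

/-- The generating polynomial `∑_{k < n} Y_k ζᵏ`. -/
def genPoly (n : ℕ) : Polynomial VarRing :=
  ∑ k ∈ Finset.range n, Polynomial.C (MvPolynomial.X k) * Polynomial.X ^ k

/-- The relations of the fusion product of irreducible modules of dimensions `j + 1`, `j ∈ ξ`. -/
def FusionRelations (ξ : Multiset ℕ) (I : Ideal VarRing) : Prop :=
  (∀ k, ξ.card ≤ k → MvPolynomial.X k ∈ I) ∧
    ∀ m r, r < (ξ.map fun j => m - j).sum → (genPoly ξ.card ^ m).coeff r ∈ I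

/-- The monomials with exponents in `B` span the quotient by `I`. -/
def SpansModulo (I : Ideal VarRing) (B : Finset (ℕ →₀ ℕ)) : Prop :=
  ∀ p : VarRing, ∃ q ∈ Submodule.span ℂ ((fun b => MvPolynomial.monomial b (1 : ℂ)) '' B),
    p - q ∈ I

theorem genPoly_coeff_zero (n : ℕ) : (genPoly (n + 1)).coeff 0 = MvPolynomial.X 0 := by
  rw [genPoly, Finset.sum_range_succ']
  simp

/-- The substitution `Y_k ↦ Y_{k+1}`. -/
def shiftVar : VarRing →ₐ[ℂ] VarRing := MvPolynomial.rename Nat.succ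

theorem genPoly_succ (n : ℕ) : genPoly (n + 1) = Polynomial.C (MvPolynomial.X 0) +
    Polynomial.X * (genPoly n).map shiftVar.toRingHom := by
  rw [genPoly, Finset.sum_range_succ', add_comm, genPoly, Polynomial.map_sum, Finset.mul_sum,
    pow_zero, mul_one]
  refine congrArg _ (Finset.sum_congr rfl fun k _ => ?_)
  have : shiftVar.toRingHom (MvPolynomial.X k) = MvPolynomial.X (k + 1) :=
    MvPolynomial.rename_X _ _
  rw [Polynomial.map_mul, Polynomial.map_C, this, Polynomial.map_pow, Polynomial.map_X, pow_succ']
  ring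

theorem exists_eq_shiftVar_add (p : VarRing) :
    ∃ q r : VarRing, p = shiftVar q + MvPolynomial.X 0 * r := by
  induction p using MvPolynomial.induction_on with
  | C c => exact ⟨MvPolynomial.C c, 0, by simp [shiftVar]⟩
  | add p p' hp hp' =>
    obtain ⟨q, r, rfl⟩ := hp
    obtain ⟨q', r', rfl⟩ := hp'
    exact ⟨q + q', r + r', by rw [map_add]; ring⟩
  | mul_X p k hp =>
    obtain ⟨q, r, rfl⟩ := hp
    cases k with
    | zero => exact ⟨0, shiftVar q + MvPolynomial.X 0 * r, by rw [map_zero]; ring⟩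
    | succ k =>
      refine ⟨q * MvPolynomial.X k, r * MvPolynomial.X (k + 1), ?_⟩
      rw [map_mul, shiftVar, MvPolynomial.rename_X]
      ring

/-- The ideal of the `p` such that `Y_0 ^ s` times the shift of `p` is in `I`. -/
def shiftColon (I : Ideal VarRing) (s : ℕ) : Ideal VarRing :=
  Ideal.comap shiftVar.toRingHom
    (Submodule.comap (LinearMap.mulLeft VarRing (MvPolynomial.X 0 ^ s)) I)

theorem mem_shiftColon {I : Ideal VarRing} {s : ℕ} {p : VarRing} :
    p ∈ shiftColon I s ↔ MvPolynomial.X 0 ^ s * shiftVar p ∈ I := Iff.rfl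

/-- The kernel of R/I → R/(I + (Y_0^s)) is generated by Y_0^s and killed by Y_0, so p ↦ Y_0^s ·
shift(p) maps R/`shiftColon I s` onto it. Spanning monomials for the two ends therefore give
spanning monomials for the middle. -/
theorem SpansModulo.combine {I : Ideal VarRing} {s : ℕ} {B₁ B₂ : Finset (ℕ →₀ ℕ)}
    (hs : MvPolynomial.X 0 ^ (s + 1) ∈ I)
    (h₁ : SpansModulo (I ⊔ Ideal.span {MvPolynomial.X 0 ^ s}) B₁)
    (h₂ : SpansModulo (shiftColon I s) B₂) :
    ∃ B : Finset (ℕ →₀ ℕ), B.card ≤ B₁.card + B₂.card ∧ SpansModulo I B := by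
  classical
  let j : (ℕ →₀ ℕ) → (ℕ →₀ ℕ) := fun b => Finsupp.single 0 s + b.mapDomain Nat.succ
  refine ⟨B₁ ∪ B₂.image j, (Finset.card_union_le _ _).trans
    (Nat.add_le_add_left Finset.card_image_le _), fun p => ?_⟩
  obtain ⟨q₁, hq₁, hp⟩ := h₁ p
  obtain ⟨i, hi, c, hc, hic⟩ := Submodule.mem_sup.1 hp
  obtain ⟨c, rfl⟩ := Ideal.mem_span_singleton.1 hc
  obtain ⟨c', d, rfl⟩ := exists_eq_shiftVar_add c
  obtain ⟨q₂, hq₂, hc'⟩ := h₂ c'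
  rw [mem_shiftColon, map_sub] at hc'
  refine ⟨q₁ + MvPolynomial.X 0 ^ s * shiftVar q₂, Submodule.add_mem _ ?_ ?_, ?_⟩
  · refine Submodule.span_mono (Set.image_mono ?_) hq₁
    simp
  · have : Submodule.map ((LinearMap.mulLeft ℂ (MvPolynomial.X 0 ^ s : VarRing)) ∘ₗ
        shiftVar.toLinearMap) (Submodule.span ℂ ((fun b => MvPolynomial.monomial b (1 : ℂ)) '' B₂))
        ≤ Submodule.span ℂ ((fun b => MvPolynomial.monomial b (1 : ℂ)) '' ↑(B₁ ∪ B₂.image j)) := by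
      rw [Submodule.map_span_le]
      rintro _ ⟨b, hb, rfl⟩
      refine Submodule.subset_span ⟨j b, ?_, ?_⟩
      · simp only [Finset.coe_union, Finset.coe_image]
        exact Or.inr ⟨b, hb, rfl⟩
      · simp [j, shiftVar, MvPolynomial.rename_monomial, MvPolynomial.X_pow_eq_monomial,
          MvPolynomial.monomial_mul]
    exact this ⟨q₂, hq₂, rfl⟩
  · have : p - (q₁ + MvPolynomial.X 0 ^ s * shiftVar q₂) =
        i + MvPolynomial.X 0 ^ s * (shiftVar c' - shiftVar q₂) + d * MvPolynomial.X 0 ^ (s + 1) := by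
      linear_combination -hic
    rw [this]
    exact I.add_mem (I.add_mem hi hc') (I.mul_mem_left _ hs)

/-- Together with `sum_sub_filter_lt` this expresses the convexity of m ↦ ∑_j max(m - j, 0): it lies
above each of its linear pieces, and `coeff_pow_mem_iterate` requires a linear bound. -/
theorem card_mul_le_sum_sub_add_sum (A : Multiset ℕ) (m : ℕ) :
    A.card * m ≤ (A.map fun j => m - j).sum + A.sum := by
  induction A using Multiset.induction_on with
  | empty => simp
  | cons a A ih => simp only [Multiset.card_cons, Multiset.map_cons, Multiset.sum_cons, add_mul]; omega

theorem sum_sub_filter_lt (A : Multiset ℕ) (m : ℕ) :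
    ((A.filter (· < m)).map fun j => m - j).sum = (A.map fun j => m - j).sum ∧
    (A.filter (· < m)).card * m =
      ((A.filter (· < m)).map fun j => m - j).sum + (A.filter (· < m)).sum := by
  induction A using Multiset.induction_on with
  | empty => simp
  | cons a A ih =>
    obtain ⟨h1, h2⟩ := ih
    by_cases h : a < m
    · rw [Multiset.filter_cons_of_pos (p := (· < m)) _ h]
      simp only [Multiset.card_cons, Multiset.map_cons, Multiset.sum_cons, add_mul]
      omega
    · rw [Multiset.filter_cons_of_neg (p := (· < m)) _ h]
      simp only [Multiset.map_cons, Multiset.sum_cons]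
      omega

theorem sum_filter_le (A : Multiset ℕ) (p : ℕ → Prop) [DecidablePred p] (g : ℕ → ℕ) :
    ((A.filter p).map g).sum ≤ (A.map g).sum := by
  induction A using Multiset.induction_on with
  | empty => simp
  | cons a A ih =>
    by_cases h : p a
    · rw [Multiset.filter_cons_of_pos _ h]; simpa using ih
    · rw [Multiset.filter_cons_of_neg _ h]; simp; omega

theorem sum_sub_eq_zero {A : Multiset ℕ} {m : ℕ} (h : ∀ j ∈ A, m ≤ j) :
    (A.map fun j => m - j).sum = 0 := by
  refine Multiset.sum_eq_zero fun x hx => ?_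
  obtain ⟨j, hj, rfl⟩ := Multiset.mem_map.1 hx
  have := h j hj
  omega

theorem FusionRelations.pow_mem {s : ℕ} {σ : Multiset ℕ} {I : Ideal VarRing}
    (h : FusionRelations (s ::ₘ σ) I) : MvPolynomial.X 0 ^ (s + 1) ∈ I := by
  have := h.2 (s + 1) 0 (by simp)
  rwa [Polynomial.coeff_zero_eq_eval_zero, Polynomial.eval_pow,
    ← Polynomial.coeff_zero_eq_eval_zero, Multiset.card_cons, genPoly_coeff_zero] at this

/-- In the quotient by `Y_0 ^ (s + 1)` the smallest entry `s + 1` becomes `s` and another entry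
grows by one. -/
theorem FusionRelations.sup_pow {s t : ℕ} {ρ : Multiset ℕ} {I : Ideal VarRing}
    (h : FusionRelations ((s + 1) ::ₘ t ::ₘ ρ) I) (hρ : ∀ j ∈ ρ, t ≤ j) :
    FusionRelations (s ::ₘ (t + 1) ::ₘ ρ) (I ⊔ Ideal.span {MvPolynomial.X 0 ^ (s + 1)}) := by
  refine ⟨fun k hk => Submodule.mem_sup_left (h.1 k (by simpa using hk)), fun m r hr => ?_⟩
  simp only [Multiset.map_cons, Multiset.sum_cons, Multiset.card_cons] at hr ⊢
  by_cases hr' : r < (m - (s + 1)) + ((m - t) + (ρ.map fun j => m - j).sum)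
  · exact Submodule.mem_sup_left (by simpa using h.2 m r (by simpa using hr'))
  · refine Submodule.mem_sup_right ?_
    rw [← genPoly_coeff_zero (ρ.card + 1)]
    refine coeff_pow_mem_span_coeff_zero _ _ _ _ ?_
    -- For m > t the old bound is at least the new one. For m ≤ t only the entry s contributes to
    -- the new bound, and r < m - s means r + (s + 1) ≤ m.
    have hmt : m ≤ t := by omega
    rw [sum_sub_eq_zero fun j hj => hmt.trans (hρ j hj)] at hr
    omega

theorem FusionRelations.sup_pow_singleton {s : ℕ} {I : Ideal VarRing}
    (h : FusionRelations {s + 1} I) :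
    FusionRelations {s} (I ⊔ Ideal.span {MvPolynomial.X 0 ^ (s + 1)}) := by
  refine ⟨fun k hk => Submodule.mem_sup_left (h.1 k (by simpa using hk)), fun m r hr => ?_⟩
  refine Submodule.mem_sup_right ?_
  rw [Multiset.card_singleton, ← genPoly_coeff_zero 0]
  refine coeff_pow_mem_span_coeff_zero _ _ _ _ ?_
  simp at hr
  omega

/-- Multiplication by Y_0^s kills 2s more coefficients of E^m than the relations provide. Since
Y_0^(s+1) ∈ I, one also has Y_0^s E^m ≡ Y_0^s ζ^m shift(E₁)^m, with E₁ the generating polynomial in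
one variable fewer, and the two smallest entries s, t merge into t - s. -/
theorem FusionRelations.shiftColon {s t : ℕ} {ρ : Multiset ℕ} {I : Ideal VarRing}
    (h : FusionRelations (s ::ₘ t ::ₘ ρ) I) (hst : s ≤ t) (hρ : ∀ j ∈ ρ, t ≤ j) :
    FusionRelations ((t - s) ::ₘ ρ) (shiftColon I s) := by
  refine ⟨fun k hk => ?_, fun m r hr => ?_⟩
  · rw [mem_shiftColon, FusionSl2.shiftVar, MvPolynomial.rename_X]
    exact I.mul_mem_left _ (h.1 _ (by simpa using hk))
  · rw [mem_shiftColon]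
    simp only [Multiset.map_cons, Multiset.sum_cons, Multiset.card_cons] at hr ⊢
    have hm : t - s < m := by
      by_contra hm
      rw [sum_sub_eq_zero fun j hj => (by have := hρ j hj; omega : m ≤ j)] at hr
      omega
    set E := genPoly (ρ.card + 1 + 1) with hE
    -- The truncated sum is replaced by its linear piece at m, of slope 2 plus the number of j ∈ ρ
    -- with j < m. The gain 2s turns (m - s) + (m - t) into m + (m - (t - s)), and the summand m is
    -- absorbed by the factor ζ^m below.
    have key : E.coeff 0 ^ s * (E ^ m).coeff (r + m) ∈ I := by
      obtain ⟨h1, h2⟩ := sum_sub_filter_lt ρ m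
      refine coeff_pow_mem_iterate I E (K := (ρ.filter (· < m)).card + 2)
        (S := (ρ.filter (· < m)).sum + s + t) (by omega) (fun m' r' hr' => ?_) s m (r + m) ?_
      · rw [hE, ← Multiset.card_cons t, ← Multiset.card_cons s]
        refine h.2 m' r' ?_
        have h3 := card_mul_le_sum_sub_add_sum (ρ.filter (· < m)) m'
        have h4 := sum_filter_le ρ (· < m) (fun j => m' - j)
        simp only [Multiset.map_cons, Multiset.sum_cons]
        rw [add_mul] at hr'
        omega
      · rw [add_mul]
        omega
    have hE0 : E.coeff 0 = MvPolynomial.X 0 := genPoly_coeff_zero _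
    have hE1 := genPoly_succ (ρ.card + 1)
    rw [← hE] at hE1
    -- E and ζ · shift(E₁) differ by the constant Y_0, so their m-th powers differ by a multiple of
    -- Y_0, which Y_0^s moves into I.
    obtain ⟨G, hG⟩ := sub_dvd_pow_sub_pow E
      (Polynomial.X * (genPoly (ρ.card + 1)).map shiftVar.toRingHom) m
    have hG1 : E - Polynomial.X * (genPoly (ρ.card + 1)).map shiftVar.toRingHom =
        Polynomial.C (MvPolynomial.X 0) := by rw [hE1]; ring
    rw [hG1] at hG
    have hc := congrArg (fun p => p.coeff (r + m)) hG
    simp only [Polynomial.coeff_sub, mul_pow, Polynomial.coeff_C_mul,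
      Polynomial.coeff_X_pow_mul, ← Polynomial.map_pow, Polynomial.coeff_map] at hc
    rw [hE0] at key
    have := I.sub_mem key (I.mul_mem_left (G.coeff (r + m)) h.pow_mem)
    convert this using 1
    change _ - shiftVar _ = _ at hc
    linear_combination (-MvPolynomial.X 0 ^ s) * hc

theorem FusionRelations.shiftColon_singleton {s : ℕ} {I : Ideal VarRing}
    (h : FusionRelations {s} I) : FusionRelations 0 (FusionSl2.shiftColon I s) := by
  refine ⟨fun k _ => ?_, fun m r hr => absurd hr (by simp)⟩
  rw [mem_shiftColon, FusionSl2.shiftVar, MvPolynomial.rename_X]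
  exact I.mul_mem_left _ (h.1 _ (by simp))

theorem SpansModulo.of_eq_top (I : Ideal VarRing) (h : I = ⊤) : SpansModulo I ∅ :=
  fun p => ⟨0, by simp, by simp [h]⟩

theorem exists_cons_min {ξ : Multiset ℕ} {n : ℕ} (h : ξ.card = n + 1) :
    ∃ s σ, ξ = s ::ₘ σ ∧ σ.card = n ∧ ∀ j ∈ σ, s ≤ j := by
  classical
  have hne : ξ.toFinset.Nonempty := by
    rw [Multiset.toFinset_nonempty]
    rintro rfl
    simp at h
  have hs := Finset.min'_mem _ hne
  rw [Multiset.mem_toFinset] at hs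
  obtain ⟨σ, hσ⟩ := Multiset.exists_cons_of_mem hs
  refine ⟨_, σ, hσ, ?_, fun j hj => Finset.min'_le _ _ ?_⟩
  · rw [hσ] at h; simpa using h
  · rw [Multiset.mem_toFinset, hσ]; exact Multiset.mem_cons_of_mem hj

/-- Double induction, on the number of entries and on the smallest entry s: `SpansModulo.combine`
splits the quotient into one where s has decreased by one and one with fewer entries. The bounds add
up to the product. -/
theorem FusionRelations.exists_spansModulo (n : ℕ) : ∀ (ξ : Multiset ℕ) (I : Ideal VarRing),
    ξ.card = n → FusionRelations ξ I →
    ∃ B : Finset (ℕ →₀ ℕ), B.card ≤ (ξ.map (· + 1)).prod ∧ SpansModulo I B := by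
  induction n with
  | zero =>
    intro ξ I hξ h
    rw [Multiset.card_eq_zero] at hξ
    subst hξ
    refine ⟨{0}, by simp, fun p => ?_⟩
    induction p using MvPolynomial.induction_on with
    | C c => exact ⟨MvPolynomial.C c, by
        rw [MvPolynomial.C_eq_smul_one]
        exact Submodule.smul_mem _ _ (Submodule.subset_span ⟨0, by simp, by simp⟩), by simp⟩
    | add p p' hp hp' =>
      obtain ⟨q, hq, hpq⟩ := hp
      obtain ⟨q', hq', hpq'⟩ := hp'
      exact ⟨q + q', add_mem hq hq', by rw [add_sub_add_comm]; exact add_mem hpq hpq'⟩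
    | mul_X p k _ => exact ⟨0, zero_mem _, by
        rw [sub_zero]; exact I.mul_mem_left _ (h.1 k (by simp))⟩
  | succ n ih =>
    intro ξ I hξ h
    obtain ⟨s, σ, rfl, hσ, hmin⟩ := exists_cons_min hξ
    clear hξ
    induction s generalizing σ I with
    | zero =>
      -- For smallest entry 0 the exponent in `SpansModulo.combine` is 0, so the quotient by Y_0^0 =
      -- 1 contributes nothing and only the colon ideal remains.
      have h1 := SpansModulo.of_eq_top (I ⊔ Ideal.span {MvPolynomial.X 0 ^ 0}) (by simp)
      cases n with
      | zero =>
        rw [Multiset.card_eq_zero] at hσ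
        subst hσ
        obtain ⟨B, hB, hB'⟩ := ih 0 _ rfl h.shiftColon_singleton
        obtain ⟨B', hB1, hB2⟩ := SpansModulo.combine h.pow_mem h1 hB'
        exact ⟨B', by simpa using hB1.trans (Nat.add_le_add_left hB _), hB2⟩
      | succ n =>
        obtain ⟨t, ρ, rfl, hρ, hmin'⟩ := exists_cons_min hσ
        obtain ⟨B, hB, hB'⟩ := ih _ _ (by simpa using hρ)
          (h.shiftColon (hmin t (by simp)) hmin')
        obtain ⟨B', hB1, hB2⟩ := SpansModulo.combine h.pow_mem h1 hB'
        exact ⟨B', by simpa using hB1.trans (Nat.add_le_add_left hB _), hB2⟩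
    | succ s ihs =>
      cases n with
      | zero =>
        rw [Multiset.card_eq_zero] at hσ
        subst hσ
        obtain ⟨B, hB, hB'⟩ := ih 0 _ rfl h.shiftColon_singleton
        obtain ⟨B₁, hB₁, hB₁'⟩ := ihs _ 0 h.sup_pow_singleton rfl (by simp)
        obtain ⟨B', hB1, hB2⟩ := SpansModulo.combine h.pow_mem hB₁' hB'
        exact ⟨B', by simpa using hB1.trans (Nat.add_le_add hB₁ hB), hB2⟩
      | succ n =>
        obtain ⟨t, ρ, rfl, hρ, hmin'⟩ := exists_cons_min hσ
        have hst := hmin t (by simp)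
        obtain ⟨B, hB, hB'⟩ := ih _ _ (by simpa using hρ) (h.shiftColon hst hmin')
        obtain ⟨B₁, hB₁, hB₁'⟩ := ihs _ ((t + 1) ::ₘ ρ) (h.sup_pow hmin') (by simpa using hρ) (by
          intro j hj
          rcases Multiset.mem_cons.1 hj with rfl | hj
          · omega
          · have := hmin' j hj; omega)
        obtain ⟨B', hB1, hB2⟩ := SpansModulo.combine h.pow_mem hB₁' hB'
        refine ⟨B', (hB1.trans (Nat.add_le_add hB₁ hB)).trans (le_of_eq ?_), hB2⟩
        simp only [Multiset.map_cons, Multiset.prod_cons]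
        -- The count closes by (s + 2)(t + 1) = (s + 1)(t + 2) + (t - s).
        obtain ⟨d, rfl⟩ := Nat.exists_eq_add_of_le hst
        rw [Nat.add_sub_cancel_left]
        ring

end Spanning

/-! ### The standard triple of sl₂ -/

section Triple

/-- The raising element `e`. -/
abbrev sl2E : Sl2 := LieAlgebra.SpecialLinear.single (R := ℂ) (0 : Fin 2) 1 zero_ne_one 1

/-- The lowering element `f`. -/
abbrev sl2F : Sl2 := LieAlgebra.SpecialLinear.single (R := ℂ) (1 : Fin 2) 0 one_ne_zero 1

/-- The semisimple element `h`. -/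
def sl2H : Sl2 := ⁅sl2E, sl2F⁆

theorem sl2E_val : sl2E.val = !![0, 1; 0, 0] := by
  rw [LieAlgebra.SpecialLinear.val_single]
  ext i j
  fin_cases i <;> fin_cases j <;> simp [Matrix.single]

theorem sl2F_val : sl2F.val = !![0, 0; 1, 0] := by
  rw [LieAlgebra.SpecialLinear.val_single]
  ext i j
  fin_cases i <;> fin_cases j <;> simp [Matrix.single]

theorem sl2H_val : sl2H.val = !![1, 0; 0, -1] := by
  rw [sl2H, LieAlgebra.SpecialLinear.sl_bracket, sl2E_val, sl2F_val]
  ext i j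
  fin_cases i <;> fin_cases j <;> simp

theorem isSl2Triple : IsSl2Triple sl2H sl2E sl2F where
  h_ne_zero h := by
    have := congrArg (fun x : Sl2 => x.val 0 0) h
    simp [sl2H_val] at this
  lie_e_f := rfl
  lie_h_e_nsmul := by
    apply Subtype.ext
    change _ = 2 • sl2E.val
    rw [LieAlgebra.SpecialLinear.sl_bracket, sl2H_val, sl2E_val]
    ext i j
    fin_cases i <;> fin_cases j <;> simp <;> norm_num
  lie_h_f_nsmul := by
    apply Subtype.ext
    change _ = -(2 • sl2F.val)
    rw [LieAlgebra.SpecialLinear.sl_bracket, sl2H_val, sl2F_val]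
    ext i j
    fin_cases i <;> fin_cases j <;> simp <;> norm_num

theorem sl2_decomp (x : Sl2) : ∃ a b c : ℂ, x = a • sl2E + b • sl2F + c • sl2H := by
  refine ⟨x.val 0 1, x.val 1 0, x.val 0 0, ?_⟩
  have htr : x.val 0 0 + x.val 1 1 = 0 := by
    have : Matrix.trace x.val = 0 := x.2
    simpa [Matrix.trace, Fin.sum_univ_two] using this
  apply Subtype.ext
  have e : ((x.val 0 1 • sl2E + x.val 1 0 • sl2F + x.val 0 0 • sl2H : Sl2) : Matrix _ _ ℂ) =
    x.val 0 1 • sl2E.val + x.val 1 0 • sl2F.val + x.val 0 0 • sl2H.val := rfl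
  rw [e, sl2H_val, sl2E_val, sl2F_val]
  ext i j
  fin_cases i <;> fin_cases j <;> simp
  linear_combination htr

/-- A property which is preserved by linear combinations and brackets holds on `sl₂` as soon as it
holds for `e` and `f`. -/
theorem sl2_induction {P : Sl2 → Prop} (he : P sl2E) (hf : P sl2F)
    (hadd : ∀ x y, P x → P y → P (x + y)) (hsmul : ∀ (c : ℂ) x, P x → P (c • x))
    (hlie : ∀ x y, P x → P y → P ⁅x, y⁆) (x : Sl2) : P x := by
  obtain ⟨a, b, c, rfl⟩ := sl2_decomp x
  exact hadd _ _ (hadd _ _ (hsmul _ _ he) (hsmul _ _ hf)) (hsmul _ _ (hlie _ _ he hf))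

/-- A submodule stable under `e` and `f` is a Lie submodule. -/
def lieSubmoduleOfStable {M : Type*} [AddCommGroup M] [Module ℂ M] [LieRingModule Sl2 M]
    [LieModule ℂ Sl2 M] (N : Submodule ℂ M) (he : ∀ m ∈ N, ⁅sl2E, m⁆ ∈ N)
    (hf : ∀ m ∈ N, ⁅sl2F, m⁆ ∈ N) : LieSubmodule ℂ Sl2 M where
  toSubmodule := N
  lie_mem := by
    intro x
    refine sl2_induction (P := fun x => ∀ {m}, m ∈ N → ⁅x, m⁆ ∈ N) (he _) (hf _) ?_ ?_ ?_ x
    · intro x y hx hy m hm; rw [add_lie]; exact N.add_mem (hx hm) (hy hm)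
    · intro c x hx m hm; rw [smul_lie]; exact N.smul_mem _ (hx hm)
    · intro x y hx hy m hm; rw [lie_lie]; exact N.sub_mem (hx (hy hm)) (hy (hx hm))

end Triple

/-! ### Primitive vectors and the irreducible modules they generate -/

section Chain

variable {M : Type*} [AddCommGroup M] [Module ℂ M] [LieRingModule Sl2 M] [LieModule ℂ Sl2 M]

/-- `w` is a non-zero vector killed by `f`, of weight `-d`. -/
abbrev IsPrimitive (w : M) (d : ℕ) : Prop :=
  isSl2Triple.symm.HasPrimitiveVectorWith w (d : ℂ)

/-- The vector `eᵖ w`. -/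
def raised (w : M) (p : ℕ) : M := (LieModule.toEnd ℂ Sl2 M sl2E ^ p) w

@[simp]
theorem raised_zero (w : M) : raised w 0 = w := rfl

theorem lie_e_raised (w : M) (p : ℕ) : ⁅sl2E, raised w p⁆ = raised w (p + 1) := by
  simp only [raised, pow_succ', Module.End.mul_apply, LieModule.toEnd_apply_apply]

variable {w : M} {d : ℕ} (hw : IsPrimitive w d)
include hw

omit [LieModule ℂ Sl2 M] in
theorem lie_f_raised_zero : ⁅sl2F, w⁆ = 0 := hw.lie_e

theorem lie_f_raised (p : ℕ) :
    ⁅sl2F, raised w (p + 1)⁆ = (((p : ℂ) + 1) * (d - p)) • raised w p :=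
  hw.lie_e_pow_succ_toEnd_f p

theorem lie_h_raised (p : ℕ) : ⁅sl2H, raised w p⁆ = ((2 : ℂ) * p - d) • raised w p := by
  have := hw.lie_h_pow_toEnd_f p
  rw [neg_lie, neg_eq_iff_eq_neg, ← neg_smul, neg_sub] at this
  exact this

theorem raised_ne_zero {p : ℕ} (hp : p ≤ d) : raised w p ≠ 0 :=
  hw.pow_toEnd_f_ne_zero_of_eq_nat rfl hp

theorem raised_linearIndependent : LinearIndependent ℂ fun p : Fin (d + 1) => raised w p := by
  refine Module.End.eigenvectors_linearIndependent' (LieModule.toEnd ℂ Sl2 M sl2H)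
    (fun p : Fin (d + 1) => (2 : ℂ) * (p : ℕ) - d) ?_ _ fun p => ⟨?_, ?_⟩
  · intro p q h
    simpa [Fin.ext_iff] using h
  · rw [Module.End.mem_eigenspace_iff]
    exact lie_h_raised hw p
  · exact raised_ne_zero hw (Nat.lt_succ_iff.1 p.2)

theorem span_raised_eq_smul_of_lie_f_eq_zero {v : M}
    (hv : v ∈ Submodule.span ℂ (Set.range fun p : Fin (d + 1) => raised w p))
    (hfv : ⁅sl2F, v⁆ = 0) : ∃ c : ℂ, v = c • w := by
  obtain ⟨c, rfl⟩ := (Submodule.mem_span_range_iff_exists_fun ℂ).1 hv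
  have hli := raised_linearIndependent hw
  rw [Fin.sum_univ_succ, lie_add, lie_smul, Fin.val_zero, raised_zero, lie_f_raised_zero hw,
    smul_zero, zero_add, lie_sum] at hfv
  simp only [lie_smul, Fin.val_succ, lie_f_raised hw, smul_smul] at hfv
  have hli' : LinearIndependent ℂ fun p : Fin d => raised w p :=
    hli.comp Fin.castSucc (Fin.castSucc_injective d)
  have h0 := Fintype.linearIndependent_iff.1 hli' _ hfv
  refine ⟨c 0, ?_⟩
  rw [Fin.sum_univ_succ, Finset.sum_eq_zero, add_zero]
  · rfl
  · intro p _
    have := h0 p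
    have hp : (d : ℂ) - (p : ℕ) ≠ 0 := by
      rw [sub_ne_zero]
      exact_mod_cast p.2.ne'
    have hp' : ((p : ℕ) : ℂ) + 1 ≠ 0 := Nat.cast_add_one_ne_zero _
    rw [(mul_eq_zero.1 this).resolve_right (mul_ne_zero hp' hp), zero_smul]

theorem span_raised_eq_smul_of_lie_e_eq_zero {v : M}
    (hv : v ∈ Submodule.span ℂ (Set.range fun p : Fin (d + 1) => raised w p))
    (hev : ⁅sl2E, v⁆ = 0) : ∃ c : ℂ, v = c • raised w d := by
  obtain ⟨c, rfl⟩ := (Submodule.mem_span_range_iff_exists_fun ℂ).1 hv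
  have hli := raised_linearIndependent hw
  -- Finite dimension is not available here, so e^(d+1) w may be non-zero. In that case e is
  -- injective on the span and v = 0.
  by_cases hd : raised w (d + 1) = 0
  · rw [Fin.sum_univ_castSucc, lie_add, lie_smul, Fin.val_last, lie_e_raised, hd,
      smul_zero, add_zero, lie_sum] at hev
    simp only [lie_smul, Fin.val_castSucc, lie_e_raised] at hev
    have hli' : LinearIndependent ℂ fun p : Fin d => raised w ((p : ℕ) + 1) :=
      hli.comp Fin.succ (Fin.succ_injective d)
    have h0 := Fintype.linearIndependent_iff.1 hli' _ hev
    refine ⟨c (Fin.last d), ?_⟩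
    rw [Fin.sum_univ_castSucc, Finset.sum_eq_zero, zero_add]
    · rfl
    · intro p _
      rw [h0 p, zero_smul]
  · have hli'' : LinearIndependent ℂ fun p : Fin (d + 1) => raised w ((p : ℕ) + 1) := by
      refine Module.End.eigenvectors_linearIndependent' (LieModule.toEnd ℂ Sl2 M sl2H)
        (fun p : Fin (d + 1) => (2 : ℂ) * ((p : ℕ) + 1 : ℕ) - d) ?_ _ fun p => ⟨?_, ?_⟩
      · intro p q h
        simpa [Fin.ext_iff] using h
      · rw [Module.End.mem_eigenspace_iff]
        exact lie_h_raised hw _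
      · rcases (Nat.lt_succ_iff.1 p.2).lt_or_eq with h | h
        · exact raised_ne_zero hw h
        · rw [h]; exact hd
    rw [lie_sum] at hev
    simp only [lie_smul, lie_e_raised] at hev
    have h0 := Fintype.linearIndependent_iff.1 hli'' _ hev
    exact ⟨0, by simp [h0]⟩

variable [FiniteDimensional ℂ M]

theorem raised_eq_zero {p : ℕ} (hp : d < p) : raised w p = 0 := by
  have h : raised w (d + 1) = 0 := hw.pow_toEnd_f_eq_zero_of_eq_nat rfl
  obtain ⟨q, rfl⟩ := Nat.exists_eq_add_of_le' (Nat.succ_le_of_lt hp)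
  rw [raised, pow_add, Module.End.mul_apply]
  rw [raised] at h
  rw [h, map_zero]

/-- The Lie submodule spanned by the vectors `eᵖ w`, for a primitive vector `w`. -/
def chainSubmodule : LieSubmodule ℂ Sl2 M :=
  lieSubmoduleOfStable (Submodule.span ℂ (Set.range fun p : Fin (d + 1) => raised w p))
    (fun m hm => by
      have : Submodule.map (LieModule.toEnd ℂ Sl2 M sl2E)
          (Submodule.span ℂ (Set.range fun p : Fin (d + 1) => raised w p)) ≤
          Submodule.span ℂ (Set.range fun p : Fin (d + 1) => raised w p) := by
        rw [Submodule.map_span_le]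
        rintro _ ⟨p, rfl⟩
        rw [LieModule.toEnd_apply_apply, lie_e_raised]
        rcases (Nat.lt_succ_iff.1 p.2).lt_or_eq with h | h
        · exact Submodule.subset_span ⟨⟨p + 1, by omega⟩, rfl⟩
        · rw [h, raised_eq_zero hw (Nat.lt_succ_self d)]
          exact Submodule.zero_mem _
      exact this ⟨m, hm, rfl⟩)
    (fun m hm => by
      have : Submodule.map (LieModule.toEnd ℂ Sl2 M sl2F)
          (Submodule.span ℂ (Set.range fun p : Fin (d + 1) => raised w p)) ≤
          Submodule.span ℂ (Set.range fun p : Fin (d + 1) => raised w p) := by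
        rw [Submodule.map_span_le]
        rintro _ ⟨p, rfl⟩
        rw [LieModule.toEnd_apply_apply]
        refine Fin.cases ?_ (fun p => ?_) p
        · beta_reduce
          rw [Fin.val_zero, raised_zero, lie_f_raised_zero hw]
          exact Submodule.zero_mem _
        · beta_reduce
          rw [Fin.val_succ, lie_f_raised hw]
          exact Submodule.smul_mem _ _ (Submodule.subset_span ⟨p.castSucc, rfl⟩)
      exact this ⟨m, hm, rfl⟩)

theorem chainSubmodule_toSubmodule : (chainSubmodule hw).toSubmodule =
    Submodule.span ℂ (Set.range fun p : Fin (d + 1) => raised w p) := rfl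

theorem raised_mem_chainSubmodule (p : ℕ) : raised w p ∈ chainSubmodule hw := by
  by_cases h : p ≤ d
  · exact Submodule.subset_span ⟨⟨p, Nat.lt_succ_of_le h⟩, rfl⟩
  · rw [raised_eq_zero hw (not_le.1 h)]
    exact zero_mem _

theorem mem_chainSubmodule : w ∈ chainSubmodule hw := raised_mem_chainSubmodule hw 0

theorem finrank_chainSubmodule : Module.finrank ℂ (chainSubmodule hw) = d + 1 := by
  have := finrank_span_eq_card (raised_linearIndependent hw)
  rw [Fintype.card_fin] at this
  exact this

theorem chainSubmodule_le {N : LieSubmodule ℂ Sl2 M} (h : w ∈ N) : chainSubmodule hw ≤ N := by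
  have hr : ∀ p, raised w p ∈ N := by
    intro p
    induction p with
    | zero => exact h
    | succ p ih => rw [← lie_e_raised]; exact N.lie_mem ih
  rw [← LieSubmodule.toSubmodule_le_toSubmodule, chainSubmodule_toSubmodule, Submodule.span_le]
  rintro _ ⟨p, rfl⟩
  exact hr p

omit hw in
theorem exists_isPrimitive [Nontrivial M] : ∃ (w : M) (d : ℕ), IsPrimitive w d := by
  obtain ⟨μ, w, -, hw⟩ := isSl2Triple.symm.exists_hasPrimitiveVectorWith (R := ℂ) (M := M)
  obtain ⟨d, rfl⟩ := hw.exists_nat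
  exact ⟨w, d, hw⟩

/-- A non-zero submodule contains a primitive vector. Inside the span of the e^p w only multiples of
w are killed by f, so the submodule contains w and with it everything. -/
theorem chainSubmodule_isIrreducible : LieModule.IsIrreducible ℂ Sl2 (chainSubmodule hw) := by
  have : Nontrivial (chainSubmodule hw) :=
    ⟨⟨w, mem_chainSubmodule hw⟩, 0, fun h => hw.ne_zero (congrArg Subtype.val h)⟩
  refine LieModule.IsIrreducible.mk fun N hN => ?_
  have : Nontrivial N := (LieSubmodule.nontrivial_iff_ne_bot ℂ Sl2 _).2 hN
  obtain ⟨x, d', hx⟩ := exists_isPrimitive (M := N)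
  obtain ⟨c, hc⟩ := span_raised_eq_smul_of_lie_f_eq_zero hw x.1.2
    (congrArg (fun y : N => (y.1.1 : M)) (lie_f_raised_zero hx))
  have hc0 : c ≠ 0 := by
    rintro rfl
    rw [zero_smul] at hc
    exact hx.ne_zero (Subtype.ext (Subtype.ext hc))
  have hwN : (⟨w, mem_chainSubmodule hw⟩ : chainSubmodule hw) ∈ N := by
    have : (⟨w, mem_chainSubmodule hw⟩ : chainSubmodule hw) = c⁻¹ • x.1 := by
      apply Subtype.ext
      rw [LieSubmodule.coe_smul, hc, smul_smul, inv_mul_cancel₀ hc0, one_smul]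
    rw [this]
    exact N.smul_mem _ x.2
  have hle : chainSubmodule hw ≤ N.map (chainSubmodule hw).incl :=
    chainSubmodule_le hw ⟨_, hwN, rfl⟩
  rw [eq_top_iff]
  intro y _
  obtain ⟨y', hy', hyy'⟩ := hle y.2
  have : y' = y := Subtype.ext hyy'
  rwa [← this]

theorem chainSubmodule_eq_top [LieModule.IsIrreducible ℂ Sl2 M] : chainSubmodule hw = ⊤ :=
  (eq_bot_or_eq_top _).resolve_left fun h => hw.ne_zero (by
    have := mem_chainSubmodule hw
    rwa [h, LieSubmodule.mem_bot] at this)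

theorem span_raised_eq_top [LieModule.IsIrreducible ℂ Sl2 M] :
    Submodule.span ℂ (Set.range fun p : Fin (d + 1) => raised w p) = ⊤ := by
  rw [← chainSubmodule_toSubmodule hw, chainSubmodule_eq_top hw]
  rfl

/-- The basis of an irreducible module consisting of the vectors `eᵖ w`. -/
def raisedBasis [LieModule.IsIrreducible ℂ Sl2 M] : Module.Basis (Fin (d + 1)) ℂ M :=
  Module.Basis.mk (raised_linearIndependent hw) (span_raised_eq_top hw).ge

@[simp]
theorem raisedBasis_apply [LieModule.IsIrreducible ℂ Sl2 M] (p : Fin (d + 1)) :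
    raisedBasis hw p = raised w p := by
  simp [raisedBasis]

theorem IsPrimitive.finrank_eq [LieModule.IsIrreducible ℂ Sl2 M] :
    Module.finrank ℂ M = d + 1 := by
  rw [Module.finrank_eq_card_basis (raisedBasis hw), Fintype.card_fin]

omit hw in
theorem IsHighest.isPrimitive [LieModule.IsIrreducible ℂ Sl2 M] {u : M} (hu : IsHighest u) :
    IsPrimitive u (Module.finrank ℂ M - 1) := by
  have : Nontrivial M := ⟨u, 0, hu.1⟩
  obtain ⟨w, d, hw⟩ := exists_isPrimitive (M := M)
  obtain ⟨c, rfl⟩ := span_raised_eq_smul_of_lie_f_eq_zero hw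
    (by rw [span_raised_eq_top hw]; exact Submodule.mem_top : u ∈ _) hu.2
  rw [hw.finrank_eq, Nat.add_sub_cancel]
  refine ⟨hu.1, ?_, hu.2⟩
  rw [lie_smul, hw.lie_h, smul_comm]

end Chain

/-! ### The Casimir element and orthogonality -/

section Casimir

variable {M : Type*} [AddCommGroup M] [Module ℂ M] [LieRingModule Sl2 M] [LieModule ℂ Sl2 M]

/-- The action of the Casimir element `h² + 2ef + 2fe`. -/
def casimir (v : M) : M :=
  ⁅sl2H, ⁅sl2H, v⁆⁆ + (2 : ℂ) • ⁅sl2E, ⁅sl2F, v⁆⁆ + (2 : ℂ) • ⁅sl2F, ⁅sl2E, v⁆⁆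

theorem casimir_raised {w : M} {d : ℕ} (hw : IsPrimitive w d) (p : ℕ) :
    casimir (raised w p) = ((d : ℂ) * (d + 2)) • raised w p := by
  rw [casimir, lie_h_raised hw, lie_smul, lie_h_raised hw, lie_e_raised, lie_f_raised hw]
  cases p with
  | zero =>
    rw [raised_zero, lie_f_raised_zero hw, lie_zero, smul_zero, smul_smul, smul_smul, add_zero,
      ← add_smul]
    congr 1
    push_cast
    ring
  | succ p =>
    rw [lie_f_raised hw, lie_smul, lie_e_raised]
    simp only [smul_smul, ← add_smul]
    congr 1
    push_cast
    ring

theorem casimir_eq_of_isIrreducible [FiniteDimensional ℂ M] (U : LieSubmodule ℂ Sl2 M)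
    (hU : LieModule.IsIrreducible ℂ Sl2 U) {d : ℕ} (hd : Module.finrank ℂ U = d + 1) {v : M}
    (hv : v ∈ U) : casimir v = ((d : ℂ) * (d + 2)) • v := by
  have : Nontrivial U := Module.nontrivial_of_finrank_pos (R := ℂ) (by omega)
  obtain ⟨w, d', hw⟩ := exists_isPrimitive (M := U)
  have hd' : d' = d := by
    have := hw.finrank_eq
    omega
  subst hd'
  have key : ∀ x : U, casimir x = ((d' : ℂ) * (d' + 2)) • x := by
    intro x
    have hx : x ∈ Submodule.span ℂ (Set.range fun p : Fin (d' + 1) => raised w p) := by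
      rw [span_raised_eq_top hw]; exact Submodule.mem_top
    induction hx using Submodule.span_induction with
    | mem x hx => obtain ⟨p, rfl⟩ := hx; exact casimir_raised hw p
    | zero => simp [casimir]
    | add x y _ _ hx hy =>
      rw [smul_add, ← hx, ← hy]
      simp only [casimir, lie_add, smul_add]
      abel
    | smul c x _ hx =>
      rw [smul_comm, ← hx]
      simp only [casimir, lie_smul, smul_add, smul_comm c]
  exact congrArg (fun x : U => (x : M)) (key ⟨v, hv⟩)

omit [LieModule ℂ Sl2 M] in
-- An invariant form makes the Casimir operator self-adjoint. This is the source of all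
-- orthogonality between components of W_i ⊗ W_j.
theorem casimir_orthogonal {B : LinearMap.BilinForm ℂ M} (hB : B.lieInvariant Sl2) {v w : M}
    {c d : ℂ} (hv : casimir v = c • v) (hw : casimir w = d • w) (h : c ≠ d) : B v w = 0 := by
  have hB2 : ∀ x y : Sl2, ∀ v w : M, B ⁅x, ⁅y, v⁆⁆ w = B v ⁅y, ⁅x, w⁆⁆ := by
    intro x y v w
    rw [hB, hB, neg_neg]
  have key : B (casimir v) w = B v (casimir w) := by
    simp only [casimir, map_add, map_smul, LinearMap.add_apply, LinearMap.smul_apply, hB2]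
    ring
  rw [hv, hw, map_smul, LinearMap.smul_apply, map_smul, ← sub_eq_zero, ← sub_smul] at key
  exact (smul_eq_zero.1 key).resolve_left (sub_ne_zero.2 h)

end Casimir

/-! ### Invariant bilinear forms on irreducible modules -/

section InvariantForm

variable {M : Type*} [AddCommGroup M] [Module ℂ M] [LieRingModule Sl2 M] [LieModule ℂ Sl2 M]

theorem lieInvariant_of_e_f {B : LinearMap.BilinForm ℂ M}
    (he : ∀ y z, B ⁅sl2E, y⁆ z = -B y ⁅sl2E, z⁆) (hf : ∀ y z, B ⁅sl2F, y⁆ z = -B y ⁅sl2F, z⁆) :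
    B.lieInvariant Sl2 := by
  intro x
  refine sl2_induction (P := fun x => ∀ y z, B ⁅x, y⁆ z = -B y ⁅x, z⁆) he hf ?_ ?_ ?_ x
  · intro x x' hx hx' y z
    simp only [add_lie, map_add, LinearMap.add_apply, hx, hx']
    ring
  · intro c x hx y z
    simp only [smul_lie, map_smul, LinearMap.smul_apply, hx, smul_neg]
  · intro x x' hx hx' y z
    simp only [lie_lie, map_sub, LinearMap.sub_apply, hx, hx']
    ring

/-- For p = 0 and q < d the vector e^q w is a multiple of f e^(q+1) w, and f moved to the other
argument kills w. For larger p one factor e is moved across the form. -/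
theorem lieInvariant_raised {B : LinearMap.BilinForm ℂ M} (hB : B.lieInvariant Sl2) {w : M}
    {d : ℕ} (hw : IsPrimitive w d) {p q : ℕ} (h : p + q < d) :
    B (raised w p) (raised w q) = 0 := by
  induction p generalizing q with
  | zero =>
    have hq : (((q : ℂ) + 1) * (d - q)) ≠ 0 := by
      refine mul_ne_zero (Nat.cast_add_one_ne_zero q) (sub_ne_zero.2 ?_)
      exact_mod_cast (by omega : d ≠ q)
    have h1 : B w ⁅sl2F, raised w (q + 1)⁆ = 0 := by
      rw [← neg_eq_zero, ← hB, lie_f_raised_zero hw, map_zero, LinearMap.zero_apply]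
    rw [lie_f_raised hw, map_smul, smul_eq_mul] at h1
    exact (mul_eq_zero.1 h1).resolve_left hq
  | succ p ih => rw [← lie_e_raised, hB, lie_e_raised, ih (by omega), neg_zero]

theorem lieInvariant_raised_eq {B : LinearMap.BilinForm ℂ M} (hB : B.lieInvariant Sl2) (w : M)
    (p q : ℕ) : B (raised w p) (raised w q) = (-1) ^ p * B w (raised w (p + q)) := by
  induction p generalizing q with
  | zero => simp
  | succ p ih =>
    rw [← lie_e_raised, hB, lie_e_raised, ih, pow_succ, add_right_comm, add_assoc]
    ring

variable [FiniteDimensional ℂ M] [LieModule.IsIrreducible ℂ Sl2 M]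

omit [LieModule.IsIrreducible ℂ Sl2 M] in
theorem lieInvariant_raisedBasis {B : LinearMap.BilinForm ℂ M} (hB : B.lieInvariant Sl2) {w : M}
    {d : ℕ} (hw : IsPrimitive w d) (p q : ℕ) :
    B (raised w p) (raised w q) = if p + q = d then (-1) ^ p * B w (raised w d) else 0 := by
  split_ifs with h
  · rw [lieInvariant_raised_eq hB, h]
  · rcases lt_or_gt_of_ne h with h | h
    · exact lieInvariant_raised hB hw h
    · rw [lieInvariant_raised_eq hB, raised_eq_zero hw h, map_zero, mul_zero]

theorem IsLowest.eq_smul {w v : M} {d : ℕ} (hw : IsPrimitive w d) (hv : IsLowest v) :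
    ∃ c : ℂ, c ≠ 0 ∧ v = c • raised w d := by
  obtain ⟨c, rfl⟩ := span_raised_eq_smul_of_lie_e_eq_zero hw
    (by rw [span_raised_eq_top hw]; exact Submodule.mem_top : v ∈ _) hv.2
  exact ⟨c, fun h => hv.1 (by rw [h, zero_smul]), rfl⟩

/-- The invariant form with `B(eᵖ w, e^q w) = (-1)ᵖ κ` for `p + q = d` and `0` otherwise. -/
def standardForm {w : M} {d : ℕ} (hw : IsPrimitive w d) (κ : ℂ) : LinearMap.BilinForm ℂ M :=
  (raisedBasis hw).constr ℂ fun p => (raisedBasis hw).constr ℂ fun q =>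
    if (p : ℕ) + q = d then (-1) ^ (p : ℕ) * κ else 0

theorem standardForm_raised {w : M} {d : ℕ} (hw : IsPrimitive w d) (κ : ℂ) (p q : ℕ) :
    standardForm hw κ (raised w p) (raised w q) = if p + q = d then (-1) ^ p * κ else 0 := by
  by_cases hp : p ≤ d
  · by_cases hq : q ≤ d
    · have h := (raisedBasis hw).constr_basis ℂ (fun p : Fin (d + 1) =>
        (raisedBasis hw).constr ℂ fun q : Fin (d + 1) =>
        if (p : ℕ) + q = d then (-1 : ℂ) ^ (p : ℕ) * κ else 0) ⟨p, Nat.lt_succ_of_le hp⟩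
      have h' := (raisedBasis hw).constr_basis ℂ (fun q : Fin (d + 1) =>
        if p + (q : ℕ) = d then (-1 : ℂ) ^ p * κ else 0) ⟨q, Nat.lt_succ_of_le hq⟩
      rw [raisedBasis_apply] at h h'
      rw [standardForm, h, h']
    · rw [raised_eq_zero hw (not_le.1 hq), map_zero, if_neg (by omega)]
  · rw [raised_eq_zero hw (not_le.1 hp), map_zero, LinearMap.zero_apply, if_neg (by omega)]

theorem standardForm_lieInvariant {w : M} {d : ℕ} (hw : IsPrimitive w d) (κ : ℂ) :
    (standardForm hw κ).lieInvariant Sl2 := by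
  have ext2 : ∀ {x : Sl2}, (∀ p q, standardForm hw κ ⁅x, raised w p⁆ (raised w q) =
      -standardForm hw κ (raised w p) ⁅x, raised w q⁆) →
      ∀ y z, standardForm hw κ ⁅x, y⁆ z = -standardForm hw κ y ⁅x, z⁆ := by
    intro x h y z
    have : (standardForm hw κ) ∘ₗ (LieModule.toEnd ℂ Sl2 M x) =
        -(standardForm hw κ).compl₂ (LieModule.toEnd ℂ Sl2 M x) := by
      refine (raisedBasis hw).ext fun p => (raisedBasis hw).ext fun q => ?_
      simpa using h p q
    simpa using congrArg (fun φ => φ y z) this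
  refine lieInvariant_of_e_f (ext2 fun p q => ?_) (ext2 fun p q => ?_)
  · rw [lie_e_raised, lie_e_raised, standardForm_raised, standardForm_raised]
    by_cases h : p + q + 1 = d
    · rw [if_pos (by omega), if_pos (by omega), pow_succ]; ring
    · rw [if_neg (by omega), if_neg (by omega), neg_zero]
  · cases p with
    | zero =>
      rw [raised_zero, lie_f_raised_zero hw, map_zero, LinearMap.zero_apply]
      cases q with
      | zero => simp [lie_f_raised_zero hw]
      | succ q =>
        have h := standardForm_raised hw κ 0 q
        rw [raised_zero] at h
        rw [lie_f_raised hw, map_smul, h]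
        split_ifs with hq
        · rw [show q = d by omega, sub_self, mul_zero, zero_smul, neg_zero]
        · simp
    | succ p =>
      rw [lie_f_raised hw, map_smul, LinearMap.smul_apply, standardForm_raised]
      cases q with
      | zero =>
        rw [raised_zero, lie_f_raised_zero hw, map_zero]
        split_ifs with hp
        · rw [show p = d by omega, sub_self, mul_zero, zero_smul, neg_zero]
        · simp
      | succ q =>
        rw [lie_f_raised hw, map_smul, standardForm_raised]
        by_cases h : p + q + 1 = d
        · rw [if_pos (by omega), if_pos (by omega), ← h, pow_succ]
          push_cast
          simp only [smul_eq_mul]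
          ring
        · rw [if_neg (by omega), if_neg (by omega)]
          simp

/-- In the basis e^p u an invariant form is determined by κ = B(u, e^d u). Since v = c e^d u with c
≠ 0, the normalization forces κ = c⁻¹. -/
theorem existsUnique_lieInvariant {u v : M} (hu : IsHighest u) (hv : IsLowest v) :
    ∃! β : LinearMap.BilinForm ℂ M, β.lieInvariant Sl2 ∧ β u v = 1 := by
  have hw := hu.isPrimitive
  obtain ⟨c, hc, rfl⟩ := hv.eq_smul hw
  set d := Module.finrank ℂ M - 1
  refine ⟨standardForm hw c⁻¹, ⟨standardForm_lieInvariant hw _, ?_⟩, ?_⟩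
  · have h := standardForm_raised hw c⁻¹ 0 d
    rw [raised_zero] at h
    rw [map_smul, h]
    simp [hc]
  · rintro β ⟨hβ, h1⟩
    refine (raisedBasis hw).ext fun p => (raisedBasis hw).ext fun q => ?_
    rw [raisedBasis_apply, raisedBasis_apply, standardForm_raised, lieInvariant_raisedBasis hβ hw]
    rw [map_smul, smul_eq_mul] at h1
    rw [eq_inv_of_mul_eq_one_right h1]

end InvariantForm

/-! ### Dual bases for an invariant form -/

section DualFamily

/-- A family biorthogonal to a basis computes the coordinates. -/
theorem repr_eq_of_biorthogonal {ι R V V' : Type*} [CommRing R] [AddCommGroup V] [Module R V]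
    [AddCommGroup V'] [Module R V'] [DecidableEq ι] (b : Module.Basis ι R V)
    (B : V' →ₗ[R] V →ₗ[R] R) (b' : ι → V')
    (h : ∀ i j, B (b' i) (b j) = if i = j then 1 else 0) (i : ι) (v : V) :
    b.repr v i = B (b' i) v := by
  have : b.coord i = B (b' i) := b.ext fun j => by
    rw [h, b.coord_apply, b.repr_self, Finsupp.single_apply]
    simp only [eq_comm]
  exact congrArg (fun φ => φ v) this

variable {M : Type*} [AddCommGroup M] [Module ℂ M] [LieRingModule Sl2 M] [LieModule ℂ Sl2 M]
  [FiniteDimensional ℂ M] [LieModule.IsIrreducible ℂ Sl2 M]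

/-- The family dual to the vectors `eᵖ w` with respect to an invariant form. -/
def raisedDual (β : LinearMap.BilinForm ℂ M) (w : M) (d p : ℕ) : M :=
  ((-1) ^ (d - p) * β w (raised w d))⁻¹ • raised w (d - p)

omit [LieModule.IsIrreducible ℂ Sl2 M] in
theorem raisedDual_apply {β : LinearMap.BilinForm ℂ M} (hβ : β.lieInvariant Sl2) {w : M} {d : ℕ}
    (hw : IsPrimitive w d) (h : β w (raised w d) ≠ 0) {p q : ℕ} (hp : p ≤ d) :
    β (raisedDual β w d p) (raised w q) = if p = q then 1 else 0 := by
  rw [raisedDual, map_smul, LinearMap.smul_apply, lieInvariant_raisedBasis hβ hw]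
  by_cases hpq : p = q
  · subst hpq
    rw [if_pos (by omega), if_pos rfl, smul_eq_mul, inv_mul_cancel₀]
    exact mul_ne_zero (pow_ne_zero _ (by norm_num)) h
  · rw [if_neg (by omega), if_neg hpq, smul_zero]

theorem lieInvariant_top_ne_zero {β : LinearMap.BilinForm ℂ M} {u v : M} {d : ℕ}
    (hu : IsPrimitive u d) (hv : IsLowest v) (h : β u v = 1) : β u (raised u d) ≠ 0 := by
  obtain ⟨c, -, rfl⟩ := hv.eq_smul hu
  intro h0
  rw [map_smul, h0, smul_zero] at h
  exact zero_ne_one h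

end DualFamily

/-! ### The Clebsch–Gordan decomposition of a product of two irreducible modules -/

section ClebschGordan

set_option linter.unusedSectionVars false

variable {M N : Type*} [AddCommGroup M] [Module ℂ M] [LieRingModule Sl2 M] [LieModule ℂ Sl2 M]
  [AddCommGroup N] [Module ℂ N] [LieRingModule Sl2 N] [LieModule ℂ Sl2 N]

/-- The vector `eᵖ u ⊗ e^q u'`. -/
def mixed (u : M) (u' : N) (p q : ℕ) : M ⊗[ℂ] N := raised u p ⊗ₜ[ℂ] raised u' q

theorem lie_e_mixed (u : M) (u' : N) (p q : ℕ) :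
    ⁅sl2E, mixed u u' p q⁆ = mixed u u' (p + 1) q + mixed u u' p (q + 1) := by
  rw [mixed, TensorProduct.LieModule.lie_tmul_right, lie_e_raised, lie_e_raised]
  rfl

/-- The action of `x` on the first factor. -/
def leftAct (x : Sl2) : M ⊗[ℂ] N →ₗ[ℂ] M ⊗[ℂ] N :=
  LinearMap.rTensor N (LieModule.toEnd ℂ Sl2 M x)

@[simp]
theorem leftAct_tmul (x : Sl2) (m : M) (n : N) : leftAct x (m ⊗ₜ[ℂ] n) = ⁅x, m⁆ ⊗ₜ[ℂ] n := rfl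

/-- The action of `x` on the second factor. -/
def rightAct (x : Sl2) : M ⊗[ℂ] N →ₗ[ℂ] M ⊗[ℂ] N :=
  LinearMap.lTensor M (LieModule.toEnd ℂ Sl2 N x)

@[simp]
theorem rightAct_tmul (x : Sl2) (m : M) (n : N) : rightAct x (m ⊗ₜ[ℂ] n) = m ⊗ₜ[ℂ] ⁅x, n⁆ := rfl

theorem lie_eq_leftAct_add_rightAct (x : Sl2) (t : M ⊗[ℂ] N) :
    ⁅x, t⁆ = leftAct x t + rightAct x t := by
  induction t using TensorProduct.induction_on with
  | zero => simp
  | tmul m n => rw [TensorProduct.LieModule.lie_tmul_right]; rfl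
  | add s t hs ht => rw [lie_add, map_add, map_add, hs, ht]; abel

theorem leftAct_lie (x y : Sl2) (t : M ⊗[ℂ] N) :
    leftAct ⁅x, y⁆ t = ⁅x, leftAct y t⁆ - leftAct y ⁅x, t⁆ := by
  induction t using TensorProduct.induction_on with
  | zero => simp
  | tmul m n =>
    simp only [TensorProduct.LieModule.lie_tmul_right, leftAct_tmul, map_add, lie_lie,
      TensorProduct.sub_tmul]
    abel
  | add s t hs ht => simp only [lie_add, map_add, hs, ht]; abel

theorem leftAct_add (x y : Sl2) (t : M ⊗[ℂ] N) :
    leftAct (x + y) t = leftAct x t + leftAct y t := by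
  simp [leftAct, LinearMap.rTensor_add]

theorem leftAct_smul (c : ℂ) (x : Sl2) (t : M ⊗[ℂ] N) :
    leftAct (c • x) t = c • leftAct x t := by
  simp [leftAct, LinearMap.rTensor_smul]

theorem leftAct_e_raised (t : M ⊗[ℂ] N) (p : ℕ) :
    leftAct sl2E (raised t p) = raised (leftAct sl2E t) p := by
  induction p with
  | zero => rfl
  | succ p ih =>
    have := leftAct_lie sl2E sl2E (raised t p)
    have h0 : leftAct (0 : Sl2) (raised t p) = 0 := by simp [leftAct]
    rw [lie_self, h0, eq_comm, sub_eq_zero] at this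
    rw [← lie_e_raised, ← this, ih, lie_e_raised]

variable {μ ν : ℕ}

/-- The absolute values of the coefficients of the highest vector of the `m`-th component. -/
def cgCoeff (μ ν m p : ℕ) : ℝ :=
  ∏ i ∈ Finset.range p, ((m - i) * (ν - m + (i + 1))) / ((i + 1) * (μ - i))

/-- The recurrence that makes the two contributions to each e^p u ⊗ e^(m-p-1) u' in f · `cgVec`
cancel. -/
theorem cgCoeff_succ {m p : ℕ} (hm : m ≤ μ) (hp : p < m) :
    cgCoeff μ ν m (p + 1) * ((p + 1) * (μ - p)) =
      cgCoeff μ ν m p * ((m - p) * (ν - m + (p + 1))) := by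
  have h1 : (p : ℝ) + 1 ≠ 0 := Nat.cast_add_one_ne_zero p
  have h2 : (μ : ℝ) - p ≠ 0 := sub_ne_zero.2 (by exact_mod_cast (by omega : μ ≠ p))
  rw [cgCoeff, Finset.prod_range_succ, ← cgCoeff, mul_assoc, div_mul_cancel₀]
  exact mul_ne_zero h1 h2

theorem cgCoeff_pos {m p : ℕ} (hm : m ≤ μ) (hm' : m ≤ ν) (hp : p ≤ m) :
    0 < cgCoeff μ ν m p := by
  refine Finset.prod_pos fun i hi => ?_
  have hi := Finset.mem_range.1 hi
  have h1 : (0 : ℝ) < m - i := sub_pos.2 (by exact_mod_cast (by omega : i < m))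
  have h2 : (0 : ℝ) < μ - i := sub_pos.2 (by exact_mod_cast (by omega : i < μ))
  have h3 : (0 : ℝ) ≤ ν - m := sub_nonneg.2 (by exact_mod_cast hm')
  positivity

/-- The highest vector of the `m`-th component of the tensor product. -/
def cgVec (u : M) (u' : N) (μ ν m : ℕ) : M ⊗[ℂ] N :=
  ∑ p ∈ Finset.range (m + 1), ((-1) ^ p * (cgCoeff μ ν m p : ℂ)) • mixed u u' p (m - p)

variable {u : M} {u' : N} (hu : IsPrimitive u μ) (hu' : IsPrimitive u' ν)
include hu hu'

theorem lie_h_mixed (p q : ℕ) :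
    ⁅sl2H, mixed u u' p q⁆ = ((2 : ℂ) * (p + q) - (μ + ν)) • mixed u u' p q := by
  rw [mixed, TensorProduct.LieModule.lie_tmul_right, lie_h_raised hu, lie_h_raised hu',
    ← TensorProduct.smul_tmul', TensorProduct.tmul_smul, ← add_smul]
  congr 1
  ring

theorem lie_f_cgVec {m : ℕ} (hm : m ≤ μ) : ⁅sl2F, cgVec u u' μ ν m⁆ = 0 := by
  have h1 : ∑ p ∈ Finset.range (m + 1), ((-1) ^ p * (cgCoeff μ ν m p : ℂ)) •
      (⁅sl2F, raised u p⁆ ⊗ₜ[ℂ] raised u' (m - p)) =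
      ∑ p ∈ Finset.range m, ((-1) ^ (p + 1) * (cgCoeff μ ν m (p + 1) : ℂ) *
        (((p : ℂ) + 1) * (μ - p))) • mixed u u' p (m - (p + 1)) := by
    rw [Finset.sum_range_succ', raised_zero, lie_f_raised_zero hu, TensorProduct.zero_tmul,
      smul_zero, add_zero]
    refine Finset.sum_congr rfl fun p _ => ?_
    rw [lie_f_raised hu, ← TensorProduct.smul_tmul', smul_smul]
    rfl
  have h2 : ∑ p ∈ Finset.range (m + 1), ((-1) ^ p * (cgCoeff μ ν m p : ℂ)) •
      (raised u p ⊗ₜ[ℂ] ⁅sl2F, raised u' (m - p)⁆) =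
      ∑ p ∈ Finset.range m, ((-1) ^ p * (cgCoeff μ ν m p : ℂ) *
        (((m : ℂ) - p) * (ν - m + (p + 1)))) • mixed u u' p (m - (p + 1)) := by
    rw [Finset.sum_range_succ, Nat.sub_self, raised_zero, lie_f_raised_zero hu',
      TensorProduct.tmul_zero, smul_zero, add_zero]
    refine Finset.sum_congr rfl fun p hp => ?_
    have hp := Finset.mem_range.1 hp
    obtain ⟨q, rfl⟩ := Nat.exists_eq_add_of_lt hp
    rw [show p + q + 1 - p = q + 1 by omega, show p + q + 1 - (p + 1) = q by omega,
      lie_f_raised hu', TensorProduct.tmul_smul, smul_smul]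
    congr 2
    push_cast
    ring
  rw [cgVec, lie_sum]
  simp only [lie_smul, mixed, TensorProduct.LieModule.lie_tmul_right, smul_add]
  rw [Finset.sum_add_distrib, h1, h2, ← Finset.sum_add_distrib]
  refine Finset.sum_eq_zero fun p hp => ?_
  rw [← add_smul]
  have := congrArg (fun x : ℝ => (x : ℂ)) (cgCoeff_succ (ν := ν) hm (Finset.mem_range.1 hp))
  push_cast at this
  rw [show ((-1 : ℂ) ^ (p + 1) * (cgCoeff μ ν m (p + 1) : ℂ) * (((p : ℂ) + 1) * (μ - p)) +
    (-1) ^ p * (cgCoeff μ ν m p : ℂ) * (((m : ℂ) - p) * (ν - m + (p + 1)))) = 0 by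
      rw [pow_succ]; linear_combination (-(-1 : ℂ) ^ p) * this, zero_smul]

theorem lie_h_cgVec (m : ℕ) :
    ⁅sl2H, cgVec u u' μ ν m⁆ = ((2 : ℂ) * m - (μ + ν)) • cgVec u u' μ ν m := by
  rw [cgVec, lie_sum, Finset.smul_sum]
  refine Finset.sum_congr rfl fun p hp => ?_
  rw [lie_smul, lie_h_mixed hu hu', smul_comm,
    Nat.cast_sub (Nat.lt_succ_iff.1 (Finset.mem_range.1 hp))]
  congr 2
  ring

variable [FiniteDimensional ℂ M] [LieModule.IsIrreducible ℂ Sl2 M]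
  [FiniteDimensional ℂ N] [LieModule.IsIrreducible ℂ Sl2 N]

theorem mixed_eq_tensorProduct_basis {p q : ℕ} (hp : p ≤ μ) (hq : q ≤ ν) :
    mixed u u' p q = ((raisedBasis hu).tensorProduct (raisedBasis hu'))
      (⟨p, Nat.lt_succ_of_le hp⟩, ⟨q, Nat.lt_succ_of_le hq⟩) := by
  rw [Module.Basis.tensorProduct_apply, raisedBasis_apply, raisedBasis_apply]
  rfl

theorem cgVec_ne_zero {m : ℕ} (hm : m ≤ μ) (hm' : m ≤ ν) : cgVec u u' μ ν m ≠ 0 := by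
  intro h
  have := congrArg (fun t => ((raisedBasis hu).tensorProduct (raisedBasis hu')).repr t
    (⟨0, Nat.succ_pos μ⟩, ⟨m, Nat.lt_succ_of_le hm'⟩)) h
  simp only [cgVec, map_sum, map_smul, map_zero, Finsupp.coe_finsetSum, Finset.sum_apply,
    Finsupp.coe_smul, Pi.smul_apply, Finsupp.coe_zero, Pi.zero_apply] at this
  rw [Finset.sum_eq_single 0] at this
  · rw [mixed_eq_tensorProduct_basis hu hu' (Nat.zero_le _) (by simpa using hm'),
      Module.Basis.repr_self] at this
    simp [cgCoeff] at this
  · intro p hp hp0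
    have hp := Nat.lt_succ_iff.1 (Finset.mem_range.1 hp)
    rw [mixed_eq_tensorProduct_basis hu hu' (hp.trans hm) ((Nat.sub_le _ _).trans hm'),
      Module.Basis.repr_self, Finsupp.single_eq_of_ne, smul_zero]
    simp only [ne_eq, Prod.mk.injEq, Fin.mk.injEq]
    omega
  · simp

theorem cgVec_isPrimitive {m : ℕ} (hm : m ≤ μ) (hm' : m ≤ ν) :
    IsPrimitive (cgVec u u' μ ν m) (μ + ν - 2 * m) where
  ne_zero := cgVec_ne_zero hu hu' hm hm'
  lie_h := by
    rw [neg_lie, lie_h_cgVec hu hu', ← neg_smul, Nat.cast_sub (by omega)]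
    congr 1
    push_cast
    ring
  lie_e := lie_f_cgVec hu hu' hm

omit [LieModule.IsIrreducible ℂ Sl2 M] [LieModule.IsIrreducible ℂ Sl2 N]
  [FiniteDimensional ℂ M] [FiniteDimensional ℂ N] hu hu' in
-- By induction G contains the image under e of everything in degree m, so in degree m + 1 the
-- vectors e^p u ⊗ e^q u' agree up to the sign (-1)^p modulo G. The coefficients of `cgVec` carry
-- the same signs, so `cgVec` is congruent to (∑ `cgCoeff`) · (u ⊗ e^(m+1) u'). The sum is positive,
-- so every vector of this degree lies in G.
theorem mixed_mem_of_cgVec_mem (hu : IsPrimitive u μ) (hu' : IsPrimitive u' ν)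
    {G : ℕ → LieSubmodule ℂ Sl2 (M ⊗[ℂ] N)} (hG : Monotone G)
    (h : ∀ k, k ≤ μ → k ≤ ν → cgVec u u' μ ν k ∈ G k) (m : ℕ) (hm : m ≤ μ) (hm' : m ≤ ν) :
    ∀ p q, p + q = m → mixed u u' p q ∈ G m := by
  have _ := hu
  have _ := hu'
  induction m with
  | zero =>
    intro p q hpq
    obtain ⟨rfl, rfl⟩ := Nat.add_eq_zero_iff.1 hpq
    have := h 0 hm hm'
    simpa [cgVec, cgCoeff] using this
  | succ m ih =>
    have ih := ih (by omega) (by omega)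
    have hstep : ∀ p q, p + q = m →
        mixed u u' (p + 1) q + mixed u u' p (q + 1) ∈ G (m + 1) := fun p q hpq => by
      rw [← lie_e_mixed]
      exact hG m.le_succ ((G m).lie_mem (ih p q hpq))
    have hall : ∀ p ≤ m + 1, mixed u u' p (m + 1 - p) - (-1 : ℂ) ^ p • mixed u u' 0 (m + 1) ∈
        G (m + 1) := by
      intro p
      induction p with
      | zero => intro _; simp
      | succ p ihp =>
        intro hp
        have h1 := hstep p (m - p) (by omega)
        have h2 := ihp (by omega)
        rw [show m - p + 1 = m + 1 - p by omega] at h1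
        have := (G (m + 1)).sub_mem h1 h2
        rw [show m + 1 - (p + 1) = m - p by omega]
        rw [pow_succ, mul_neg_one, neg_smul]
        have e : mixed u u' (p + 1) (m - p) + mixed u u' p (m + 1 - p) -
            (mixed u u' p (m + 1 - p) - (-1 : ℂ) ^ p • mixed u u' 0 (m + 1)) =
            mixed u u' (p + 1) (m - p) - -((-1 : ℂ) ^ p • mixed u u' 0 (m + 1)) := by abel
        rwa [e] at this
    have hsum : (∑ p ∈ Finset.range (m + 1 + 1), (cgCoeff μ ν (m + 1) p : ℂ)) •
        mixed u u' 0 (m + 1) ∈ G (m + 1) := by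
      have h1 := h (m + 1) hm hm'
      have h2 : ∑ p ∈ Finset.range (m + 1 + 1), ((-1) ^ p * (cgCoeff μ ν (m + 1) p : ℂ)) •
          (mixed u u' p (m + 1 - p) - (-1 : ℂ) ^ p • mixed u u' 0 (m + 1)) ∈ G (m + 1) :=
        (G (m + 1)).toSubmodule.sum_mem fun p hp => (G (m + 1)).smul_mem _
          (hall p (Nat.lt_succ_iff.1 (Finset.mem_range.1 hp)))
      have := (G (m + 1)).sub_mem h1 h2
      rw [cgVec, ← Finset.sum_sub_distrib] at this
      rw [Finset.sum_smul]
      refine (congrArg (· ∈ G (m + 1)) (Finset.sum_congr rfl fun p _ => ?_)).mp this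
      rw [← smul_sub, sub_sub_cancel, smul_smul, mul_right_comm, ← mul_pow]
      simp
    have hne : (∑ p ∈ Finset.range (m + 1 + 1), (cgCoeff μ ν (m + 1) p : ℂ)) ≠ 0 := by
      rw [← Complex.ofReal_sum, Complex.ofReal_ne_zero]
      refine (Finset.sum_pos (fun p hp => cgCoeff_pos hm hm'
        (Nat.lt_succ_iff.1 (Finset.mem_range.1 hp))) ⟨0, by simp⟩).ne'
    have h0 : mixed u u' 0 (m + 1) ∈ G (m + 1) := by
      have := (G (m + 1)).smul_mem (∑ p ∈ Finset.range (m + 1 + 1),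
        (cgCoeff μ ν (m + 1) p : ℂ))⁻¹ hsum
      rwa [smul_smul, inv_mul_cancel₀ hne, one_smul] at this
    intro p q hpq
    have := (G (m + 1)).add_mem (hall p (by omega)) ((G (m + 1)).smul_mem ((-1 : ℂ) ^ p) h0)
    rwa [sub_add_cancel, show m + 1 - p = q by omega] at this

omit [LieModule.IsIrreducible ℂ Sl2 M] [LieModule.IsIrreducible ℂ Sl2 N] in
-- Above degree min(μ, ν) no new generators are needed. If μ ≤ ν, the vectors e^p u ⊗ u' are covered
-- or zero, and e^p u ⊗ e^(q+1) u' = e(e^p u ⊗ e^q u') - e^(p+1) u ⊗ e^q u'; the other case is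
-- symmetric.
theorem mixed_mem_of_cgVec_mem_min {G : ℕ → LieSubmodule ℂ Sl2 (M ⊗[ℂ] N)} (hG : Monotone G)
    (h : ∀ k, k ≤ μ → k ≤ ν → cgVec u u' μ ν k ∈ G k) (p q : ℕ) :
    mixed u u' p q ∈ G (min μ ν) := by
  have h0 := mixed_mem_of_cgVec_mem hu hu' hG h
  rcases le_total μ ν with hμν | hμν
  · rw [min_eq_left hμν]
    induction q generalizing p with
    | zero =>
      by_cases hp : p ≤ μ
      · exact hG hp (h0 p hp (hp.trans hμν) p 0 rfl)
      · rw [mixed, raised_eq_zero hu (not_le.1 hp), TensorProduct.zero_tmul]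
        exact zero_mem _
    | succ q ih =>
      have := (G μ).sub_mem ((G μ).lie_mem (x := sl2E) (ih p)) (ih (p + 1))
      rwa [lie_e_mixed, add_sub_cancel_left] at this
  · rw [min_eq_right hμν]
    induction p generalizing q with
    | zero =>
      by_cases hq : q ≤ ν
      · exact hG hq (h0 q (hq.trans hμν) hq 0 q (zero_add q))
      · rw [mixed, raised_eq_zero hu' (not_le.1 hq), TensorProduct.tmul_zero]
        exact zero_mem _
    | succ p ih =>
      have := (G ν).sub_mem ((G ν).lie_mem (x := sl2E) (ih q)) (ih (q + 1))
      rwa [lie_e_mixed, add_sub_cancel_right] at this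

theorem eq_top_of_mixed_mem {G : LieSubmodule ℂ Sl2 (M ⊗[ℂ] N)}
    (h : ∀ p q, mixed u u' p q ∈ G) : G = ⊤ := by
  rw [eq_top_iff]
  intro t _
  rw [← LieSubmodule.mem_toSubmodule,
    ← ((raisedBasis hu).tensorProduct (raisedBasis hu')).sum_repr t]
  refine Submodule.sum_mem _ fun x _ => Submodule.smul_mem _ _ ?_
  rw [Module.Basis.tensorProduct_apply, raisedBasis_apply, raisedBasis_apply]
  exact h _ _

theorem cgVec_mem_componentSum {K : Set ℕ} {k : ℕ} (hk : k ∈ K) (hkμ : k ≤ μ) (hkν : k ≤ ν) :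
    cgVec u u' μ ν k ∈ componentSum M N K := by
  have hw := cgVec_isPrimitive hu hu' hkμ hkν
  have hle : chainSubmodule hw ≤ componentSum M N K := by
    refine le_sSup ⟨chainSubmodule_isIrreducible hw, k, hk, ?_, ?_⟩
    · rw [hu.finrank_eq, hu'.finrank_eq]; omega
    · rw [hu.finrank_eq, hu'.finrank_eq, finrank_chainSubmodule]; omega
  exact hle (mem_chainSubmodule hw)

omit hu hu' [LieModule.IsIrreducible ℂ Sl2 M] [LieModule.IsIrreducible ℂ Sl2 N]
  [FiniteDimensional ℂ M] [FiniteDimensional ℂ N] in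
theorem componentSum_Iic_monotone : Monotone fun l => componentSum M N {k | k ≤ l} :=
  fun _ _ h => componentSum_mono _ _ fun _ hk => le_trans hk h

theorem mixed_mem_componentSum {p q : ℕ} (h : p + q ≤ μ) (h' : p + q ≤ ν) :
    mixed u u' p q ∈ componentSum M N {k | k ≤ p + q} :=
  mixed_mem_of_cgVec_mem hu hu' (G := fun l => componentSum M N {k | k ≤ l})
    componentSum_Iic_monotone (fun k => cgVec_mem_componentSum hu hu' (show k ≤ k from le_rfl))
    (p + q) h h' p q rfl

theorem componentSum_Iic_eq_top {l : ℕ} (hl : min μ ν ≤ l) :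
    componentSum M N {k | k ≤ l} = ⊤ := by
  rw [eq_top_iff, ← eq_top_of_mixed_mem hu hu' (mixed_mem_of_cgVec_mem_min hu hu'
    (G := fun l => componentSum M N {k | k ≤ l}) componentSum_Iic_monotone
    fun k => cgVec_mem_componentSum hu hu' (show k ≤ k from le_rfl))]
  exact componentSum_Iic_monotone hl

/-- Complete reducibility is not needed: the partial sums of the submodules generated by the `cgVec`
form a filtration to which the preceding argument applies, so they exhaust the product. -/
theorem exists_sum_cgVec (t : M ⊗[ℂ] N) : ∃ c : ℕ → M ⊗[ℂ] N,
    (∀ k, c k ∈ LieSubmodule.lieSpan ℂ Sl2 {cgVec u u' μ ν k}) ∧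
    t = ∑ k ∈ Finset.range (min μ ν + 1), c k := by
  let G : ℕ → LieSubmodule ℂ Sl2 (M ⊗[ℂ] N) := fun l =>
    ⨆ k ∈ Finset.range (l + 1), LieSubmodule.lieSpan ℂ Sl2 {cgVec u u' μ ν k}
  have hG : Monotone G := fun l l' hl => biSup_mono fun k hk => by
    rw [Finset.mem_range] at hk ⊢; omega
  have htop := eq_top_of_mixed_mem hu hu' (mixed_mem_of_cgVec_mem_min hu hu' hG
    fun k _ _ => (le_biSup (fun k => LieSubmodule.lieSpan ℂ Sl2 {cgVec u u' μ ν k})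
      (Finset.self_mem_range_succ k)) (LieSubmodule.subset_lieSpan (Set.mem_singleton _)))
  have ht : t ∈ (G (min μ ν)).toSubmodule := by rw [htop]; exact Submodule.mem_top
  simp only [G, LieSubmodule.iSup_toSubmodule] at ht
  obtain ⟨c, hc⟩ := (Submodule.mem_iSup_finset_iff_exists_sum _ _).1 ht
  exact ⟨fun k => c k, fun k => (c k).2, hc.symm⟩

theorem lieSpan_cgVec_le_componentSum {K : Set ℕ} {k : ℕ} (hk : k ∈ K) (hk' : k ≤ min μ ν) :
    LieSubmodule.lieSpan ℂ Sl2 {cgVec u u' μ ν k} ≤ componentSum M N K := by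
  rw [LieSubmodule.lieSpan_le, Set.singleton_subset_iff]
  exact cgVec_mem_componentSum hu hu' hk (by omega) (by omega)

omit hu hu' [LieModule.IsIrreducible ℂ Sl2 M] [LieModule.IsIrreducible ℂ Sl2 N]
  [FiniteDimensional ℂ M] [FiniteDimensional ℂ N] in
theorem componentSum_toSubmodule_le {K : Set ℕ} {S : Submodule ℂ (M ⊗[ℂ] N)}
    (h : ∀ U : LieSubmodule ℂ Sl2 (M ⊗[ℂ] N), LieModule.IsIrreducible ℂ Sl2 U →
      ∀ k ∈ K, k < min (Module.finrank ℂ M) (Module.finrank ℂ N) →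
      Module.finrank ℂ U + 1 + 2 * k = Module.finrank ℂ M + Module.finrank ℂ N →
      U.toSubmodule ≤ S) : (componentSum M N K).toSubmodule ≤ S := by
  rw [componentSum, LieSubmodule.sSup_toSubmodule]
  refine sSup_le ?_
  rintro _ ⟨U, ⟨hU, k, hk, hk1, hk2⟩, rfl⟩
  exact h U hU k hk hk1 hk2

omit hu hu' [LieModule.IsIrreducible ℂ Sl2 M] [LieModule.IsIrreducible ℂ Sl2 N] in
/-- Sums of components with disjoint sets of dimensions are orthogonal. -/
theorem componentSum_orthogonal {B : LinearMap.BilinForm ℂ (M ⊗[ℂ] N)} (hB : B.lieInvariant Sl2)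
    {K K' : Set ℕ} (hK : Disjoint K K') {t t' : M ⊗[ℂ] N} (ht : t ∈ componentSum M N K)
    (ht' : t' ∈ componentSum M N K') : B t t' = 0 := by
  have h1 : (componentSum M N K).toSubmodule ≤
      ⨅ s ∈ (componentSum M N K'), LinearMap.ker (LinearMap.flip B s) := by
    refine componentSum_toSubmodule_le fun U hU k hk hk1 hk2 x hx => ?_
    simp only [Submodule.mem_iInf, LinearMap.mem_ker, LinearMap.flip_apply]
    have h2 : (componentSum M N K').toSubmodule ≤ LinearMap.ker (B x) := by
      refine componentSum_toSubmodule_le fun U' hU' k' hk' hk1' hk2' x' hx' => ?_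
      rw [LinearMap.mem_ker]
      have hne : k ≠ k' := fun h => Set.disjoint_left.1 hK hk (h ▸ hk')
      refine casimir_orthogonal hB
        (casimir_eq_of_isIrreducible U hU
          (d := Module.finrank ℂ M + Module.finrank ℂ N - 2 - 2 * k) (by omega) hx)
        (casimir_eq_of_isIrreducible U' hU'
          (d := Module.finrank ℂ M + Module.finrank ℂ N - 2 - 2 * k') (by omega) hx') ?_
      norm_cast
      intro h
      apply hne
      have : Module.finrank ℂ M + Module.finrank ℂ N - 2 - 2 * k =
          Module.finrank ℂ M + Module.finrank ℂ N - 2 - 2 * k' := by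
        -- The Casimir eigenvalue d(d + 2) determines d, hence k.
        have hmono : StrictMono fun d : ℕ => d * (d + 2) := fun a b hab => by
          beta_reduce
          nlinarith
        exact hmono.injective h
      omega
    exact fun s hs => h2 hs
  have := h1 ht
  simp only [Submodule.mem_iInf, LinearMap.mem_ker, LinearMap.flip_apply] at this
  exact this t' ht'

/-- The components of an element which is orthogonal to all components in `K` are outside `K`. -/
theorem mem_componentSum_compl {B : LinearMap.BilinForm ℂ (M ⊗[ℂ] N)} (hB : B.lieInvariant Sl2)
    (hnd : ∀ t, (∀ s, B s t = 0) → t = 0) {K : Set ℕ} {t : M ⊗[ℂ] N}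
    (ht : ∀ s ∈ componentSum M N K, B s t = 0) :
    ∃ c : ℕ → M ⊗[ℂ] N, (∀ k, c k ∈ LieSubmodule.lieSpan ℂ Sl2 {cgVec u u' μ ν k}) ∧
    (∀ k ∈ K, c k = 0) ∧ t = ∑ k ∈ Finset.range (min μ ν + 1), c k := by
  classical
  obtain ⟨c, hc, rfl⟩ := exists_sum_cgVec hu hu' t
  refine ⟨fun k => if k ∈ K then 0 else c k, fun k => ?_, fun k hk => if_pos hk, ?_⟩
  · beta_reduce
    split_ifs
    · exact zero_mem _
    · exact hc k
  · refine Finset.sum_congr rfl fun k hk => ?_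
    beta_reduce
    split_ifs with hkK
    -- A part c_k with k ∈ K is orthogonal to the other components by the Casimir argument and to
    -- its own component by hypothesis, so non-degeneracy makes it zero.
    · refine hnd _ fun s => ?_
      obtain ⟨c', hc', rfl⟩ := exists_sum_cgVec hu hu' s
      rw [map_sum, LinearMap.sum_apply]
      have hmem : ∀ {k' : ℕ} {c : ℕ → M ⊗[ℂ] N}, k' ∈ Finset.range (min μ ν + 1) →
          (∀ k, c k ∈ LieSubmodule.lieSpan ℂ Sl2 {cgVec u u' μ ν k}) →
          c k' ∈ componentSum M N {k'} := fun hk' hc =>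
        lieSpan_cgVec_le_componentSum hu hu' (Set.mem_singleton _)
          (Nat.lt_succ_iff.1 (Finset.mem_range.1 hk')) (hc _)
      have hne : ∀ {k₁ k₂ : ℕ} {x y : M ⊗[ℂ] N}, k₁ ≠ k₂ → x ∈ componentSum M N {k₁} →
          y ∈ componentSum M N {k₂} → B x y = 0 := fun h hx hy =>
        componentSum_orthogonal hB (Set.disjoint_singleton.2 h) hx hy
      refine Finset.sum_eq_zero fun k' hk' => ?_
      by_cases hkk' : k' = k
      · subst hkk'
        have h1 := ht (c' k') (lieSpan_cgVec_le_componentSum hu hu' hkK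
          (Nat.lt_succ_iff.1 (Finset.mem_range.1 hk')) (hc' _))
        rwa [map_sum, Finset.sum_eq_single k'] at h1
        · exact fun k'' hk'' h => hne h.symm (hmem hk' hc') (hmem hk'' hc)
        · exact fun h => absurd hk' h
      · exact hne hkk' (hmem hk' hc') (hmem hk hc)
    · rfl

theorem mem_componentSum_of_orthogonal {B : LinearMap.BilinForm ℂ (M ⊗[ℂ] N)}
    (hB : B.lieInvariant Sl2) (hnd : ∀ t, (∀ s, B s t = 0) → t = 0) {K K' : Set ℕ}
    (hK : ∀ k, k ∉ K → k ∈ K') {t : M ⊗[ℂ] N}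
    (ht : ∀ s ∈ componentSum M N K, B s t = 0) : t ∈ componentSum M N K' := by
  obtain ⟨c, hc, hcK, rfl⟩ := mem_componentSum_compl hu hu' hB hnd ht
  refine (componentSum M N K').toSubmodule.sum_mem fun k hk => ?_
  by_cases hkK : k ∈ K
  · rw [hcK k hkK]; exact zero_mem _
  · exact lieSpan_cgVec_le_componentSum hu hu' (hK k hkK)
      (Nat.lt_succ_iff.1 (Finset.mem_range.1 hk)) (hc k)

omit hu hu' [LieModule.IsIrreducible ℂ Sl2 M] [LieModule.IsIrreducible ℂ Sl2 N]
  [FiniteDimensional ℂ M] [FiniteDimensional ℂ N] in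
/-- The span of the vectors `(x + y)ᵃ xᵖ (u ⊗ u')`, `p ≤ l`, with `x = e ⊗ 1`, `y = 1 ⊗ e`. -/
def hybridSpan (u : M) (u' : N) (l : ℕ) : Submodule ℂ (M ⊗[ℂ] N) :=
  Submodule.span ℂ {t | ∃ p ≤ l, ∃ a, t = raised (mixed u u' p 0) a}

omit hu hu' [LieModule.IsIrreducible ℂ Sl2 M] [LieModule.IsIrreducible ℂ Sl2 N]
  [FiniteDimensional ℂ M] [FiniteDimensional ℂ N] in
theorem lie_e_mem_hybridSpan {l : ℕ} {t : M ⊗[ℂ] N} (ht : t ∈ hybridSpan u u' l) :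
    ⁅sl2E, t⁆ ∈ hybridSpan u u' l := by
  have : (hybridSpan u u' l).map (LieModule.toEnd ℂ Sl2 (M ⊗[ℂ] N) sl2E) ≤
      hybridSpan u u' l := by
    rw [hybridSpan, Submodule.map_span_le]
    rintro _ ⟨p, hp, a, rfl⟩
    exact Submodule.subset_span ⟨p, hp, a + 1, by
      rw [LieModule.toEnd_apply_apply, lie_e_raised]⟩
  exact this ⟨t, ht, rfl⟩

omit hu hu' [LieModule.IsIrreducible ℂ Sl2 M] [LieModule.IsIrreducible ℂ Sl2 N]
  [FiniteDimensional ℂ M] [FiniteDimensional ℂ N] in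
theorem leftAct_e_mem_hybridSpan {l : ℕ} {t : M ⊗[ℂ] N} (ht : t ∈ hybridSpan u u' l) :
    leftAct sl2E t ∈ hybridSpan u u' (l + 1) := by
  have : (hybridSpan u u' l).map (leftAct sl2E) ≤ hybridSpan u u' (l + 1) := by
    rw [hybridSpan, Submodule.map_span_le]
    rintro _ ⟨p, hp, a, rfl⟩
    refine Submodule.subset_span ⟨p + 1, by omega, a, ?_⟩
    rw [leftAct_e_raised, mixed, leftAct_tmul, lie_e_raised]
    rfl
  exact this ⟨t, ht, rfl⟩

omit hu hu' [LieModule.IsIrreducible ℂ Sl2 M] [LieModule.IsIrreducible ℂ Sl2 N]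
  [FiniteDimensional ℂ M] [FiniteDimensional ℂ N] in
-- A power of y is traded for powers of x + y and x through y = (x + y) - x.
theorem mixed_mem_hybridSpan (u : M) (u' : N) {l p q : ℕ} (h : p + q ≤ l) :
    mixed u u' p q ∈ hybridSpan u u' l := by
  induction q generalizing p with
  | zero => exact Submodule.subset_span ⟨p, h, 0, rfl⟩
  | succ q ih =>
    have := (hybridSpan u u' l).sub_mem (lie_e_mem_hybridSpan (ih (p := p) (by omega)))
      (ih (p := p + 1) (by omega))
    rwa [lie_e_mixed, add_sub_cancel_left] at this

theorem hybridSpan_le_componentSum (l : ℕ) :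
    hybridSpan u u' l ≤ (componentSum M N {k | k ≤ l}).toSubmodule := by
  by_cases hl : min μ ν ≤ l
  · rw [componentSum_Iic_eq_top hu hu' hl]
    exact le_top
  · rw [hybridSpan, Submodule.span_le]
    rintro _ ⟨p, hp, a, rfl⟩
    induction a with
    | zero =>
      exact componentSum_Iic_monotone (show p + 0 ≤ l from hp)
        (mixed_mem_componentSum hu hu' (by omega) (by omega))
    | succ a ih =>
      rw [← lie_e_raised]
      exact LieSubmodule.lie_mem _ ih

theorem lieSpan_cgVec_le_hybridSpan {k : ℕ} (hk : k ≤ min μ ν) :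
    (LieSubmodule.lieSpan ℂ Sl2 {cgVec u u' μ ν k}).toSubmodule ≤ hybridSpan u u' k := by
  have hw := cgVec_isPrimitive hu hu' (hk.trans (min_le_left _ _)) (hk.trans (min_le_right _ _))
  have h1 : LieSubmodule.lieSpan ℂ Sl2 {cgVec u u' μ ν k} ≤ chainSubmodule hw := by
    rw [LieSubmodule.lieSpan_le, Set.singleton_subset_iff]
    exact mem_chainSubmodule hw
  refine ((LieSubmodule.toSubmodule_le_toSubmodule _ _).2 h1).trans ?_
  rw [chainSubmodule_toSubmodule, Submodule.span_le]
  rintro _ ⟨⟨p, hp⟩, rfl⟩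
  change raised _ p ∈ hybridSpan u u' k
  clear hp
  induction p with
  | zero =>
    rw [raised_zero, cgVec]
    refine Submodule.sum_mem _ fun p hp => Submodule.smul_mem _ _ ?_
    have := Finset.mem_range.1 hp
    exact mixed_mem_hybridSpan u u' (by omega)
  | succ p ih =>
    rw [← lie_e_raised]
    exact lie_e_mem_hybridSpan ih

/-- With `hybridSpan_le_componentSum` this identifies V(l) with the vectors reached by at most l
uses of e on the first factor alone, a description that can be compared with the action of currents
near a diagonal. An element of V(l) is orthogonal to the components with k > l, so it only has parts
generated by `cgVec` with k ≤ l, and these lie in the hybrid span. -/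
theorem componentSum_le_hybridSpan {B : LinearMap.BilinForm ℂ (M ⊗[ℂ] N)}
    (hB : B.lieInvariant Sl2) (hnd : ∀ t, (∀ s, B s t = 0) → t = 0) (l : ℕ) :
    (componentSum M N {k | k ≤ l}).toSubmodule ≤ hybridSpan u u' l := by
  intro t ht
  obtain ⟨c, hc, hcK, rfl⟩ := mem_componentSum_compl hu hu' hB hnd (K := {k | l < k}) (t := t)
    fun s hs => componentSum_orthogonal hB (Set.disjoint_left.2
      fun k (hk : l < k) (hk' : k ≤ l) => absurd hk (not_lt.2 hk')) hs ht
  refine Submodule.sum_mem _ fun k hk => ?_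
  by_cases hkl : l < k
  · rw [hcK k hkl]; exact zero_mem _
  · refine Submodule.span_mono ?_ (lieSpan_cgVec_le_hybridSpan hu hu'
      (Nat.lt_succ_iff.1 (Finset.mem_range.1 hk)) (hc k))
    rintro _ ⟨p, hp, a, rfl⟩
    exact ⟨p, hp.trans (not_lt.1 hkl), a, rfl⟩

/-- For x = e this is visible in the hybrid description. Commutators of the diagonal f with e ⊗ 1
give h ⊗ 1 and then f ⊗ 1, and the diagonal action preserves both steps of the filtration. -/
theorem leftAct_mem_componentSum {B : LinearMap.BilinForm ℂ (M ⊗[ℂ] N)}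
    (hB : B.lieInvariant Sl2) (hnd : ∀ t, (∀ s, B s t = 0) → t = 0) (x : Sl2) {l : ℕ}
    {t : M ⊗[ℂ] N} (ht : t ∈ componentSum M N {k | k ≤ l}) :
    leftAct x t ∈ componentSum M N {k | k ≤ l + 1} := by
  set V := componentSum M N {k | k ≤ l}
  set V' := componentSum M N {k | k ≤ l + 1}
  have he : ∀ t ∈ V, leftAct sl2E t ∈ V' := fun t ht =>
    hybridSpan_le_componentSum hu hu' _ (leftAct_e_mem_hybridSpan
      (componentSum_le_hybridSpan hu hu' hB hnd l ht))
  have hlie : ∀ x y : Sl2, (∀ t ∈ V, leftAct y t ∈ V') → ∀ t ∈ V, leftAct ⁅x, y⁆ t ∈ V' := by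
    intro x y hy t ht
    rw [leftAct_lie]
    exact V'.sub_mem (V'.lie_mem (hy t ht)) (hy _ (V.lie_mem ht))
  have hh : ∀ t ∈ V, leftAct sl2H t ∈ V' := by
    have := hlie sl2F sl2E he
    intro t ht
    have h1 := V'.neg_mem (this t ht)
    have e : (⁅sl2F, sl2E⁆ : Sl2) = (-1 : ℂ) • sl2H := by
      rw [neg_one_smul, sl2H, lie_skew]
    rwa [e, leftAct_smul, neg_one_smul, neg_neg] at h1
  have hf : ∀ t ∈ V, leftAct sl2F t ∈ V' := by
    have := hlie sl2F sl2H hh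
    intro t ht
    have h1 := V'.smul_mem (1 / 2 : ℂ) (this t ht)
    have e : (⁅sl2F, sl2H⁆ : Sl2) = (2 : ℂ) • sl2F := by
      rw [← lie_skew, isSl2Triple.lie_lie_smul_f ℂ, neg_neg]
    rw [e, leftAct_smul, smul_smul] at h1
    simpa using h1
  obtain ⟨a, b, c, rfl⟩ := sl2_decomp x
  rw [leftAct_add, leftAct_add, leftAct_smul, leftAct_smul, leftAct_smul]
  exact V'.add_mem (V'.add_mem (V'.smul_mem _ (he t ht)) (V'.smul_mem _ (hf t ht)))
    (V'.smul_mem _ (hh t ht))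

/-- Dual to `leftAct_mem_componentSum`: the action on the first factor is skew for the form, and
membership in the opposite filtration can be tested by orthogonality to the complementary
components, which this action moves by at most one step. -/
theorem leftAct_mem_componentSum_opp {B : LinearMap.BilinForm ℂ (M ⊗[ℂ] N)}
    (hB : B.lieInvariant Sl2) (hnd : ∀ t, (∀ s, B s t = 0) → t = 0)
    (hskew : ∀ (x : Sl2) s t, B (leftAct x s) t = -B s (leftAct x t)) (x : Sl2) {r l : ℕ}
    {t : M ⊗[ℂ] N} (ht : t ∈ componentSum M N {k | r ≤ k + l}) :
    leftAct x t ∈ componentSum M N {k | r ≤ k + (l + 1)} := by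
  refine mem_componentSum_of_orthogonal hu hu' hB hnd (K := {k | k + (l + 1) < r})
    (fun k hk => (not_lt.1 hk : r ≤ k + (l + 1))) fun s hs => ?_
  rw [← neg_eq_zero, ← hskew]
  by_cases hr : l + 2 ≤ r
  · obtain ⟨r, rfl⟩ := Nat.exists_eq_add_of_le' hr
    have hs' : s ∈ componentSum M N {k | k ≤ r} :=
      componentSum_mono _ _ (fun k (hk : k + (l + 1) < r + (l + 2)) =>
        (by omega : k ≤ r)) hs
    exact componentSum_orthogonal hB (Set.disjoint_left.2
      fun k (hk : k ≤ r + 1) (hk' : r + (l + 2) ≤ k + l) => by omega)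
      (leftAct_mem_componentSum hu hu' hB hnd x hs') ht
  -- For r < l + 2 no natural number k satisfies k + (l + 1) < r, so the test space is zero.
  · have : s = 0 := by
      have h0 : (componentSum M N {k | k + (l + 1) < r}).toSubmodule ≤ ⊥ :=
        componentSum_toSubmodule_le fun U _ k (hk : k + (l + 1) < r) => by omega
      exact (Submodule.mem_bot ℂ).1 (h0 hs)
    rw [this, map_zero, map_zero, LinearMap.zero_apply]

end ClebschGordan

/-! ### The product form on two factors -/

section TensorForm

set_option linter.unusedSectionVars false

variable {M N : Type*} [AddCommGroup M] [Module ℂ M] [LieRingModule Sl2 M] [LieModule ℂ Sl2 M]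
  [AddCommGroup N] [Module ℂ N] [LieRingModule Sl2 N] [LieModule ℂ Sl2 N]

/-- The product of two bilinear forms. -/
def tensorForm (β : LinearMap.BilinForm ℂ M) (β' : LinearMap.BilinForm ℂ N) :
    LinearMap.BilinForm ℂ (M ⊗[ℂ] N) := LinearMap.BilinForm.tmul β β'

omit [LieRingModule Sl2 M] [LieModule ℂ Sl2 M] [LieRingModule Sl2 N] [LieModule ℂ Sl2 N] in
@[simp]
theorem tensorForm_tmul (β : LinearMap.BilinForm ℂ M) (β' : LinearMap.BilinForm ℂ N) (m m' : M)
    (n n' : N) : tensorForm β β' (m ⊗ₜ n) (m' ⊗ₜ n') = β m m' * β' n n' := by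
  simp [tensorForm, mul_comm]

variable {β : LinearMap.BilinForm ℂ M} {β' : LinearMap.BilinForm ℂ N}
  (hβ : β.lieInvariant Sl2) (hβ' : β'.lieInvariant Sl2)

include hβ in
theorem tensorForm_leftAct (x : Sl2) (s t : M ⊗[ℂ] N) :
    tensorForm β β' (leftAct x s) t = -tensorForm β β' s (leftAct x t) := by
  induction s using TensorProduct.induction_on with
  | zero => simp
  | add s s' hs hs' => simp only [map_add, LinearMap.add_apply, hs, hs']; ring
  | tmul m n =>
    induction t using TensorProduct.induction_on with
    | zero => simp
    | add t t' ht ht' => simp only [map_add, ht, ht']; ring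
    | tmul m' n' => simp [hβ x m m']

include hβ' in
theorem tensorForm_rightAct (x : Sl2) (s t : M ⊗[ℂ] N) :
    tensorForm β β' (rightAct x s) t = -tensorForm β β' s (rightAct x t) := by
  induction s using TensorProduct.induction_on with
  | zero => simp
  | add s s' hs hs' => simp only [map_add, LinearMap.add_apply, hs, hs']; ring
  | tmul m n =>
    induction t using TensorProduct.induction_on with
    | zero => simp
    | add t t' ht ht' => simp only [map_add, ht, ht']; ring
    | tmul m' n' => simp [hβ' x n n']

include hβ hβ' in
theorem tensorForm_lieInvariant : (tensorForm β β').lieInvariant Sl2 := by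
  intro x s t
  rw [lie_eq_leftAct_add_rightAct, lie_eq_leftAct_add_rightAct, map_add, LinearMap.add_apply,
    map_add, tensorForm_leftAct hβ, tensorForm_rightAct hβ']
  ring

include hβ hβ' in
theorem tensorForm_nondegenerate [FiniteDimensional ℂ M] [LieModule.IsIrreducible ℂ Sl2 M]
    [FiniteDimensional ℂ N] [LieModule.IsIrreducible ℂ Sl2 N] {u : M} {u' : N} {μ ν : ℕ}
    (hu : IsPrimitive u μ) (hu' : IsPrimitive u' ν) (h : β u (raised u μ) ≠ 0)
    (h' : β' u' (raised u' ν) ≠ 0) (t : M ⊗[ℂ] N) (ht : ∀ s, tensorForm β β' s t = 0) :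
    t = 0 := by
  refine ((raisedBasis hu).tensorProduct (raisedBasis hu')).ext_elem fun x => ?_
  rw [repr_eq_of_biorthogonal _ (tensorForm β β')
    (fun x => raisedDual β u μ x.1 ⊗ₜ raisedDual β' u' ν x.2) _ x t, ht, map_zero,
    Finsupp.zero_apply]
  intro x y
  rw [Module.Basis.tensorProduct_apply, tensorForm_tmul, raisedBasis_apply, raisedBasis_apply,
    raisedDual_apply hβ hu h (Nat.lt_succ_iff.1 x.1.2),
    raisedDual_apply hβ' hu' h' (Nat.lt_succ_iff.1 x.2.2), ite_zero_mul_ite_zero, mul_one]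
  simp only [Prod.ext_iff, Fin.ext_iff]

end TensorForm

/-! ### Operators on tensor factors and the diagonal conditions -/

section PairImage

variable {n : ℕ} {W : Fin n → Type*} [∀ i, AddCommGroup (W i)] [∀ i, Module ℂ (W i)]

theorem atSite_tprod (i : Fin n) (A : Module.End ℂ (W i)) (x : ∀ p, W p) :
    atSite i A (PiTensorProduct.tprod ℂ x) =
      PiTensorProduct.tprod ℂ (Function.update x i (A (x i))) := by
  rw [atSite_apply, PiTensorProduct.map_tprod]
  congr 1
  funext p
  by_cases h : p = i
  · subst h; simp
  · simp [Function.update_of_ne h]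

theorem insertPair_tmul {i j : Fin n} (hij : i ≠ j) (w : ∀ p, W p) (x : W i) (y : W j) :
    insertPair hij w (x ⊗ₜ[ℂ] y) =
      PiTensorProduct.tprod ℂ (Function.update (Function.update w i x) j y) := rfl

theorem insertPair_apply_self {i j : Fin n} (hij : i ≠ j) (w : ∀ p, W p) :
    insertPair hij w (w i ⊗ₜ[ℂ] w j) = PiTensorProduct.tprod ℂ w := by
  rw [insertPair_tmul, Function.update_eq_self, Function.update_eq_self]

theorem atSite_insertPair_of_ne {i j p : Fin n} (hij : i ≠ j) (hpi : p ≠ i) (hpj : p ≠ j)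
    (A : Module.End ℂ (W p)) (w : ∀ p, W p) (t : W i ⊗[ℂ] W j) :
    atSite p A (insertPair hij w t) =
      insertPair hij (Function.update w p (A (w p))) t := by
  induction t using TensorProduct.induction_on with
  | zero => simp
  | add s t hs ht => simp only [map_add, hs, ht]
  | tmul x y =>
    rw [insertPair_tmul, insertPair_tmul, atSite_tprod, Function.update_of_ne hpj,
      Function.update_of_ne hpi, Function.update_comm hpj.symm, Function.update_comm hpi.symm]

theorem atSite_insertPair_left {i j : Fin n} (hij : i ≠ j) (A : Module.End ℂ (W i))
    (w : ∀ p, W p) (t : W i ⊗[ℂ] W j) :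
    atSite i A (insertPair hij w t) = insertPair hij w (LinearMap.rTensor (W j) A t) := by
  induction t using TensorProduct.induction_on with
  | zero => simp
  | add s t hs ht => simp only [map_add, hs, ht]
  | tmul x y =>
    rw [LinearMap.rTensor_tmul, insertPair_tmul, insertPair_tmul, atSite_tprod,
      Function.update_of_ne hij, Function.update_self, Function.update_comm hij.symm,
      Function.update_idem]

theorem atSite_insertPair_right {i j : Fin n} (hij : i ≠ j) (A : Module.End ℂ (W j))
    (w : ∀ p, W p) (t : W i ⊗[ℂ] W j) :
    atSite j A (insertPair hij w t) = insertPair hij w (LinearMap.lTensor (W i) A t) := by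
  induction t using TensorProduct.induction_on with
  | zero => simp
  | add s t hs ht => simp only [map_add, hs, ht]
  | tmul x y =>
    rw [LinearMap.lTensor_tmul, insertPair_tmul, insertPair_tmul, atSite_tprod,
      Function.update_self, Function.update_idem]

theorem insertPair_mem_pairImage {i j : Fin n} (hij : i ≠ j) {U : Submodule ℂ (W i ⊗[ℂ] W j)}
    (w : ∀ p, W p) {t : W i ⊗[ℂ] W j} (ht : t ∈ U) : insertPair hij w t ∈ pairImage hij U :=
  Submodule.mem_iSup_of_mem w ⟨t, ht, rfl⟩

theorem pairImage_le {i j : Fin n} (hij : i ≠ j) {U : Submodule ℂ (W i ⊗[ℂ] W j)}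
    {S : Submodule ℂ (Tens W)} (h : ∀ w, ∀ t ∈ U, insertPair hij w t ∈ S) :
    pairImage hij U ≤ S := by
  refine iSup_le fun w => ?_
  rw [Submodule.map_le_iff_le_comap]
  exact h w

theorem evalAt_baseChange (φ : Module.End ℂ (Tens W)) (Z : Fin n → ℂ) (f : ValPol W) :
    evalAt Z (LinearMap.baseChange (Pol n) φ f) = φ (evalAt Z f) := by
  induction f using TensorProduct.induction_on with
  | zero => simp
  | add f g hf hg => simp only [map_add, hf, hg]
  | tmul p x => simp [evalAt]

theorem baseChange_mem_transverse (φ : Module.End ℂ (Tens W)) {i j : Fin n} {f : ValPol W}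
    (hf : f ∈ transverse W i j) : LinearMap.baseChange (Pol n) φ f ∈ transverse W i j := by
  obtain ⟨y, rfl⟩ := hf
  refine ⟨LinearMap.lTensor _ φ y, ?_⟩
  induction y using TensorProduct.induction_on with
  | zero => simp
  | add f g hf hg => simp only [map_add, hf, hg]
  | tmul p x => simp

theorem DiagCondition.baseChange {i j : Fin n} {hij : i ≠ j}
    {V V' : ℕ → Submodule ℂ (W i ⊗[ℂ] W j)} {f : ValPol W} (hf : DiagCondition hij V f)
    (φ : Module.End ℂ (Tens W)) (h : ∀ k, ∀ w, ∀ t ∈ V k,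
      φ (insertPair hij w t) ∈ pairImage hij (V' k)) :
    DiagCondition hij V' (LinearMap.baseChange (Pol n) φ f) := by
  obtain ⟨g, rfl, hg⟩ := hf
  refine ⟨g.mapRange (LinearMap.baseChange (Pol n) φ) (map_zero _), ?_, fun k => ⟨?_, fun Z => ?_⟩⟩
  · rw [Finsupp.sum_mapRange_index (by simp), Finsupp.sum, Finsupp.sum, map_sum]
    simp only [map_smul]
  · rw [Finsupp.mapRange_apply]
    exact baseChange_mem_transverse φ (hg k).1
  · rw [Finsupp.mapRange_apply, evalAt_baseChange]
    have : pairImage hij (V k) ≤ (pairImage hij (V' k)).comap φ := pairImage_le hij (h k)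
    exact this ((hg k).2 Z)

/-- A factor z_i - z_j shifts the expansion by one index. It thereby compensates an operator that
moves the filtration up by one step. -/
theorem DiagCondition.smul_diff_succ {i j : Fin n} {hij : i ≠ j}
    {V : ℕ → Submodule ℂ (W i ⊗[ℂ] W j)} {f : ValPol W}
    (hf : DiagCondition hij (fun k => V (k + 1)) f) :
    DiagCondition hij V ((MvPolynomial.X i - MvPolynomial.X j : Pol n) • f) := by
  obtain ⟨g, rfl, hg⟩ := hf
  refine ⟨g.embDomain ⟨Nat.succ, Nat.succ_injective⟩, ?_, fun k => ?_⟩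
  · rw [Finsupp.sum_embDomain, Finsupp.smul_sum]
    simp only [smul_smul, Function.Embedding.coeFn_mk, Nat.succ_eq_add_one, pow_succ']
  · cases k with
    | zero =>
      rw [Finsupp.embDomain_of_notMem_range _ _ _ (by simp)]
      exact ⟨by simp, fun Z => by simp⟩
    | succ k =>
      have h : g.embDomain ⟨Nat.succ, Nat.succ_injective⟩ (k + 1) = g k :=
        Finsupp.embDomain_apply_self ⟨Nat.succ, Nat.succ_injective⟩ g k
      rw [h]
      exact hg k

end PairImage

/-! ### Stability of F^c and F̂^c under the current algebra -/

section CurrentStable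

variable {n : ℕ} {W : Fin n → Type*} [∀ i, AddCommGroup (W i)] [∀ i, Module ℂ (W i)]
  [∀ i, LieRingModule Sl2 (W i)] [∀ i, LieModule ℂ Sl2 (W i)]

theorem aeval_sub_aeval_dvd (p : Polynomial ℂ) (i j : Fin n) :
    (MvPolynomial.X i - MvPolynomial.X j : Pol n) ∣
      Polynomial.aeval (MvPolynomial.X i : Pol n) p -
        Polynomial.aeval (MvPolynomial.X j : Pol n) p := by
  rw [Polynomial.aeval_def, Polynomial.aeval_def, ← Polynomial.eval_map, ← Polynomial.eval_map]
  exact Polynomial.sub_dvd_eval_sub _ _ _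

/-- Conditions for a family of filtrations by Lie submodules which make the space of conditioned
vector-valued polynomials stable under the current algebra. -/
theorem conditioned_isCurrentStable (V : ∀ i j : Fin n, ℕ →o Submodule ℂ (W i ⊗[ℂ] W j))
    (h₀ : ∀ (i j : Fin n) (k : ℕ) (x : Sl2), ∀ t ∈ V i j k, ⁅x, t⁆ ∈ V i j k)
    (h₁ : ∀ (i j : Fin n) (k : ℕ) (x : Sl2), ∀ t ∈ V i j k, leftAct x t ∈ V i j (k + 1)) :
    IsCurrentStable Sl2 (conditioned V) := by
  intro a f hf i j hij
  induction a using TensorProduct.induction_on with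
  | zero =>
    rw [map_zero, LinearMap.zero_apply]
    exact DiagCondition.zero _ _
  | add a b ha hb =>
    rw [map_add, LinearMap.add_apply]
    exact ha.add hb
  | tmul p x =>
    have hf := hf i j hij
    have hmono := (V i j).monotone
    have hne := hij.ne
    obtain ⟨r, hr⟩ := aeval_sub_aeval_dvd p i j
    rw [currentAct_tmul, LinearMap.sum_apply, ← Finset.add_sum_erase _ _ (Finset.mem_univ i),
      ← Finset.add_sum_erase _ _ (Finset.mem_erase.2 ⟨hne.symm, Finset.mem_univ j⟩), ← add_assoc]
    refine DiagCondition.add ?_ ?_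
    -- With p(z_i) - p(z_j) = (z_i - z_j) r the two terms become p(z_j)(x^(i) + x^(j)) + r (z_i -
    -- z_j) x^(i). The first operator preserves the filtration; the second moves it by one step,
    -- which the factor z_i - z_j compensates.
    · have e : (Polynomial.aeval (MvPolynomial.X i : Pol n) p •
          onSite i (LieModule.toEnd ℂ Sl2 (W i) x)) f +
          (Polynomial.aeval (MvPolynomial.X j : Pol n) p •
          onSite j (LieModule.toEnd ℂ Sl2 (W j) x)) f =
          Polynomial.aeval (MvPolynomial.X j : Pol n) p • (LinearMap.baseChange (Pol n)
            (atSite i (LieModule.toEnd ℂ Sl2 (W i) x) +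
              atSite j (LieModule.toEnd ℂ Sl2 (W j) x)) f) +
          r • ((MvPolynomial.X i - MvPolynomial.X j : Pol n) •
            LinearMap.baseChange (Pol n) (atSite i (LieModule.toEnd ℂ Sl2 (W i) x)) f) := by
        rw [LinearMap.baseChange_add, smul_smul, mul_comm r, ← hr]
        simp only [LinearMap.smul_apply, LinearMap.add_apply, onSite_apply, smul_add, sub_smul]
        abel
      rw [e]
      refine DiagCondition.add (DiagCondition.smul hmono _ (hf.baseChange _ fun k w t ht => ?_))
        (DiagCondition.smul hmono _ (DiagCondition.smul_diff_succ
          (hf.baseChange _ fun k w t ht => ?_)))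
      · rw [LinearMap.add_apply, atSite_insertPair_left, atSite_insertPair_right, ← map_add]
        refine insertPair_mem_pairImage _ _ ?_
        have := h₀ i j k x t ht
        rwa [lie_eq_leftAct_add_rightAct] at this
      · rw [atSite_insertPair_left]
        exact insertPair_mem_pairImage _ _ (h₁ i j k x t ht)
    · rw [← Finset.sum_coe_sort]
      refine Finset.sum_induction _ (DiagCondition hne (V i j))
        (fun _ _ => DiagCondition.add) (DiagCondition.zero _ _) fun q _ => ?_
      have hq := Finset.mem_erase.1 q.2
      have hq' := Finset.mem_erase.1 hq.2
      rw [LinearMap.smul_apply]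
      refine DiagCondition.smul hmono _ (hf.baseChange _ fun k w t ht => ?_)
      rw [atSite_insertPair_of_ne _ hq'.1 hq.1]
      exact insertPair_mem_pairImage _ _ ht

theorem lie_mem_toSubmodule {M : Type*} [AddCommGroup M] [Module ℂ M] [LieRingModule Sl2 M]
    [LieModule ℂ Sl2 M] (V : LieSubmodule ℂ Sl2 M) (x : Sl2) {t : M} (ht : t ∈ V.toSubmodule) :
    ⁅x, t⁆ ∈ V.toSubmodule := V.lie_mem ht

variable [∀ i, FiniteDimensional ℂ (W i)] [∀ i, LieModule.IsIrreducible ℂ Sl2 (W i)]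
  {u v : ∀ i, W i} (hu : ∀ i, IsHighest (u i)) (hv : ∀ i, IsLowest (v i))
  {β : ∀ i, LinearMap.BilinForm ℂ (W i)}
  (hβ : ∀ i, (β i).lieInvariant Sl2 ∧ β i (u i) (v i) = 1)

include hu hv hβ

theorem tensorForm_nondeg (i j : Fin n) (t : W i ⊗[ℂ] W j)
    (ht : ∀ s, tensorForm (β i) (β j) s t = 0) : t = 0 :=
  tensorForm_nondegenerate (hβ i).1 (hβ j).1 (hu i).isPrimitive (hu j).isPrimitive
    (lieInvariant_top_ne_zero (hu i).isPrimitive (hv i) (hβ i).2)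
    (lieInvariant_top_ne_zero (hu j).isPrimitive (hv j) (hβ j).2) t ht

theorem Fc_isCurrentStable : IsCurrentStable Sl2 (Fc W) :=
  conditioned_isCurrentStable _ (fun _ _ _ x _ ht => lie_mem_toSubmodule _ x ht)
    fun i j _ x _ ht => leftAct_mem_componentSum (hu i).isPrimitive (hu j).isPrimitive
      (tensorForm_lieInvariant (hβ i).1 (hβ j).1) (tensorForm_nondeg hu hv hβ i j) x ht

theorem FcHat_isCurrentStable : IsCurrentStable Sl2 (FcHat W) :=
  conditioned_isCurrentStable _ (fun _ _ _ x _ ht => lie_mem_toSubmodule _ x ht)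
    fun i j _ x _ ht => leftAct_mem_componentSum_opp (hu i).isPrimitive (hu j).isPrimitive
      (tensorForm_lieInvariant (hβ i).1 (hβ j).1) (tensorForm_nondeg hu hv hβ i j)
      (tensorForm_leftAct (hβ i).1) x ht

end CurrentStable

/-! ### Divisibility by powers of z_i - z_j -/

section DiagonalPolynomials

variable {n : ℕ}

open MvPolynomial in
/-- The retraction of `ℂ[z₁, …, zₙ]` onto the polynomials in `z_i + z_j` and the `z_p`,
`p ≠ i, j`, which sends `z_i` and `z_j` to their mean. -/
def midpoint (i j : Fin n) : Pol n →ₐ[ℂ] Pol n :=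
  aeval fun l => if l = i ∨ l = j then C (1 / 2) * (X i + X j) else X l

theorem C_half_mul_two : (MvPolynomial.C (1 / 2 : ℂ) : Pol n) * 2 = 1 := by
  rw [← map_ofNat (MvPolynomial.C : ℂ →+* Pol n) 2, ← map_mul]
  norm_num

theorem midpoint_diff (i j : Fin n) :
    midpoint i j (MvPolynomial.X i - MvPolynomial.X j) = 0 := by
  simp [midpoint]

theorem diff_dvd_sub_midpoint (i j : Fin n) (p : Pol n) :
    (MvPolynomial.X i - MvPolynomial.X j : Pol n) ∣ p - midpoint i j p := by
  induction p using MvPolynomial.induction_on with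
  | C c => simp [midpoint]
  | add p q hp hq =>
    rw [map_add, add_sub_add_comm]
    exact dvd_add hp hq
  | mul_X p l hp =>
    have hl : (MvPolynomial.X i - MvPolynomial.X j : Pol n) ∣
        MvPolynomial.X l - midpoint i j (MvPolynomial.X l) := by
      by_cases h : l = i ∨ l = j
      · simp only [midpoint, MvPolynomial.aeval_X, if_pos h]
        rcases h with rfl | rfl
        · exact ⟨MvPolynomial.C (1 / 2), by
            linear_combination (-MvPolynomial.X l) * C_half_mul_two (n := n)⟩
        · exact ⟨-MvPolynomial.C (1 / 2), by
            linear_combination (-MvPolynomial.X l) * C_half_mul_two (n := n)⟩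
      · simp [midpoint, if_neg h]
    rw [map_mul]
    have e : p * MvPolynomial.X l - midpoint i j p * midpoint i j (MvPolynomial.X l) =
        (p - midpoint i j p) * MvPolynomial.X l +
          midpoint i j p * (MvPolynomial.X l - midpoint i j (MvPolynomial.X l)) := by ring
    rw [e]
    exact dvd_add (hp.mul_right _) (hl.mul_left _)

theorem diff_dvd_iff (i j : Fin n) (p : Pol n) :
    (MvPolynomial.X i - MvPolynomial.X j : Pol n) ∣ p ↔ midpoint i j p = 0 := by
  constructor
  · rintro ⟨q, rfl⟩
    rw [map_mul, midpoint_diff, zero_mul]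
  · intro h
    simpa [h] using diff_dvd_sub_midpoint i j p

theorem diff_ne_zero {i j : Fin n} (h : i ≠ j) :
    (MvPolynomial.X i - MvPolynomial.X j : Pol n) ≠ 0 := by
  rw [Ne, sub_eq_zero]
  exact fun e => h (MvPolynomial.X_injective e)

/-- The multiples of z_i - z_j form the kernel of `midpoint`, a ring homomorphism into a domain. -/
theorem diff_prime {i j : Fin n} (h : i ≠ j) :
    Prime (MvPolynomial.X i - MvPolynomial.X j : Pol n) := by
  refine ⟨diff_ne_zero h, fun hu => ?_, fun p q hpq => ?_⟩
  · have := (diff_dvd_iff i j (1 : Pol n)).1 hu.dvd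
    simp at this
  · rw [diff_dvd_iff, map_mul, mul_eq_zero] at hpq
    rwa [diff_dvd_iff, diff_dvd_iff]

theorem midpoint_of_mem_transversePol {i j : Fin n} {q : Pol n} (hq : q ∈ transversePol i j) :
    midpoint i j q = q := by
  have : transversePol i j ≤ AlgHom.equalizer (midpoint i j) (AlgHom.id ℂ (Pol n)) := by
    refine Algebra.adjoin_le ?_
    rintro _ (rfl | ⟨p, ⟨hpi, hpj⟩, rfl⟩)
    · rw [SetLike.mem_coe, AlgHom.mem_equalizer]
      simp only [midpoint, map_add, MvPolynomial.aeval_X, true_or, or_true, if_true,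
        AlgHom.coe_id, id_eq]
      linear_combination (MvPolynomial.X i + MvPolynomial.X j) * C_half_mul_two (n := n)
    · rw [SetLike.mem_coe, AlgHom.mem_equalizer]
      simp [midpoint, hpi, hpj]
  exact this hq

theorem not_diff_dvd_diff {i j k l : Fin n} (hkl : k ≠ l) (h : ¬(k = i ∧ l = j))
    (h' : ¬(k = j ∧ l = i)) : ¬(MvPolynomial.X i - MvPolynomial.X j : Pol n) ∣
      MvPolynomial.X k - MvPolynomial.X l := by
  rintro ⟨q, hq⟩
  have key : ∀ Z : Fin n → ℂ, Z i = Z j → Z k = Z l := by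
    intro Z hZ
    have := congrArg (MvPolynomial.eval Z) hq
    simp only [map_sub, map_mul, MvPolynomial.eval_X, hZ, sub_self, zero_mul] at this
    exact sub_eq_zero.1 this
  by_cases hk : k = i ∨ k = j
  · have hl : l ≠ i ∧ l ≠ j := by
      constructor <;> rintro rfl <;> rcases hk with rfl | rfl <;> simp_all
    have := key (Pi.single l 1) (by simp [hl.1.symm, hl.2.symm])
    simp [hkl] at this
  · push Not at hk
    have := key (Pi.single k 1) (by simp [hk.1.symm, hk.2.symm])
    simp [hkl.symm] at this

theorem diff_isRelPrime_diff {i j k l : Fin n} (hij : i ≠ j) (hkl : k ≠ l) (h : ¬(k = i ∧ l = j))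
    (h' : ¬(k = j ∧ l = i)) : IsRelPrime (MvPolynomial.X i - MvPolynomial.X j : Pol n)
      (MvPolynomial.X k - MvPolynomial.X l) :=
  (diff_prime hij).irreducible.isRelPrime_iff_not_dvd.2 (not_diff_dvd_diff hkl h h')

theorem prod_diff_pow_dvd (m : Fin n → Fin n → ℕ) {p : Pol n}
    (h : ∀ i j, i < j → (MvPolynomial.X i - MvPolynomial.X j) ^ m i j ∣ p) :
    ∏ i, ∏ j ∈ Finset.Ioi i, (MvPolynomial.X i - MvPolynomial.X j : Pol n) ^ m i j ∣ p := by
  rw [Finset.prod_sigma']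
  refine Finset.prod_dvd_of_isRelPrime ?_ ?_
  · rintro ⟨i, j⟩ hij ⟨k, l⟩ hkl hne
    simp only [Finset.coe_sigma, Set.mem_sigma_iff, Finset.coe_Ioi, Set.mem_Ioi] at hij hkl
    refine (diff_isRelPrime_diff hij.2.ne hkl.2.ne ?_ ?_).pow
    · rintro ⟨rfl, rfl⟩
      exact hne rfl
    · rintro ⟨rfl, rfl⟩
      exact lt_asymm hij.2 hkl.2
  · rintro ⟨i, j⟩ hij
    exact h i j (by simpa using hij)

/-- Uniqueness of the expansion in powers of z_i - z_j. Once the lower coefficients vanish, z_i -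
z_j divides q_k, so `midpoint` kills q_k; but `midpoint` fixes transverse polynomials. -/
theorem eq_zero_of_diff_pow_dvd {i j : Fin n} (hij : i ≠ j) {M : ℕ} (q : ℕ →₀ Pol n)
    (hq : ∀ k, q k ∈ transversePol i j)
    (h : (MvPolynomial.X i - MvPolynomial.X j : Pol n) ^ M ∣
      q.sum fun k x => (MvPolynomial.X i - MvPolynomial.X j) ^ k * x) {k : ℕ} (hk : k < M) :
    q k = 0 := by
  set s : Pol n := MvPolynomial.X i - MvPolynomial.X j with hs
  induction k using Nat.strong_induction_on with
  | _ k ih =>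
    have hsum : s ^ (k + 1) ∣ s ^ k * q k := by
      have h1 : s ^ (k + 1) ∣ q.sum fun k x => s ^ k * x := (pow_dvd_pow s hk).trans h
      have h2 : (q.sum fun k x => s ^ k * x) =
          s ^ k * q k + ∑ l ∈ q.support.erase k, s ^ l * q l := by
        rw [Finsupp.sum]
        by_cases hks : k ∈ q.support
        · exact (Finset.add_sum_erase _ (fun l => s ^ l * q l) hks).symm
        · rw [Finsupp.notMem_support_iff.1 hks, mul_zero, zero_add, Finset.erase_eq_of_notMem hks]
      rw [h2] at h1
      refine (dvd_add_left (Finset.dvd_sum fun l hl => ?_)).1 h1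
      rcases lt_trichotomy l k with hlk | rfl | hlk
      · rw [ih l hlk (hlk.trans hk), mul_zero]
        exact dvd_zero _
      · exact absurd rfl (Finset.ne_of_mem_erase hl)
      · exact (pow_dvd_pow s hlk).mul_right _
    rw [pow_succ] at hsum
    have := (diff_dvd_iff i j _).1
      ((mul_dvd_mul_iff_left (pow_ne_zero k (diff_ne_zero hij))).1 hsum)
    rwa [midpoint_of_mem_transversePol (hq k)] at this

end DiagonalPolynomials

/-! ### Diagonal conditions expressed through the pairing χ -/

section PairDecomposition

variable {n : ℕ} {W : Fin n → Type*} [∀ i, AddCommGroup (W i)] [∀ i, Module ℂ (W i)]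

theorem pairImage_top {i j : Fin n} (hij : i ≠ j) : pairImage (W := W) hij ⊤ = ⊤ := by
  rw [eq_top_iff, ← PiTensorProduct.span_tprod_eq_top, Submodule.span_le]
  rintro _ ⟨x, rfl⟩
  rw [← insertPair_apply_self hij]
  exact insertPair_mem_pairImage hij x trivial

theorem diagCondition_tmul {i j : Fin n} (hij : i ≠ j) {V : ℕ → Submodule ℂ (W i ⊗[ℂ] W j)}
    {t : Tens W} (ht : t ∈ pairImage hij (V 0)) : DiagCondition hij V (1 ⊗ₜ[ℂ] t) := by
  refine ⟨Finsupp.single 0 (1 ⊗ₜ[ℂ] t), by simp, fun k => ?_⟩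
  rcases Nat.eq_zero_or_pos k with rfl | hk
  · rw [Finsupp.single_eq_same]
    refine ⟨⟨1 ⊗ₜ t, by simp⟩, fun Z => ?_⟩
    simpa [evalAt] using ht
  · rw [Finsupp.single_eq_of_ne hk.ne']
    simp

/-- Existence of the expansion in powers of z_i - z_j: the constant filtration imposes no condition
on values, it holds for constants, and diagonal conditions are stable under polynomials. -/
theorem diagCondition_top {i j : Fin n} (hij : i ≠ j) (f : ValPol W) :
    DiagCondition hij (fun _ => ⊤) f := by
  induction f using TensorProduct.induction_on with
  | zero => exact DiagCondition.zero _ _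
  | add f g hf hg => exact hf.add hg
  | tmul p t =>
    have : (p ⊗ₜ[ℂ] t : ValPol W) = p • (1 ⊗ₜ[ℂ] t) := by
      rw [TensorProduct.smul_tmul', smul_eq_mul, mul_one]
    rw [this]
    refine DiagCondition.smul (V := fun _ => ⊤) monotone_const p (diagCondition_tmul hij ?_)
    rw [pairImage_top]
    trivial

variable (β : ∀ i, LinearMap.BilinForm ℂ (W i))

theorem prodForm_insertPair {i j : Fin n} (hij : i ≠ j) (w w' : ∀ p, W p)
    (t t' : W i ⊗[ℂ] W j) :
    prodForm β (insertPair hij w t) (insertPair hij w' t') =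
      tensorForm (β i) (β j) t t' *
        ∏ p ∈ (Finset.univ.erase i).erase j, β p (w p) (w' p) := by
  induction t using TensorProduct.induction_on with
  | zero => simp
  | add s t hs ht => simp only [map_add, LinearMap.add_apply, hs, ht, add_mul]
  | tmul x y =>
    induction t' using TensorProduct.induction_on with
    | zero => simp
    | add s t hs ht => simp only [map_add, hs, ht, add_mul]
    | tmul x' y' =>
      rw [insertPair_tmul, insertPair_tmul, prodForm_tprod, tensorForm_tmul,
        ← Finset.mul_prod_erase _ _ (Finset.mem_univ i),
        ← Finset.mul_prod_erase _ _ (Finset.mem_erase.2 ⟨hij.symm, Finset.mem_univ j⟩),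
        ← mul_assoc]
      simp only [Function.update_self, Function.update_of_ne hij]
      congr 1
      refine Finset.prod_congr rfl fun p hp => ?_
      have hpj := Finset.ne_of_mem_erase hp
      have hpi := Finset.ne_of_mem_erase (Finset.mem_of_mem_erase hp)
      simp only [Function.update_of_ne hpj, Function.update_of_ne hpi]

variable {β}

theorem prodForm_pairImage_eq_zero {i j : Fin n} {hij : i ≠ j}
    {U U' : Submodule ℂ (W i ⊗[ℂ] W j)}
    (h : ∀ t ∈ U, ∀ t' ∈ U', tensorForm (β i) (β j) t t' = 0) {t t' : Tens W}
    (ht : t ∈ pairImage hij U) (ht' : t' ∈ pairImage hij U') : prodForm β t t' = 0 := by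
  have h1 : ∀ w', ∀ s' ∈ U', pairImage hij U ≤
      LinearMap.ker ((prodForm β).flip (insertPair hij w' s')) := fun w' s' hs' =>
    pairImage_le hij fun w s hs => by
      change prodForm β (insertPair hij w s) (insertPair hij w' s') = 0
      rw [prodForm_insertPair, h s hs s' hs', zero_mul]
  have h2 : pairImage hij U' ≤ LinearMap.ker (prodForm β t) := pairImage_le hij fun w' s' hs' =>
    h1 w' s' hs' ht
  exact h2 ht'

/-- If the filtrations `V` and `V'` are orthogonal in total degrees below `M`, then `χ` of
vector-valued polynomials subject to the corresponding conditions is divisible by the `M`-th power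
of `z_i - z_j`. -/
theorem DiagCondition.diff_pow_dvd_chi {i j : Fin n} {hij : i ≠ j}
    {V V' : ℕ → Submodule ℂ (W i ⊗[ℂ] W j)} {M : ℕ}
    (h : ∀ k l, k + l < M → ∀ t ∈ V k, ∀ t' ∈ V' l, tensorForm (β i) (β j) t t' = 0)
    {f f' : ValPol W} (hf : DiagCondition hij V f) (hf' : DiagCondition hij V' f') :
    (MvPolynomial.X i - MvPolynomial.X j) ^ M ∣ chi β f f' := by
  obtain ⟨g, rfl, hg⟩ := hf
  obtain ⟨g', rfl, hg'⟩ := hf'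
  have e : ∀ x : ValPol W, (MvPolynomial.X i - MvPolynomial.X j) ^ M ∣ chi β x
      (g'.sum fun k y => (MvPolynomial.X i - MvPolynomial.X j : Pol n) ^ k • y) ↔
      (MvPolynomial.X i - MvPolynomial.X j) ^ M ∣
        ∑ l ∈ g'.support, (MvPolynomial.X i - MvPolynomial.X j) ^ l * chi β x (g' l) := by
    intro x
    rw [Finsupp.sum, map_sum]
    simp only [map_smul, smul_eq_mul]
  rw [e]
  refine Finset.dvd_sum fun l _ => ?_
  rw [Finsupp.sum, map_sum, LinearMap.sum_apply, Finset.mul_sum]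
  refine Finset.dvd_sum fun k _ => ?_
  rw [map_smul, LinearMap.smul_apply, smul_eq_mul, ← mul_assoc, ← pow_add]
  by_cases hkl : M ≤ l + k
  · exact (pow_dvd_pow _ hkl).mul_right _
  · have h0 : chi β (g k) (g' l) = 0 := by
      refine MvPolynomial.funext fun Z => ?_
      rw [eval_chi, map_zero]
      exact prodForm_pairImage_eq_zero (h k l (by omega)) ((hg k).2 Z) ((hg' l).2 Z)
    rw [h0, mul_zero]
    exact dvd_zero _

/-- Expand t along a basis of the factors other than i, j, with coefficients in W_i ⊗ W_j. Pairing
with the dual basis in those factors isolates one coefficient, which is then orthogonal to U and so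
lies in U'. -/
theorem mem_pairImage_of_orthogonal {ι : Fin n → Type*} [∀ p, Fintype (ι p)]
    [∀ p, DecidableEq (ι p)] (b : ∀ p, Module.Basis (ι p) ℂ (W p)) (b' : ∀ p, ι p → W p)
    (hb : ∀ p q r, β p (b' p q) (b p r) = if q = r then 1 else 0) (r₀ : ∀ p, ι p)
    {i j : Fin n} (hij : i ≠ j) {U U' : Submodule ℂ (W i ⊗[ℂ] W j)}
    (hU : ∀ t, (∀ s ∈ U, tensorForm (β i) (β j) s t = 0) → t ∈ U') {t : Tens W}
    (ht : ∀ s ∈ pairImage hij U, prodForm β s t = 0) : t ∈ pairImage hij U' := by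
  classical
  -- `insertPair` ignores the entries of r at i and j. Freezing them at r₀ leaves exactly one
  -- summand for each basis tensor of the other factors.
  have hdec : ∀ t : Tens W, ∃ c : (∀ p, ι p) → W i ⊗[ℂ] W j,
      (∀ r, r i ≠ r₀ i ∨ r j ≠ r₀ j → c r = 0) ∧
      t = ∑ r, insertPair hij (fun p => b p (r p)) (c r) := by
    intro t
    have htop : t ∈ Submodule.span ℂ (Set.range (Basis.piTensorProduct b)) := by
      rw [Module.Basis.span_eq]; trivial
    induction htop using Submodule.span_induction with
    | zero => exact ⟨0, by simp, by simp⟩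
    | add x y _ _ hx hy =>
      obtain ⟨c, hc, rfl⟩ := hx
      obtain ⟨c', hc', rfl⟩ := hy
      refine ⟨c + c', fun r hr => by simp [hc r hr, hc' r hr], ?_⟩
      simp only [Pi.add_apply, map_add, Finset.sum_add_distrib]
    | smul a x _ hx =>
      obtain ⟨c, hc, rfl⟩ := hx
      refine ⟨a • c, fun r hr => by simp [hc r hr], ?_⟩
      simp only [Pi.smul_apply, map_smul, Finset.smul_sum]
    | mem x hx =>
      obtain ⟨r, rfl⟩ := hx
      set r' := Function.update (Function.update r i (r₀ i)) j (r₀ j) with hr'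
      refine ⟨Pi.single r' (b i (r i) ⊗ₜ b j (r j)), fun q hq => ?_, ?_⟩
      · refine Pi.single_eq_of_ne ?_ _
        rintro rfl
        simp [hr', Function.update_of_ne hij] at hq
      · rw [Finset.sum_eq_single r' (fun q _ hq => by rw [Pi.single_eq_of_ne hq, map_zero])
          (by simp), Pi.single_eq_same, insertPair_tmul, Basis.piTensorProduct_apply]
        congr 1
        funext p
        by_cases hpj : p = j
        · subst hpj; simp
        · by_cases hpi : p = i
          · subst hpi; simp [Function.update_of_ne hij]
          · simp [Function.update_of_ne hpj, Function.update_of_ne hpi, hr']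
  obtain ⟨c, hc, htc⟩ := hdec t
  rw [htc]
  refine Submodule.sum_mem _ fun r _ => ?_
  by_cases hr : r i ≠ r₀ i ∨ r j ≠ r₀ j
  · rw [hc r hr, map_zero]
    exact Submodule.zero_mem _
  · push Not at hr
    refine insertPair_mem_pairImage hij _ (hU _ fun s hs => ?_)
    have := ht _ (insertPair_mem_pairImage hij (fun p => b' p (r p)) hs)
    rw [htc, map_sum, Finset.sum_eq_single r, prodForm_insertPair] at this
    · simpa [hb] using this
    · intro q _ hq
      rw [prodForm_insertPair]
      by_cases hq' : q i ≠ r₀ i ∨ q j ≠ r₀ j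
      · rw [hc q hq', map_zero, zero_mul]
      · push Not at hq'
        obtain ⟨p, hp⟩ : ∃ p, r p ≠ q p := by
          by_contra hcon
          push Not at hcon
          exact hq (funext fun p => (hcon p).symm)
        rw [Finset.prod_eq_zero (i := p), mul_zero]
        · simp only [Finset.mem_erase, Finset.mem_univ, and_true]
          constructor
          · rintro rfl; exact hp (hr.2.trans hq'.2.symm)
          · rintro rfl; exact hp (hr.1.trans hq'.1.symm)
        · rw [hb, if_neg hp]
    · simp

theorem chi_mem_transversePol {i j : Fin n} {f : ValPol W} (hf : f ∈ transverse W i j)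
    (t : Tens W) : chi β (1 ⊗ₜ[ℂ] t) f ∈ transversePol i j := by
  obtain ⟨y, rfl⟩ := hf
  induction y using TensorProduct.induction_on with
  | zero => simp
  | add x y hx hy =>
    rw [map_add, map_add]
    exact Subalgebra.add_mem _ hx hy
  | tmul p x =>
    simp only [LinearMap.rTensor_tmul, chi, LinearMap.BilinForm.baseChange_tmul]
    simpa using Subalgebra.smul_mem _ p.2 _

/-- A converse of `DiagCondition.diff_pow_dvd_chi`. -/
theorem diagCondition_of_diff_pow_dvd {ι : Fin n → Type*} [∀ p, Fintype (ι p)]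
    [∀ p, DecidableEq (ι p)] (b : ∀ p, Module.Basis (ι p) ℂ (W p)) (b' : ∀ p, ι p → W p)
    (hb : ∀ p q r, β p (b' p q) (b p r) = if q = r then 1 else 0) (r₀ : ∀ p, ι p)
    {i j : Fin n} (hij : i ≠ j) {V V' : ℕ → Submodule ℂ (W i ⊗[ℂ] W j)} {M : ℕ}
    (hV : ∀ k l, k + l + 1 = M → ∀ t, (∀ s ∈ V k, tensorForm (β i) (β j) s t = 0) → t ∈ V' l)
    (hV' : ∀ l, M ≤ l → V' l = ⊤) {f : ValPol W}
    (hf : ∀ k, k < M → ∀ t ∈ pairImage hij (V k),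
      (MvPolynomial.X i - MvPolynomial.X j) ^ (M - k) ∣ chi β (1 ⊗ₜ[ℂ] t) f) :
    DiagCondition hij V' f := by
  obtain ⟨g, rfl, hg⟩ := diagCondition_top hij f
  refine ⟨g, rfl, fun l => ⟨(hg l).1, fun Z => ?_⟩⟩
  by_cases hl : M ≤ l
  · rw [hV' l hl]
    exact (hg l).2 Z
  · obtain ⟨k, hk⟩ : ∃ k, k + l + 1 = M := ⟨M - l - 1, by omega⟩
    refine mem_pairImage_of_orthogonal b b' hb r₀ hij (hV k l hk) fun s hs => ?_
    -- Since M - k = l + 1 > l, uniqueness of the expansion annihilates the l-th coefficient of the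
    -- pairing of the constant s with f.
    have h0 : chi β (1 ⊗ₜ[ℂ] s) (g l) = 0 := by
      refine eq_zero_of_diff_pow_dvd hij (M := M - k)
        (g.mapRange (chi β (1 ⊗ₜ[ℂ] s)) (map_zero _)) (fun m => ?_) ?_ (k := l) (by omega)
      · rw [Finsupp.mapRange_apply]
        exact chi_mem_transversePol (hg m).1 s
      · rw [Finsupp.sum_mapRange_index (by simp)]
        have := hf k (by omega) s hs
        rw [Finsupp.sum, map_sum] at this
        simp only [map_smul, smul_eq_mul] at this
        exact this
    have := eval_chi β (1 ⊗ₜ[ℂ] s) (g l) Z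
    rw [h0, map_zero] at this
    simpa [evalAt] using this.symm

end PairDecomposition

/-! ### Divisibility of χ by D -/

section Divisibility

variable {n : ℕ} {W : Fin n → Type*} [∀ i, AddCommGroup (W i)] [∀ i, Module ℂ (W i)]
  [∀ i, LieRingModule Sl2 (W i)] [∀ i, LieModule ℂ Sl2 (W i)] [∀ i, FiniteDimensional ℂ (W i)]

/-- A component in both V(k) and V̂(l) has an index m with m ≤ k and s_ij ≤ m + l, which is
impossible for k + l < s_ij. The two are therefore orthogonal, and the orders of vanishing on the
diagonals multiply. -/
theorem diagDenominator_dvd_chi {β : ∀ i, LinearMap.BilinForm ℂ (W i)}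
    (hβ : ∀ i, (β i).lieInvariant Sl2) {f h : ValPol W} (hf : f ∈ Fc W) (hh : h ∈ FcHat W) :
    diagDenominator W ∣ chi β f h := by
  refine prod_diff_pow_dvd _ fun i j hij => ?_
  refine DiagCondition.diff_pow_dvd_chi (fun k l hkl t ht t' ht' => ?_) (hf i j hij) (hh i j hij)
  refine componentSum_orthogonal (tensorForm_lieInvariant (hβ i) (hβ j)) ?_ ht ht'
  rw [Set.disjoint_left]
  intro m hm hm'
  change m ≤ k at hm
  change _ ≤ m + l at hm'
  omega

end Divisibility

/-! ### Fusion relations for the coefficients of the current -/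

/-- In a non-zero term of the m-th power the factor x_a is chosen at most ξ_a times, and each of the
at least m - ξ_a other choices contributes a factor ζ_a. -/
theorem prod_pow_dvd_sum_pow {A σ : Type*} [CommRing A] [DecidableEq σ] (s : Finset σ)
    (x ζ : σ → A) (ξ : σ → ℕ) (hx : ∀ j, x j ^ (ξ j + 1) = 0) (m : ℕ) :
    ∏ j ∈ s, ζ j ^ (m - ξ j) ∣ (∑ i ∈ s, x i * ∏ j ∈ s.erase i, ζ j) ^ m := by
  induction s using Finset.induction_on generalizing m with
  | empty => simp
  | insert a s ha ih =>
    have hsum : ∑ i ∈ insert a s, x i * ∏ j ∈ (insert a s).erase i, ζ j =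
        x a * ∏ j ∈ s, ζ j + ζ a * ∑ i ∈ s, x i * ∏ j ∈ s.erase i, ζ j := by
      rw [Finset.sum_insert ha, Finset.erase_insert ha, Finset.mul_sum]
      congr 1
      refine Finset.sum_congr rfl fun i hi => ?_
      have hia : a ≠ i := fun h => ha (h ▸ hi)
      rw [Finset.erase_insert_of_ne hia,
        Finset.prod_insert fun h => ha (Finset.mem_of_mem_erase h)]
      ring
    rw [hsum, add_pow, Finset.prod_insert ha]
    refine Finset.dvd_sum fun k hk => ?_
    by_cases hka : k ≤ ξ a
    · have h1 : ζ a ^ (m - ξ a) ∣ ζ a ^ (m - k) := pow_dvd_pow _ (by omega)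
      have h2 : ∏ j ∈ s, ζ j ^ (m - ξ j) ∣
          (∏ j ∈ s, ζ j) ^ k * (∑ i ∈ s, x i * ∏ j ∈ s.erase i, ζ j) ^ (m - k) := by
        refine dvd_trans ?_ (mul_dvd_mul_left _ (ih (m - k)))
        rw [← Finset.prod_pow, ← Finset.prod_mul_distrib]
        refine Finset.prod_dvd_prod_of_dvd _ _ fun j _ => ?_
        rw [← pow_add]
        exact pow_dvd_pow _ (by omega)
      refine (mul_dvd_mul h1 h2).trans ?_
      rw [mul_pow, mul_pow]
      exact ⟨x a ^ k * (m.choose k), by ring⟩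
    · have : x a ^ k = 0 := pow_eq_zero_of_le (by omega) (hx a)
      rw [mul_pow, this]
      simp

section SiteCurrent

variable {n : ℕ}

/-- The polynomial `∏_{j ≠ i} (ζ - z_j)` in `ζ`. -/
def complementaryProd (i : Fin n) : Polynomial (Pol n) :=
  ∏ j ∈ Finset.univ.erase i, (Polynomial.X - Polynomial.C (MvPolynomial.X j))

theorem natDegree_complementaryProd (i : Fin n) : (complementaryProd i).natDegree + 1 = n := by
  rw [complementaryProd, Polynomial.natDegree_finsetProd_X_sub_C_eq_card,
    Finset.card_erase_add_one (Finset.mem_univ i), Finset.card_univ, Fintype.card_fin]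

variable {A : Type*} [CommRing A] [Algebra (Pol n) A] (x : Fin n → A)

/-- The polynomial `∑ᵢ x_i ∏_{j ≠ i} (ζ - z_j)` in `ζ`. -/
def siteCurrent : Polynomial A :=
  ∑ i, Polynomial.C (x i) * (complementaryProd i).map (algebraMap (Pol n) A)

/-- The coefficients of `siteCurrent`. -/
def siteCoeff (k : ℕ) : A := ∑ i, (complementaryProd i).coeff k • x i

theorem coeff_siteCurrent (k : ℕ) : (siteCurrent x).coeff k = siteCoeff x k := by
  rw [siteCurrent, Polynomial.finsetSum_coeff, siteCoeff]
  refine Finset.sum_congr rfl fun i _ => ?_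
  rw [Polynomial.coeff_C_mul, Polynomial.coeff_map, Algebra.smul_def, mul_comm]

theorem siteCoeff_eq_zero {k : ℕ} (hk : n ≤ k) : siteCoeff x k = 0 := by
  refine Finset.sum_eq_zero fun i _ => ?_
  rw [Polynomial.coeff_eq_zero_of_natDegree_lt, zero_smul]
  have := natDegree_complementaryProd i
  omega

/-- The algebra generated over `ℂ[z₁, …, zₙ]` by the coefficients of `siteCurrent`. -/
def coeffAlgebra : Subalgebra (Pol n) A := Algebra.adjoin (Pol n) (Set.range (siteCoeff x))

theorem siteCoeff_mem (k : ℕ) : siteCoeff x k ∈ coeffAlgebra x := Algebra.subset_adjoin ⟨k, rfl⟩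

/-- The ring homomorphism from the polynomial ring in countably many variables which sends the
variables to the coefficients of `siteCurrent`. -/
def coeffHom : VarRing →+* coeffAlgebra x :=
  MvPolynomial.eval₂Hom ((algebraMap (Pol n) (coeffAlgebra x)).comp MvPolynomial.C)
    fun k => ⟨siteCoeff x k, siteCoeff_mem x k⟩

theorem coeffHom_X (k : ℕ) : coeffHom x (MvPolynomial.X k) = ⟨siteCoeff x k, siteCoeff_mem x k⟩ :=
  MvPolynomial.eval₂Hom_X' _ _ _

theorem coeffHom_C (c : ℂ) : coeffHom x (MvPolynomial.C c) =
    algebraMap (Pol n) (coeffAlgebra x) (MvPolynomial.C c) :=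
  MvPolynomial.eval₂Hom_C _ _ _

/-- The ideal generated by the `z_i`. -/
def coeffIdeal : Ideal (coeffAlgebra x) :=
  Ideal.span (Set.range fun i => algebraMap (Pol n) (coeffAlgebra x) (MvPolynomial.X i))

theorem algebraMap_X_mem_coeffIdeal (i : Fin n) :
    algebraMap (Pol n) (coeffAlgebra x) (MvPolynomial.X i) ∈ coeffIdeal x :=
  Ideal.subset_span (Set.mem_range_self i)

theorem map_genPoly_coeffHom :
    ((genPoly n).map (coeffHom x)).map (coeffAlgebra x).val.toRingHom = siteCurrent x := by
  ext k
  rw [coeff_siteCurrent]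
  simp only [genPoly, Polynomial.coeff_map, Polynomial.finsetSum_coeff,
    Polynomial.coeff_C_mul, Polynomial.coeff_X_pow, mul_ite, mul_one, mul_zero,
    Finset.sum_ite_eq, Finset.mem_range]
  split_ifs with hk
  · rw [coeffHom_X]; rfl
  · rw [map_zero, map_zero, siteCoeff_eq_zero x (by omega)]

/-- The m-th power of the current is divisible by ∏_j (ζ - z_j)^(m - ξ_j), which becomes a pure
power of ζ modulo the z_j. -/
theorem fusionRelations_coeffIdeal (ξ : Fin n → ℕ) (hx : ∀ i, x i ^ (ξ i + 1) = 0) :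
    FusionRelations (Finset.univ.val.map ξ) ((coeffIdeal x).comap (coeffHom x)) := by
  have hcard : (Finset.univ.val.map ξ).card = n := by simp
  rw [FusionRelations, hcard]
  refine ⟨fun k hk => ?_, fun m r hr => ?_⟩
  · rw [Ideal.mem_comap, coeffHom_X]
    convert Ideal.zero_mem _
    exact siteCoeff_eq_zero x hk
  · set P : Polynomial (coeffAlgebra x) := ∏ j : Fin n, (Polynomial.X -
      Polynomial.C (algebraMap (Pol n) (coeffAlgebra x) (MvPolynomial.X j))) ^ (m - ξ j) with hP
    have hmonic : P.Monic := Polynomial.monic_prod_of_monic _ _ fun j _ =>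
      (Polynomial.monic_X_sub_C _).pow _
    -- `prod_pow_dvd_sum_pow` gives divisibility over A. Because P is monic, the quotient already
    -- has its coefficients in the subalgebra, which is needed to reduce modulo its ideal.
    have hdvd : P ∣ (genPoly n).map (coeffHom x) ^ m := by
      rw [← Polynomial.map_dvd_map (coeffAlgebra x).val.toRingHom Subtype.val_injective hmonic,
        Polynomial.map_pow, map_genPoly_coeffHom]
      have := prod_pow_dvd_sum_pow Finset.univ (fun i => Polynomial.C (x i))
        (fun j : Fin n => Polynomial.X - Polynomial.C (algebraMap (Pol n) A (MvPolynomial.X j)))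
        ξ (fun j => by rw [← Polynomial.C_pow, hx, Polynomial.C_0]) m
      convert this using 1
      · rw [hP, Polynomial.map_prod]
        refine Finset.prod_congr rfl fun j _ => ?_
        rw [Polynomial.map_pow, Polynomial.map_sub, Polynomial.map_X, Polynomial.map_C]
        rfl
      · congr 1
        refine Finset.sum_congr rfl fun i _ => ?_
        rw [complementaryProd, Polynomial.map_prod]
        congr 1
        refine Finset.prod_congr rfl fun j _ => ?_
        rw [Polynomial.map_sub, Polynomial.map_X, Polynomial.map_C]
    have hdvd' := Polynomial.map_dvd (Ideal.Quotient.mk (coeffIdeal x)) hdvd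
    have hP' : P.map (Ideal.Quotient.mk (coeffIdeal x)) =
        Polynomial.X ^ (∑ j, (m - ξ j)) := by
      rw [hP, Polynomial.map_prod, ← Finset.prod_pow_eq_pow_sum]
      refine Finset.prod_congr rfl fun j _ => ?_
      rw [Polynomial.map_pow, Polynomial.map_sub, Polynomial.map_X, Polynomial.map_C,
        Ideal.Quotient.eq_zero_iff_mem.2 (algebraMap_X_mem_coeffIdeal x j), Polynomial.C_0, sub_zero]
    rw [hP', Polynomial.X_pow_dvd_iff] at hdvd'
    have := hdvd' r (by rwa [Multiset.map_map] at hr)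
    rw [Polynomial.coeff_map, Ideal.Quotient.eq_zero_iff_mem, ← Polynomial.map_pow,
      Polynomial.coeff_map] at this
    exact this

/-- Modulo the z_i the polynomial coefficients become complex numbers, so the coefficients of the
current alone generate the quotient over ℂ. -/
theorem exists_coeffHom_add {a : A} (ha : a ∈ coeffAlgebra x) :
    ∃ p : VarRing, ∃ d ∈ coeffIdeal x, a = coeffHom x p + d := by
  induction ha using Algebra.adjoin_induction with
  | mem a ha =>
    obtain ⟨k, rfl⟩ := ha
    refine ⟨MvPolynomial.X k, 0, Ideal.zero_mem _, ?_⟩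
    rw [coeffHom_X, ZeroMemClass.coe_zero, add_zero]
  | algebraMap r =>
    induction r using MvPolynomial.induction_on with
    | C c =>
      refine ⟨MvPolynomial.C c, 0, Ideal.zero_mem _, ?_⟩
      rw [coeffHom_C, ZeroMemClass.coe_zero, add_zero]
      rfl
    | add p q hp hq =>
      obtain ⟨p', d, hd, hp'⟩ := hp
      obtain ⟨q', e, he, hq'⟩ := hq
      refine ⟨p' + q', d + e, Ideal.add_mem _ hd he, ?_⟩
      rw [map_add, map_add, hp', hq', Subalgebra.coe_add, Subalgebra.coe_add]
      ring
    | mul_X p i _ =>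
      refine ⟨0, _, Ideal.mul_mem_left _ (algebraMap (Pol n) (coeffAlgebra x) p)
        (algebraMap_X_mem_coeffIdeal x i), ?_⟩
      rw [map_zero, ZeroMemClass.coe_zero, zero_add, map_mul]
      rfl
  | add a b _ _ hp hq =>
    obtain ⟨p', d, hd, hp'⟩ := hp
    obtain ⟨q', e, he, hq'⟩ := hq
    refine ⟨p' + q', d + e, Ideal.add_mem _ hd he, ?_⟩
    rw [map_add, hp', hq', Subalgebra.coe_add, Subalgebra.coe_add]
    ring
  | mul a b _ _ hp hq =>
    obtain ⟨p', d, hd, hp'⟩ := hp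
    obtain ⟨q', e, he, hq'⟩ := hq
    refine ⟨p' * q', d * (coeffHom x q' + e) + coeffHom x p' * e,
      Ideal.add_mem _ (Ideal.mul_mem_right _ _ hd) (Ideal.mul_mem_left _ _ he), ?_⟩
    rw [map_mul, hp', hq']
    simp only [Subalgebra.coe_add, Subalgebra.coe_mul]
    ring

/-- Modulo the ideal of the `z_i`, the algebra of the coefficients is spanned by at most
`∏ᵢ (ξ_i + 1)` monomials. -/
theorem exists_monomials (ξ : Fin n → ℕ) (hx : ∀ i, x i ^ (ξ i + 1) = 0) :
    ∃ S : Finset A, S.card ≤ ∏ i, (ξ i + 1) ∧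
      (S : Set A) ⊆ Submonoid.closure (Set.range (siteCoeff x)) ∧
      ∀ b ∈ coeffAlgebra x, ∃ q ∈ Submodule.span (Pol n) (S : Set A), ∃ c : Fin n → A,
        (∀ i, c i ∈ coeffAlgebra x) ∧ b = q + ∑ i, (MvPolynomial.X i : Pol n) • c i := by
  classical
  obtain ⟨B, hB, hspan⟩ := (fusionRelations_coeffIdeal x ξ hx).exists_spansModulo n _ _ (by simp)
  let m : (ℕ →₀ ℕ) → A := fun b => coeffHom x (MvPolynomial.monomial b 1)
  have hm : ∀ b, m b ∈ Submonoid.closure (Set.range (siteCoeff x)) := by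
    intro b
    have : m b = ∏ k ∈ b.support, siteCoeff x k ^ b k := by
      simp only [m, coeffHom, MvPolynomial.coe_eval₂Hom, MvPolynomial.eval₂_monomial, map_one,
        one_mul, Finsupp.prod]
      rw [SubmonoidClass.coe_finsetProd]
      rfl
    rw [this]
    exact Submonoid.prod_mem _ fun k _ => Submonoid.pow_mem _ (Submonoid.subset_closure (Set.mem_range_self k)) _
  refine ⟨B.image m, Finset.card_image_le.trans (by rwa [Multiset.map_map] at hB), ?_, fun b hb => ?_⟩
  · rw [Finset.coe_image]
    rintro _ ⟨b, _, rfl⟩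
    exact hm b
  · obtain ⟨p, d, hd, rfl⟩ := exists_coeffHom_add x hb
    obtain ⟨q, hq, hpq⟩ := hspan p
    rw [Ideal.mem_comap, map_sub] at hpq
    have h := Ideal.add_mem _ hd hpq
    rw [coeffIdeal, Ideal.mem_span_range_iff_exists_fun] at h
    obtain ⟨c, hc⟩ := h
    refine ⟨coeffHom x q, ?_, fun i => c i, fun i => (c i).2, ?_⟩
    · clear hpq hc
      induction hq using Submodule.span_induction with
      | mem y hy =>
        obtain ⟨b, hb, rfl⟩ := hy
        exact Submodule.subset_span (Finset.mem_coe.2 (Finset.mem_image_of_mem m hb))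
      | zero => rw [map_zero]; exact Submodule.zero_mem _
      | add y y' _ _ hy hy' => rw [map_add]; exact Submodule.add_mem _ hy hy'
      | smul a y _ hy =>
        rw [MvPolynomial.smul_eq_C_mul, map_mul, coeffHom_C, ← Algebra.smul_def]
        exact Submodule.smul_mem _ _ hy
    · have := congrArg Subtype.val hc
      rw [Subalgebra.coe_add, AddSubgroupClass.coe_sub] at this
      rw [add_comm, ← sub_eq_iff_eq_add', add_sub_assoc, ← this, AddSubmonoidClass.coe_finsetSum]
      refine Finset.sum_congr rfl fun i _ => ?_
      rw [Algebra.smul_def, mul_comm]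
      rfl

end SiteCurrent

/-! ### Grading by polynomial degree and Nakayama's lemma -/

section Grading

variable {n : ℕ} {V : Type*} [AddCommGroup V] [Module ℂ V]

variable (n V) in
/-- The vector-valued polynomials which are homogeneous of degree `d`. -/
def homogPart (d : ℕ) : Submodule ℂ (Pol n ⊗[ℂ] V) :=
  Submodule.span ℂ {f | ∃ (p : Pol n) (v : V), p.IsHomogeneous d ∧ f = p ⊗ₜ v}

/-- The projection to the homogeneous part of degree `d`. -/
def gradeProj (d : ℕ) : Pol n ⊗[ℂ] V →ₗ[ℂ] Pol n ⊗[ℂ] V :=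
  LinearMap.rTensor V (MvPolynomial.homogeneousComponent d)

theorem gradeProj_of_mem {d : ℕ} {f : Pol n ⊗[ℂ] V} (hf : f ∈ homogPart n V d) (e : ℕ) :
    gradeProj e f = if d = e then f else 0 := by
  induction hf using Submodule.span_induction with
  | mem f hf =>
    obtain ⟨p, v, hp, rfl⟩ := hf
    rw [gradeProj, LinearMap.rTensor_tmul, MvPolynomial.homogeneousComponent_of_mem hp]
    by_cases h : d = e
    · rw [if_pos h.symm, if_pos h]
    · rw [if_neg (Ne.symm h), if_neg h, TensorProduct.zero_tmul]
  | zero => simp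
  | add f g _ _ hf hg => rw [map_add, hf, hg]; split_ifs <;> simp
  | smul c f _ hf => rw [map_smul, hf]; split_ifs <;> simp

theorem smul_mem_homogPart {p : Pol n} {d e : ℕ} (hp : p.IsHomogeneous e) {f : Pol n ⊗[ℂ] V}
    (hf : f ∈ homogPart n V d) : p • f ∈ homogPart n V (d + e) := by
  induction hf using Submodule.span_induction with
  | mem f hf =>
    obtain ⟨q, v, hq, rfl⟩ := hf
    refine Submodule.subset_span ⟨p * q, v, ?_, ?_⟩
    · rw [add_comm]; exact hp.mul hq
    · rw [TensorProduct.smul_tmul', smul_eq_mul]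
  | zero => rw [smul_zero]; exact Submodule.zero_mem _
  | add f g _ _ hf hg => rw [smul_add]; exact Submodule.add_mem _ hf hg
  | smul c f _ hf => rw [smul_comm]; exact Submodule.smul_mem _ _ hf

theorem homogeneousComponent_X_mul (i : Fin n) (p : Pol n) (d : ℕ) :
    MvPolynomial.homogeneousComponent (d + 1) (MvPolynomial.X i * p) =
      MvPolynomial.X i * MvPolynomial.homogeneousComponent d p ∧
    MvPolynomial.homogeneousComponent 0 (MvPolynomial.X i * p) = 0 := by
  induction p using MvPolynomial.induction_on' with
  | add p q hp hq =>
    simp only [mul_add, map_add, hp.1, hq.1, hp.2, hq.2, add_zero, and_self]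
  | monomial m c =>
    have h1 : (MvPolynomial.monomial m c : Pol n).IsHomogeneous m.degree :=
      MvPolynomial.isHomogeneous_monomial c rfl
    have h2 := (MvPolynomial.isHomogeneous_X ℂ i).mul h1
    rw [MvPolynomial.homogeneousComponent_of_mem h1, MvPolynomial.homogeneousComponent_of_mem h2,
      MvPolynomial.homogeneousComponent_of_mem h2]
    constructor
    · by_cases h : d = m.degree
      · rw [if_pos h, if_pos (by omega)]
      · rw [if_neg h, if_neg (by omega), mul_zero]
    · rw [if_neg (by omega)]

theorem gradeProj_X_smul (i : Fin n) (f : Pol n ⊗[ℂ] V) (d : ℕ) :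
    gradeProj (d + 1) ((MvPolynomial.X i : Pol n) • f) = (MvPolynomial.X i : Pol n) • gradeProj d f ∧
    gradeProj 0 ((MvPolynomial.X i : Pol n) • f) = 0 := by
  induction f using TensorProduct.induction_on with
  | zero => simp
  | add f g hf hg => simp only [smul_add, map_add, hf.1, hg.1, hf.2, hg.2, add_zero, and_self]
  | tmul p v =>
    simp only [TensorProduct.smul_tmul', smul_eq_mul, gradeProj, LinearMap.rTensor_tmul,
      (homogeneousComponent_X_mul i p d).1, (homogeneousComponent_X_mul i p d).2,
      TensorProduct.zero_tmul, and_self]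

theorem exists_eq_sum_gradeProj (f : Pol n ⊗[ℂ] V) :
    ∃ N, ∀ M, N ≤ M → f = ∑ d ∈ Finset.range M, gradeProj d f := by
  induction f using TensorProduct.induction_on with
  | zero => exact ⟨0, fun _ _ => by simp⟩
  | add f g hf hg =>
    obtain ⟨N, hN⟩ := hf
    obtain ⟨N', hN'⟩ := hg
    refine ⟨max N N', fun M hM => ?_⟩
    simp only [map_add, Finset.sum_add_distrib]
    rw [← hN M (le_trans (le_max_left _ _) hM), ← hN' M (le_trans (le_max_right _ _) hM)]
  | tmul p v =>
    refine ⟨p.totalDegree + 1, fun M hM => ?_⟩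
    simp only [gradeProj, LinearMap.rTensor_tmul]
    rw [← TensorProduct.sum_tmul]
    congr 1
    rw [← Finset.sum_subset (Finset.range_mono hM), MvPolynomial.sum_homogeneousComponent]
    intro d _ hd
    exact MvPolynomial.homogeneousComponent_eq_zero _ _ (by simpa using hd)

theorem gradeProj_mem_span {S : Set (Pol n ⊗[ℂ] V)} (hS : ∀ s ∈ S, ∃ e, s ∈ homogPart n V e)
    {f : Pol n ⊗[ℂ] V} (hf : f ∈ Submodule.span (Pol n) S) (d : ℕ) :
    gradeProj d f ∈ Submodule.span (Pol n) S := by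
  induction hf using Submodule.span_induction generalizing d with
  | mem s hs =>
    obtain ⟨e, he⟩ := hS s hs
    rw [gradeProj_of_mem he]
    split_ifs
    · exact Submodule.subset_span hs
    · exact Submodule.zero_mem _
  | zero => rw [map_zero]; exact Submodule.zero_mem _
  | add f g _ _ hf hg => rw [map_add]; exact Submodule.add_mem _ (hf d) (hg d)
  | smul p f _ hf =>
    induction p using MvPolynomial.induction_on generalizing d with
    | C c =>
      have : (MvPolynomial.C c : Pol n) • f = c • f := algebraMap_smul (Pol n) c f
      rw [this, map_smul]
      exact Submodule.smul_of_tower_mem _ c (hf d)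
    | add p q hp hq => rw [add_smul, map_add]; exact Submodule.add_mem _ (hp d) (hq d)
    | mul_X p i hp =>
      rw [mul_comm, mul_smul]
      cases d with
      | zero => rw [(gradeProj_X_smul i _ 0).2]; exact Submodule.zero_mem _
      | succ d =>
        rw [(gradeProj_X_smul i _ d).1]
        exact Submodule.smul_mem _ _ (hp d)

/-- The graded Nakayama lemma for vector-valued polynomials. -/
theorem le_span_of_graded {P : Submodule (Pol n) (Pol n ⊗[ℂ] V)} {S : Set (Pol n ⊗[ℂ] V)}
    (hS : ∀ s ∈ S, ∃ e, s ∈ homogPart n V e)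
    (h : ∀ f ∈ P, ∃ g ∈ Submodule.span (Pol n) S, ∃ c : Fin n → Pol n ⊗[ℂ] V,
      (∀ i, c i ∈ P) ∧ f = g + ∑ i, (MvPolynomial.X i : Pol n) • c i) :
    P ≤ Submodule.span (Pol n) S := by
  -- The degree d + 1 part of z_i c_i is z_i times the degree d part of c_i, so the induction on
  -- degree closes.
  have key : ∀ d, ∀ f ∈ P, gradeProj d f ∈ Submodule.span (Pol n) S := by
    intro d
    induction d with
    | zero =>
      intro f hf
      obtain ⟨g, hg, c, hc, rfl⟩ := h f hf
      rw [map_add, map_sum]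
      refine Submodule.add_mem _ (gradeProj_mem_span hS hg 0) (Submodule.sum_mem _ fun i _ => ?_)
      rw [(gradeProj_X_smul i _ 0).2]
      exact Submodule.zero_mem _
    | succ d ih =>
      intro f hf
      obtain ⟨g, hg, c, hc, rfl⟩ := h f hf
      rw [map_add, map_sum]
      refine Submodule.add_mem _ (gradeProj_mem_span hS hg _) (Submodule.sum_mem _ fun i _ => ?_)
      rw [(gradeProj_X_smul i _ d).1]
      exact Submodule.smul_mem _ _ (ih _ (hc i))
  intro f hf
  obtain ⟨N, hN⟩ := exists_eq_sum_gradeProj f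
  rw [hN N le_rfl]
  exact Submodule.sum_mem _ fun d _ => key d f hf

end Grading

theorem coeff_prod_X_sub_C_isHomogeneous {n : ℕ} (s : Finset (Fin n)) {k d : ℕ}
    (h : k + d = s.card) :
    ((∏ j ∈ s, (Polynomial.X - Polynomial.C (MvPolynomial.X j : Pol n))).coeff k).IsHomogeneous d := by
  induction s using Finset.induction_on generalizing k d with
  | empty =>
    have hk : k = 0 := by simp at h; omega
    have hd : d = 0 := by simp at h; omega
    subst hk hd
    simpa using MvPolynomial.isHomogeneous_one (Fin n) ℂ
  | insert a s ha ih =>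
    rw [Finset.card_insert_of_notMem ha] at h
    rw [Finset.prod_insert ha, sub_mul, Polynomial.coeff_sub, Polynomial.coeff_C_mul]
    have h2 : (MvPolynomial.X a * (∏ j ∈ s, (Polynomial.X - Polynomial.C
        (MvPolynomial.X j : Pol n))).coeff k).IsHomogeneous d := by
      cases d with
      | zero =>
        rw [Polynomial.coeff_eq_zero_of_natDegree_lt, mul_zero]
        · exact MvPolynomial.isHomogeneous_zero _ _ _
        · rw [Polynomial.natDegree_finsetProd_X_sub_C_eq_card]; omega
      | succ d =>
        rw [add_comm]
        exact (MvPolynomial.isHomogeneous_X ℂ a).mul (ih (by omega))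
    refine MvPolynomial.IsHomogeneous.sub ?_ h2
    cases k with
    | zero => rw [Polynomial.coeff_X_mul_zero]; exact MvPolynomial.isHomogeneous_zero _ _ _
    | succ k => rw [Polynomial.coeff_X_mul]; exact ih (by omega)

theorem coeff_complementaryProd_isHomogeneous {n : ℕ} (i : Fin n) (k : ℕ) :
    ((complementaryProd i).coeff k).IsHomogeneous (n - 1 - k) := by
  have hn := natDegree_complementaryProd i
  by_cases hk : k ≤ n - 1
  · refine coeff_prod_X_sub_C_isHomogeneous _ ?_
    rw [Finset.card_erase_of_mem (Finset.mem_univ i), Finset.card_univ, Fintype.card_fin]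
    omega
  · rw [Polynomial.coeff_eq_zero_of_natDegree_lt (by omega)]
    exact MvPolynomial.isHomogeneous_zero _ _ _

/-! ### Evaluating the current at ζ = z_q -/

section Evaluation

variable {n : ℕ}

/-- The polynomial `∏_{j ≠ i} (z_i - z_j)`. -/
def vanishing (i : Fin n) : Pol n :=
  ∏ j ∈ Finset.univ.erase i, (MvPolynomial.X i - MvPolynomial.X j)

theorem eval_complementaryProd_self (i : Fin n) :
    (complementaryProd i).eval (MvPolynomial.X i) = vanishing i := by
  simp [complementaryProd, vanishing, Polynomial.eval_prod]

theorem eval_complementaryProd_of_ne {i q : Fin n} (h : i ≠ q) :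
    (complementaryProd i).eval (MvPolynomial.X q) = 0 := by
  rw [complementaryProd, Polynomial.eval_prod]
  exact Finset.prod_eq_zero (Finset.mem_erase.2 ⟨h.symm, Finset.mem_univ q⟩) (by simp)

variable {A : Type*} [CommRing A] [Algebra (Pol n) A] (x : Fin n → A)

/-- The value of the current at ζ = z_q: every complementary product except the q-th has the factor
ζ - z_q. -/
theorem sum_pow_smul_siteCoeff (q : Fin n) :
    ∑ k ∈ Finset.range n, (MvPolynomial.X q : Pol n) ^ k • siteCoeff x k =
      vanishing q • x q := by
  simp only [siteCoeff, Finset.smul_sum, smul_smul]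
  rw [Finset.sum_comm]
  have h : ∀ i : Fin n, ∑ k ∈ Finset.range n,
      ((MvPolynomial.X q : Pol n) ^ k * (complementaryProd i).coeff k) • x i =
        (complementaryProd i).eval (MvPolynomial.X q) • x i := by
    intro i
    have hn := natDegree_complementaryProd i
    rw [← Finset.sum_smul, Polynomial.eval_eq_sum_range' (n := n) (by omega)]
    simp only [mul_comm]
  simp only [h]
  rw [Finset.sum_eq_single q, eval_complementaryProd_self]
  · intro i _ hi
    rw [eval_complementaryProd_of_ne hi, zero_smul]
  · simp

theorem vanishing_smul_mem (q : Fin n) : vanishing q • x q ∈ coeffAlgebra x := by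
  rw [← sum_pow_smul_siteCoeff]
  exact Subalgebra.sum_mem _ fun k _ => Subalgebra.smul_mem _ (siteCoeff_mem x k) _

/-- The values of one polynomial at z_i and z_j differ by a multiple of z_i - z_j, and the quotient
has coefficients in the algebra. -/
theorem exists_diff_smul_eq (i j : Fin n) : ∃ b ∈ coeffAlgebra x,
    vanishing i • x i - vanishing j • x j =
      (MvPolynomial.X i - MvPolynomial.X j : Pol n) • b := by
  choose c hc using fun k => sub_dvd_pow_sub_pow (MvPolynomial.X i : Pol n) (MvPolynomial.X j) k
  refine ⟨∑ k ∈ Finset.range n, c k • siteCoeff x k,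
    Subalgebra.sum_mem _ fun k _ => Subalgebra.smul_mem _ (siteCoeff_mem x k) _, ?_⟩
  rw [← sum_pow_smul_siteCoeff, ← sum_pow_smul_siteCoeff, ← Finset.sum_sub_distrib,
    Finset.smul_sum]
  refine Finset.sum_congr rfl fun k _ => ?_
  rw [← sub_smul, hc, smul_smul]

/-- The polynomial `∏_{l ≠ i, j} (z_i - z_l)`. -/
def partialVanishing (i j : Fin n) : Pol n :=
  ∏ l ∈ (Finset.univ.erase i).erase j, (MvPolynomial.X i - MvPolynomial.X l)

theorem vanishing_eq {i j : Fin n} (h : i ≠ j) :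
    vanishing i = (MvPolynomial.X i - MvPolynomial.X j) * partialVanishing i j := by
  rw [vanishing, ← Finset.mul_prod_erase _ _ (Finset.mem_erase.2 ⟨h.symm, Finset.mem_univ j⟩)]
  rfl

theorem not_diff_dvd_partialVanishing {i j : Fin n} (h : i ≠ j) :
    ¬(MvPolynomial.X i - MvPolynomial.X j : Pol n) ∣ partialVanishing i j := by
  intro hd
  obtain ⟨l, hl, hl'⟩ := (diff_prime h).exists_mem_finset_dvd hd
  have hlj := Finset.ne_of_mem_erase hl
  have hli := Finset.ne_of_mem_erase (Finset.mem_of_mem_erase hl)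
  exact not_diff_dvd_diff hli.symm (fun e => hlj e.2) (fun e => h e.1) hl'

theorem not_diff_dvd_vanishing {i j q : Fin n} (h : i ≠ j) (hi : q ≠ i) (hj : q ≠ j) :
    ¬(MvPolynomial.X i - MvPolynomial.X j : Pol n) ∣ vanishing q := by
  intro hd
  obtain ⟨l, hl, hl'⟩ := (diff_prime h).exists_mem_finset_dvd hd
  exact not_diff_dvd_diff (Finset.ne_of_mem_erase hl).symm (fun e => hi e.1) (fun e => hj e.1) hl'

theorem diff_dvd_partialVanishing_sub (i j : Fin n) :
    (MvPolynomial.X i - MvPolynomial.X j : Pol n) ∣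
      partialVanishing i j - partialVanishing j i := by
  rw [diff_dvd_iff, map_sub, sub_eq_zero, partialVanishing, partialVanishing, map_prod, map_prod,
    Finset.erase_right_comm]
  refine Finset.prod_congr rfl fun l _ => ?_
  rw [map_sub, map_sub]
  congr 1
  have := midpoint_diff i j
  rwa [map_sub, sub_eq_zero] at this

/-- Up to a factor which is coprime to `z_i - z_j`, the algebra generated by the coefficients of
`siteCurrent` contains `x_i + x_j`, `(z_i - z_j) x_i` and the `x_q`, `q ≠ i, j`. -/
theorem exists_not_diff_dvd (hA : ∀ p : Pol n, p ≠ 0 → ∀ a : A, p • a = 0 → a = 0)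
    {i j : Fin n} (hij : i ≠ j) :
    ∃ G : Pol n, ¬(MvPolynomial.X i - MvPolynomial.X j) ∣ G ∧
      (∀ q, q ≠ i → q ≠ j → G • x q ∈ coeffAlgebra x) ∧ G • (x i + x j) ∈ coeffAlgebra x ∧
      ((MvPolynomial.X i - MvPolynomial.X j) * G) • x i ∈ coeffAlgebra x := by
  set s : Pol n := MvPolynomial.X i - MvPolynomial.X j with hs
  set γ := partialVanishing i j
  set γ' := partialVanishing j i
  have hvi : vanishing i = s * γ := vanishing_eq hij
  have hvj : vanishing j = -s * γ' := by rw [vanishing_eq hij.symm, hs, neg_sub]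
  have hγ : ¬s ∣ γ := not_diff_dvd_partialVanishing hij
  have hγ' : ¬s ∣ γ' := by
    have := not_diff_dvd_partialVanishing hij.symm
    rwa [← neg_sub, neg_dvd] at this
  set π : Pol n := ∏ q ∈ (Finset.univ.erase i).erase j, vanishing q
  have hπ : ¬s ∣ π := by
    intro hd
    obtain ⟨q, hq, hq'⟩ := (diff_prime hij).exists_mem_finset_dvd hd
    exact not_diff_dvd_vanishing hij (Finset.ne_of_mem_erase (Finset.mem_of_mem_erase hq))
      (Finset.ne_of_mem_erase hq) hq'
  refine ⟨π * (γ * γ'), ?_, fun q hqi hqj => ?_, ?_, ?_⟩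
  · intro hd
    rcases (diff_prime hij).dvd_or_dvd hd with h | h
    · exact hπ h
    · rcases (diff_prime hij).dvd_or_dvd h with h | h
      exacts [hγ h, hγ' h]
  · have hq : q ∈ (Finset.univ.erase i).erase j := by simp [hqi, hqj]
    have e : (π * (γ * γ')) • x q =
        ((∏ l ∈ ((Finset.univ.erase i).erase j).erase q, vanishing l) * (γ * γ')) •
          (vanishing q • x q) := by
      rw [smul_smul]
      congr 1
      simp only [π]
      rw [← Finset.mul_prod_erase _ _ hq]
      ring
    rw [e]
    exact Subalgebra.smul_mem _ (vanishing_smul_mem x q) _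
  · rw [mul_smul]
    refine Subalgebra.smul_mem _ ?_ _
    obtain ⟨b, hb, hb'⟩ := exists_diff_smul_eq x i j
    obtain ⟨c, hc⟩ := diff_dvd_partialVanishing_sub i j
    -- The values of the current at z_i and z_j are sγ x_i and -sγ' x_j, so sb = s(γ x_i + γ' x_j).
    -- As γ - γ' = sc, correcting γ' b by c times the value at z_j makes the two coefficients equal.
    -- The identity is checked after multiplication by s and uses torsion-freeness.
    have e : (γ * γ') • (x i + x j) = γ' • b - c • (vanishing j • x j) := by
      refine sub_eq_zero.1 (hA s (diff_ne_zero hij) _ ?_)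
      have h1 : s • b = (s * γ) • x i + (s * γ') • x j := by
        rw [← hb', hvi, hvj]
        simp only [neg_mul, neg_smul, sub_neg_eq_add]
      have h2 : s * c = γ - γ' := hc.symm
      rw [hvj, smul_sub, smul_sub, smul_comm s γ' b, h1]
      simp only [Algebra.smul_def, map_mul, map_neg]
      have h3 : algebraMap (Pol n) A s * algebraMap (Pol n) A c =
          algebraMap (Pol n) A γ - algebraMap (Pol n) A γ' := by rw [← map_mul, h2, map_sub]
      linear_combination (-algebraMap (Pol n) A s * algebraMap (Pol n) A γ' * x j) * h3
    rw [e]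
    exact Subalgebra.sub_mem _ (Subalgebra.smul_mem _ hb _)
      (Subalgebra.smul_mem _ (vanishing_smul_mem x j) _)
  · have e : (s * (π * (γ * γ'))) • x i = (π * γ') • (vanishing i • x i) := by
      rw [smul_smul, hvi]
      congr 1
      ring
    rw [e]
    exact Subalgebra.smul_mem _ (vanishing_smul_mem x i) _

end Evaluation

/-! ### The commuting operators e^(i) and the submodule they generate -/

section SiteAlgebra

variable {n : ℕ} (W : Fin n → Type*) [∀ i, AddCommGroup (W i)] [∀ i, Module ℂ (W i)]
  [∀ i, LieRingModule Sl2 (W i)] [∀ i, LieModule ℂ Sl2 (W i)]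

/-- The action of `e` through the `i`-th tensor factor. -/
def raiseAt (i : Fin n) : Module.End (Pol n) (ValPol W) :=
  onSite i (LieModule.toEnd ℂ Sl2 (W i) sl2E)

theorem raiseAt_commute (i j : Fin n) : raiseAt W i * raiseAt W j = raiseAt W j * raiseAt W i := by
  by_cases h : i = j
  · rw [h]
  · exact onSite_commute h _ _

/-- The commutative algebra generated over `ℂ[z₁, …, zₙ]` by the actions of `e` through the tensor
factors. -/
def SiteAlgebra : Type _ := Algebra.adjoin (Pol n) (Set.range (raiseAt W))

instance : CommRing (SiteAlgebra W) :=
  { (Algebra.adjoin (Pol n) (Set.range (raiseAt W))).toRing with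
    mul_comm := (Algebra.isMulCommutative_adjoin (Pol n) (by
      rintro _ ⟨i, rfl⟩ _ ⟨j, rfl⟩
      exact raiseAt_commute W i j)).is_comm.comm }

instance : Algebra (Pol n) (SiteAlgebra W) :=
  inferInstanceAs (Algebra (Pol n) (Algebra.adjoin (Pol n) (Set.range (raiseAt W))))

/-- The representation of the site algebra on vector-valued polynomials. -/
def siteVal : SiteAlgebra W →ₐ[Pol n] Module.End (Pol n) (ValPol W) :=
  (Algebra.adjoin (Pol n) (Set.range (raiseAt W))).val

theorem siteVal_injective : Function.Injective (siteVal W) := Subtype.val_injective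

/-- The action of `e` through the `i`-th tensor factor as an element of the site algebra. -/
def siteGen (i : Fin n) : SiteAlgebra W :=
  ⟨raiseAt W i, Algebra.subset_adjoin (Set.mem_range_self i)⟩

theorem siteVal_siteGen (i : Fin n) : siteVal W (siteGen W i) = raiseAt W i := rfl

variable {W}

omit [∀ i, LieRingModule Sl2 (W i)] [∀ i, LieModule ℂ Sl2 (W i)] in
theorem onSite_pow_succ (i : Fin n) (A : Module.End ℂ (W i)) (k : ℕ) :
    onSite (W := W) i (A ^ (k + 1)) = onSite i A ^ (k + 1) := by
  induction k with
  | zero => simp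
  | succ k ih => rw [pow_succ, onSite_mul, ih, ← pow_succ]

theorem raiseAt_tmul (i : Fin n) (p : Pol n) (t : Tens W) :
    raiseAt W i (p ⊗ₜ[ℂ] t) = p ⊗ₜ[ℂ] atSite i (LieModule.toEnd ℂ Sl2 (W i) sl2E) t := rfl

theorem siteVal_siteCoeff (k : ℕ) : siteVal W (siteCoeff (siteGen W) k) =
    ∑ i, (complementaryProd i).coeff k • raiseAt W i := by
  simp only [siteCoeff, map_sum, map_smul, siteVal_siteGen]

theorem raiseAt_mem_homogPart (i : Fin n) {d : ℕ} {f : ValPol W}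
    (hf : f ∈ homogPart n (Tens W) d) : raiseAt W i f ∈ homogPart n (Tens W) d := by
  induction hf using Submodule.span_induction with
  | mem f hf =>
    obtain ⟨p, v, hp, rfl⟩ := hf
    exact Submodule.subset_span ⟨p, _, hp, raiseAt_tmul i p v⟩
  | zero => rw [map_zero]; exact Submodule.zero_mem _
  | add f g _ _ hf hg => rw [map_add]; exact Submodule.add_mem _ hf hg
  | smul c f _ hf => rw [LinearMap.map_smul_of_tower]; exact Submodule.smul_mem _ _ hf

theorem siteVal_closure_mem_homogPart {s : SiteAlgebra W}
    (hs : s ∈ Submonoid.closure (Set.range (siteCoeff (siteGen W)))) :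
    ∃ e, ∀ d, ∀ f ∈ homogPart n (Tens W) d, siteVal W s f ∈ homogPart n (Tens W) (d + e) := by
  induction hs using Submonoid.closure_induction with
  | mem s hs =>
    obtain ⟨k, rfl⟩ := hs
    refine ⟨n - 1 - k, fun d f hf => ?_⟩
    rw [siteVal_siteCoeff, LinearMap.sum_apply]
    refine Submodule.sum_mem _ fun i _ => ?_
    exact smul_mem_homogPart (coeff_complementaryProd_isHomogeneous i k)
      (raiseAt_mem_homogPart i hf)
  | one => exact ⟨0, fun d f hf => by simpa using hf⟩
  | mul s t _ _ hs ht =>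
    obtain ⟨a, ha⟩ := hs
    obtain ⟨b, hb⟩ := ht
    refine ⟨b + a, fun d f hf => ?_⟩
    rw [map_mul, Module.End.mul_apply, ← add_assoc]
    exact ha _ _ (hb _ _ hf)

variable (u : ∀ i, W i)

/-- The vector-valued polynomials obtained from the constant `u₁ ⊗ ⋯ ⊗ uₙ` by the algebra generated
by the coefficients of `siteCurrent`. -/
def fusionSpan : Submodule (Pol n) (ValPol W) :=
  (Subalgebra.toSubmodule (coeffAlgebra (siteGen W))).map
    ((LinearMap.applyₗ (1 ⊗ₜ[ℂ] PiTensorProduct.tprod ℂ u)).comp (siteVal W).toLinearMap)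

theorem siteVal_apply_mem_fusionSpan {b : SiteAlgebra W} (hb : b ∈ coeffAlgebra (siteGen W)) :
    siteVal W b (1 ⊗ₜ[ℂ] PiTensorProduct.tprod ℂ u) ∈ fusionSpan u := ⟨b, hb, rfl⟩

variable {u} in
theorem siteVal_mem_fusionSpan {b : SiteAlgebra W} (hb : b ∈ coeffAlgebra (siteGen W))
    {f : ValPol W} (hf : f ∈ fusionSpan u) : siteVal W b f ∈ fusionSpan u := by
  obtain ⟨c, hc, rfl⟩ := hf
  refine ⟨b * c, Subalgebra.mul_mem _ hb hc, ?_⟩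
  simp

/-- The spanning monomials modulo the z_i, applied to u₁ ⊗ ⋯ ⊗ uₙ, are homogeneous vector-valued
polynomials, so graded Nakayama lifts spanning at z = 0 to generation over the polynomial ring. -/
theorem exists_fusionSpan_eq_span (ξ : Fin n → ℕ) (hx : ∀ i, siteGen W i ^ (ξ i + 1) = 0) :
    ∃ S : Finset (ValPol W), S.card ≤ ∏ i, (ξ i + 1) ∧
      fusionSpan u = Submodule.span (Pol n) (S : Set (ValPol W)) := by
  classical
  obtain ⟨S, hS, hS', hspan⟩ := exists_monomials (siteGen W) ξ hx
  let ev : SiteAlgebra W →ₗ[Pol n] ValPol W :=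
    (LinearMap.applyₗ (1 ⊗ₜ[ℂ] PiTensorProduct.tprod ℂ u)).comp (siteVal W).toLinearMap
  have hclos : Submonoid.closure (Set.range (siteCoeff (siteGen W))) ≤
      (coeffAlgebra (siteGen W)).toSubmonoid := Submonoid.closure_le.2 (by
    rintro _ ⟨k, rfl⟩
    exact siteCoeff_mem _ k)
  refine ⟨S.image ev, Finset.card_image_le.trans hS, le_antisymm ?_ ?_⟩
  · refine le_span_of_graded ?_ ?_
    · intro s hs
      rw [Finset.coe_image] at hs
      obtain ⟨s, hs, rfl⟩ := hs
      obtain ⟨e, he⟩ := siteVal_closure_mem_homogPart (hS' hs)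
      exact ⟨0 + e, he 0 _ (Submodule.subset_span ⟨1, _, MvPolynomial.isHomogeneous_one _ _, rfl⟩)⟩
    · rintro _ ⟨b, hb, rfl⟩
      obtain ⟨q, hq, c, hc, rfl⟩ := hspan b hb
      refine ⟨ev q, ?_, fun i => ev (c i), fun i => ⟨c i, hc i, rfl⟩, ?_⟩
      · rw [Finset.coe_image, ← Submodule.map_span]
        exact ⟨q, hq, rfl⟩
      · change ev _ = _
        rw [map_add, map_sum]
        simp only [map_smul]
  · rw [Submodule.span_le, Finset.coe_image]
    rintro _ ⟨s, hs, rfl⟩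
    exact ⟨s, hclos (hS' hs), rfl⟩

theorem complementaryProd_eq_divByMonic (i : Fin n) : complementaryProd i =
    (∏ j : Fin n, (Polynomial.X - Polynomial.C (MvPolynomial.X j : Pol n))) /ₘ
      (Polynomial.X - Polynomial.C (MvPolynomial.X i)) := by
  rw [← Finset.mul_prod_erase _ _ (Finset.mem_univ i),
    Polynomial.mul_divByMonic_cancel_left _ (Polynomial.monic_X_sub_C _)]
  rfl

/-- Dividing ∏_j (ζ - z_j) by ζ - z_i gives coefficients that combine powers of z_i with
coefficients independent of i. So each `siteCoeff` is a polynomial combination of the currents e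
t^m. -/
theorem siteVal_siteCoeff_mem {P : Submodule (Pol n) (ValPol W)} (hP : IsCurrentStable Sl2 P)
    (k : ℕ) {f : ValPol W} (hf : f ∈ P) : siteVal W (siteCoeff (siteGen W) k) f ∈ P := by
  have e : siteVal W (siteCoeff (siteGen W) k) =
      ∑ m ∈ Finset.Icc (k + 1) (∏ j : Fin n, (Polynomial.X -
          Polynomial.C (MvPolynomial.X j : Pol n))).natDegree,
        (∏ j : Fin n, (Polynomial.X - Polynomial.C (MvPolynomial.X j : Pol n))).coeff m •
          currentAct W Sl2 ((Polynomial.X ^ (m - (k + 1)) : Polynomial ℂ) ⊗ₜ sl2E) := by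
    rw [siteVal_siteCoeff]
    simp only [complementaryProd_eq_divByMonic, Polynomial.coeff_divByMonic_X_sub_C,
      currentAct_tmul, Finset.smul_sum, Finset.sum_smul, smul_smul]
    rw [Finset.sum_comm]
    refine Finset.sum_congr rfl fun m _ => Finset.sum_congr rfl fun i _ => ?_
    rw [map_pow, Polynomial.aeval_X, mul_comm]
    rfl
  rw [e, LinearMap.sum_apply]
  exact Submodule.sum_mem _ fun m _ => Submodule.smul_mem _ _ (hP _ f hf)

theorem fusionSpan_le {P : Submodule (Pol n) (ValPol W)} (hP : IsCurrentStable Sl2 P)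
    (hu : (1 ⊗ₜ[ℂ] PiTensorProduct.tprod ℂ u : ValPol W) ∈ P) : fusionSpan u ≤ P := by
  have key : ∀ b ∈ coeffAlgebra (siteGen W), ∀ f ∈ P, siteVal W b f ∈ P := by
    intro b hb
    induction hb using Algebra.adjoin_induction with
    | mem b hb =>
      obtain ⟨k, rfl⟩ := hb
      exact fun f hf => siteVal_siteCoeff_mem hP k hf
    | algebraMap r =>
      intro f hf
      rw [AlgHom.commutes]
      exact Submodule.smul_mem _ r hf
    | add a b _ _ ha hb =>
      intro f hf
      rw [map_add]
      exact Submodule.add_mem _ (ha f hf) (hb f hf)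
    | mul a b _ _ ha hb =>
      intro f hf
      rw [map_mul]
      exact ha _ (hb f hf)
  rintro _ ⟨b, hb, rfl⟩
  exact key b hb _ hu

end SiteAlgebra

/-! ### The product of the z_i - z_j -/

section Discriminant

variable {n : ℕ}

/-- The polynomial `∏_{i<j} (z_i - z_j)`. -/
def diagProd (n : ℕ) : Pol n :=
  ∏ i, ∏ j ∈ Finset.Ioi i, (MvPolynomial.X i - MvPolynomial.X j)

theorem diagProd_ne_zero : diagProd n ≠ 0 :=
  Finset.prod_ne_zero_iff.2 fun _ _ => Finset.prod_ne_zero_iff.2 fun _ hj =>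
    diff_ne_zero (Finset.mem_Ioi.1 hj).ne

theorem diff_dvd_diagProd {i j : Fin n} (h : i ≠ j) :
    (MvPolynomial.X i - MvPolynomial.X j : Pol n) ∣ diagProd n := by
  have key : ∀ {i j : Fin n}, i < j →
      (MvPolynomial.X i - MvPolynomial.X j : Pol n) ∣ diagProd n := by
    intro i j hij
    have h1 := Finset.dvd_prod_of_mem
      (fun j : Fin n => (MvPolynomial.X i - MvPolynomial.X j : Pol n)) (Finset.mem_Ioi.2 hij)
    have h2 := Finset.dvd_prod_of_mem (fun i : Fin n => ∏ j ∈ Finset.Ioi i,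
      (MvPolynomial.X i - MvPolynomial.X j : Pol n)) (Finset.mem_univ i)
    exact h1.trans h2
  rcases lt_or_gt_of_ne h with h | h
  · exact key h
  · rw [← neg_sub, neg_dvd]
    exact key h

theorem vanishing_dvd_diagProd (q : Fin n) : vanishing q ∣ diagProd n := by
  refine Finset.prod_dvd_of_isRelPrime ?_ fun j hj =>
    diff_dvd_diagProd (Finset.ne_of_mem_erase hj).symm
  intro j hj l hl hjl
  have hj := (Finset.ne_of_mem_erase (Finset.mem_coe.1 hj)).symm
  have hl := (Finset.ne_of_mem_erase (Finset.mem_coe.1 hl)).symm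
  exact diff_isRelPrime_diff hj hl (fun e => hjl e.2.symm) fun e => hj e.1

theorem diagProd_pow (M : ℕ) : diagProd n ^ M =
    ∏ i, ∏ j ∈ Finset.Ioi i, (MvPolynomial.X i - MvPolynomial.X j) ^ M := by
  simp only [diagProd, Finset.prod_pow]

end Discriminant

/-! ### Freeness of the submodule generated by the currents of e -/

section Bases

variable {n : ℕ} {W : Fin n → Type*} [∀ i, AddCommGroup (W i)] [∀ i, Module ℂ (W i)]
  [∀ i, LieRingModule Sl2 (W i)] [∀ i, LieModule ℂ Sl2 (W i)]
  [∀ i, FiniteDimensional ℂ (W i)] [∀ i, LieModule.IsIrreducible ℂ Sl2 (W i)]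
  {u : ∀ i, W i} {d : Fin n → ℕ} (hw : ∀ i, IsPrimitive (u i) (d i))

/-- The basis of the vector-valued polynomials which consists of the constants
`e^{r₁} u₁ ⊗ ⋯ ⊗ e^{rₙ} uₙ`. -/
def valBasis : Module.Basis (∀ i, Fin (d i + 1)) (Pol n) (ValPol W) :=
  Algebra.TensorProduct.basis (Pol n) (Basis.piTensorProduct fun i => raisedBasis (hw i))

theorem valBasis_apply (r : ∀ i, Fin (d i + 1)) :
    valBasis hw r = 1 ⊗ₜ[ℂ] PiTensorProduct.tprod ℂ fun i => raised (u i) (r i) := by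
  rw [valBasis, Algebra.TensorProduct.basis_apply, Basis.piTensorProduct_apply]
  simp only [raisedBasis_apply]

include hw in
-- The site algebra acts faithfully on a free module.
theorem siteAlgebra_torsionFree {p : Pol n} (hp : p ≠ 0) {a : SiteAlgebra W} (h : p • a = 0) :
    a = 0 := by
  refine siteVal_injective W (LinearMap.ext fun f => ?_)
  have := congrArg (fun b => siteVal W b f) h
  simp only [map_smul, map_zero, LinearMap.smul_apply, LinearMap.zero_apply] at this
  rw [map_zero]
  exact ((valBasis hw).smul_eq_zero.1 this).resolve_left hp

include hw in
theorem siteGen_pow_eq_zero (i : Fin n) : siteGen W i ^ (d i + 1) = 0 := by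
  have h0 : LieModule.toEnd ℂ Sl2 (W i) sl2E ^ (d i + 1) = 0 := by
    refine (raisedBasis (hw i)).ext fun p => ?_
    rw [raisedBasis_apply, raised, ← Module.End.mul_apply, ← pow_add]
    exact raised_eq_zero (hw i) (by omega)
  refine siteVal_injective W ?_
  rw [map_pow, siteVal_siteGen, raiseAt, ← onSite_pow_succ, h0, map_zero, map_zero]

omit [∀ i, FiniteDimensional ℂ (W i)] [∀ i, LieModule.IsIrreducible ℂ Sl2 (W i)] in
theorem siteVal_siteGen_tmul (i : Fin n) (t : Tens W) : siteVal W (siteGen W i) (1 ⊗ₜ[ℂ] t) =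
    1 ⊗ₜ[ℂ] atSite i (LieModule.toEnd ℂ Sl2 (W i) sl2E) t := rfl

omit [∀ i, FiniteDimensional ℂ (W i)] [∀ i, LieModule.IsIrreducible ℂ Sl2 (W i)] in
theorem siteVal_siteGen_pow_tprod (i : Fin n) (k : ℕ) (w : ∀ i, W i) :
    siteVal W (siteGen W i ^ k) (1 ⊗ₜ[ℂ] PiTensorProduct.tprod ℂ w) =
      1 ⊗ₜ[ℂ] PiTensorProduct.tprod ℂ (Function.update w i (raised (w i) k)) := by
  induction k with
  | zero => simp [raised_zero]
  | succ k ih =>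
    rw [pow_succ', map_mul, Module.End.mul_apply, ih, siteVal_siteGen_tmul, atSite_tprod,
      Function.update_self, Function.update_idem, LieModule.toEnd_apply_apply, lie_e_raised]

omit [∀ i, FiniteDimensional ℂ (W i)] [∀ i, LieModule.IsIrreducible ℂ Sl2 (W i)] in
theorem siteVal_prod_siteGen (s : Finset (Fin n)) (r : Fin n → ℕ) (w : ∀ i, W i) :
    siteVal W (∏ q ∈ s, siteGen W q ^ r q) (1 ⊗ₜ[ℂ] PiTensorProduct.tprod ℂ w) =
      1 ⊗ₜ[ℂ] PiTensorProduct.tprod ℂ fun i => if i ∈ s then raised (w i) (r i) else w i := by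
  induction s using Finset.induction_on with
  | empty => simp
  | insert a s ha ih =>
    rw [Finset.prod_insert ha, map_mul, Module.End.mul_apply, ih, siteVal_siteGen_pow_tprod,
      if_neg ha]
    congr 2
    funext i
    by_cases h : i = a
    · subst h; simp
    · simp [h]

omit [∀ i, FiniteDimensional ℂ (W i)] [∀ i, LieModule.IsIrreducible ℂ Sl2 (W i)] in
theorem diagProd_smul_siteGen_mem (q : Fin n) :
    diagProd n • siteGen W q ∈ coeffAlgebra (siteGen W) := by
  obtain ⟨c, hc⟩ := vanishing_dvd_diagProd q
  rw [hc, mul_comm, mul_smul]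
  exact Subalgebra.smul_mem _ (vanishing_smul_mem _ q) _

include hw in
/-- The submodule `fusionSpan` contains the multiples of a power of `∏_{i<j} (z_i - z_j)`. -/
theorem exists_diagProd_pow_smul_mem :
    ∃ M, ∀ f : ValPol W, diagProd n ^ M • f ∈ fusionSpan u := by
  refine ⟨∑ i, d i, fun f => ?_⟩
  have key : ∀ r : ∀ i, Fin (d i + 1), diagProd n ^ (∑ i, d i) • valBasis hw r ∈ fusionSpan u := by
    intro r
    -- Each e^(q) needs one factor `diagProd n` to enter the algebra. The basis vector r uses ∑ r_i
    -- of the ∑ d_i available factors, and the rest stays in front.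
    have e : diagProd n ^ (∑ i, d i) • valBasis hw r =
        siteVal W (diagProd n ^ (∑ i, (d i - r i)) •
          ∏ q, (diagProd n • siteGen W q) ^ (r q : ℕ))
            (1 ⊗ₜ[ℂ] PiTensorProduct.tprod ℂ u) := by
      simp only [smul_pow]
      rw [Finset.prod_smul, Finset.prod_pow_eq_pow_sum, smul_smul, ← pow_add,
        ← Finset.sum_add_distrib, map_smul, LinearMap.smul_apply,
        siteVal_prod_siteGen Finset.univ (fun q => (r q : ℕ)), valBasis_apply]
      simp only [Finset.mem_univ, if_true]
      congr 2
      exact Finset.sum_congr rfl fun i _ => by have := (r i).2; omega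
    rw [e]
    refine siteVal_apply_mem_fusionSpan u (Subalgebra.smul_mem _ ?_ _)
    exact Subalgebra.prod_mem _ fun q _ => Subalgebra.pow_mem _ (diagProd_smul_siteGen_mem q) _
  rw [← (valBasis hw).sum_repr f, Finset.smul_sum]
  refine Submodule.sum_mem _ fun r _ => ?_
  rw [smul_comm]
  exact Submodule.smul_mem _ _ (key r)

include hw in
-- A free module of rank ∏ (d_i + 1) maps onto `fusionSpan u`, by the bound on the number of
-- generators, and embeds into it, by multiplication of all vector-valued polynomials with a power
-- of `diagProd n`. The Orzech property makes the surjection an isomorphism.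
theorem nonempty_fusionBasis :
    Nonempty (Module.Basis (∀ i, Fin (d i + 1)) (Pol n) (fusionSpan u)) := by
  classical
  obtain ⟨S, hS, hspan⟩ := exists_fusionSpan_eq_span u d (siteGen_pow_eq_zero hw)
  obtain ⟨M, hM⟩ := exists_diagProd_pow_smul_mem hw
  have hcard : Fintype.card S ≤ Fintype.card (∀ i, Fin (d i + 1)) := by
    rw [Fintype.card_coe, Fintype.card_pi]
    simpa using hS
  obtain ⟨emb⟩ := Function.Embedding.nonempty_of_card_le hcard
  have hSmem : ∀ s ∈ S, s ∈ fusionSpan u := fun s hs => hspan ▸ Submodule.subset_span hs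
  -- The generators may be fewer than the index set; the missing ones are filled in by 0.
  let g : (∀ i, Fin (d i + 1)) → fusionSpan u :=
    Function.extend emb (fun s => ⟨s, hSmem s s.2⟩) 0
  let f : ((∀ i, Fin (d i + 1)) →₀ Pol n) →ₗ[Pol n] fusionSpan u :=
    Finsupp.linearCombination (Pol n) g
  have hf : Function.Surjective f := by
    rw [← LinearMap.range_eq_top, Finsupp.range_linearCombination, eq_top_iff]
    have h1 : fusionSpan u ≤
        (Submodule.span (Pol n) (Set.range g)).map (fusionSpan u).subtype := by
      rw [Submodule.map_span]
      conv_lhs => rw [hspan]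
      refine Submodule.span_mono fun s hs => ⟨⟨s, hSmem s hs⟩, ⟨emb ⟨s, hs⟩, ?_⟩, rfl⟩
      exact emb.injective.extend_apply _ _ _
    rintro ⟨x, hx⟩ _
    obtain ⟨y, hy, rfl⟩ := h1 hx
    exact hy
  let i : ((∀ i, Fin (d i + 1)) →₀ Pol n) →ₗ[Pol n] fusionSpan u :=
    (((diagProd n ^ M) • (LinearMap.id : ValPol W →ₗ[Pol n] ValPol W)).codRestrict _
      hM).comp (valBasis hw).repr.symm.toLinearMap
  have hi : Function.Injective i := by
    rw [injective_iff_map_eq_zero]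
    intro c hc
    have h1 : diagProd n ^ M • (valBasis hw).repr.symm c = 0 := congrArg Subtype.val hc
    have h2 := ((valBasis hw).smul_eq_zero.1 h1).resolve_left (pow_ne_zero _ diagProd_ne_zero)
    exact (LinearEquiv.map_eq_zero_iff _).1 h2
  have : Module.Finite (Pol n) (fusionSpan u) := Module.Finite.of_surjective f hf
  exact ⟨⟨(LinearEquiv.ofBijective f
    (OrzechProperty.bijective_of_surjective_of_injective i f hi hf)).symm⟩⟩

end Bases

/-! ### The generated submodule near a generic point of a diagonal -/

section PairSpan

variable {n : ℕ} {W : Fin n → Type*} [∀ i, AddCommGroup (W i)] [∀ i, Module ℂ (W i)]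
  [∀ i, LieRingModule Sl2 (W i)] [∀ i, LieModule ℂ Sl2 (W i)] (u : ∀ i, W i)

/-- The vectors `t` such that `G^m s^k t` belongs to `fusionSpan` for some `m`. -/
def conductor (G s : Pol n) (k : ℕ) : Submodule ℂ (Tens W) where
  carrier := {t | ∃ m, (G ^ m * s ^ k) • (1 ⊗ₜ[ℂ] t : ValPol W) ∈ fusionSpan u}
  zero_mem' := ⟨0, by simp⟩
  add_mem' := by
    rintro t t' ⟨m, hm⟩ ⟨m', hm'⟩
    refine ⟨m + m', ?_⟩
    have e : (G ^ (m + m') * s ^ k) • (1 ⊗ₜ[ℂ] (t + t') : ValPol W) =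
        G ^ m' • (G ^ m * s ^ k) • (1 ⊗ₜ[ℂ] t : ValPol W) +
          G ^ m • (G ^ m' * s ^ k) • (1 ⊗ₜ[ℂ] t' : ValPol W) := by
      rw [smul_smul, smul_smul, TensorProduct.tmul_add, smul_add]
      congr 2 <;> ring
    rw [e]
    exact Submodule.add_mem _ (Submodule.smul_mem _ _ hm) (Submodule.smul_mem _ _ hm')
  smul_mem' := by
    rintro c t ⟨m, hm⟩
    refine ⟨m, ?_⟩
    rw [TensorProduct.tmul_smul, smul_comm]
    exact Submodule.smul_of_tower_mem _ c hm

variable {u} {G s : Pol n} {k : ℕ}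

theorem conductor_mono {l : ℕ} (h : k ≤ l) : conductor u G s k ≤ conductor u G s l := by
  rintro t ⟨m, hm⟩
  refine ⟨m, ?_⟩
  have e : G ^ m * s ^ l = s ^ (l - k) * (G ^ m * s ^ k) := by
    rw [mul_left_comm, ← pow_add, Nat.sub_add_cancel h]
  rw [e, mul_smul]
  exact Submodule.smul_mem _ _ hm

theorem conductor_map {b : SiteAlgebra W} {φ : Tens W → Tens W}
    (hb : ∀ t, siteVal W b (1 ⊗ₜ[ℂ] t) = 1 ⊗ₜ[ℂ] φ t) {l : ℕ}
    (hG : (s ^ l * G) • b ∈ coeffAlgebra (siteGen W)) {t : Tens W} (ht : t ∈ conductor u G s k) :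
    φ t ∈ conductor u G s (k + l) := by
  obtain ⟨m, hm⟩ := ht
  refine ⟨m + 1, ?_⟩
  have := siteVal_mem_fusionSpan hG hm
  rw [map_smul, map_smul, LinearMap.smul_apply, hb, smul_smul] at this
  convert this using 2
  ring

omit [∀ i, LieRingModule Sl2 (W i)] [∀ i, LieModule ℂ Sl2 (W i)] in
theorem insertPair_update_add {i j a : Fin n} (hij : i ≠ j) (hai : a ≠ i) (haj : a ≠ j)
    (w : ∀ p, W p) (x y : W a) (t : W i ⊗[ℂ] W j) :
    insertPair hij (Function.update w a (x + y)) t =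
      insertPair hij (Function.update w a x) t + insertPair hij (Function.update w a y) t := by
  induction t using TensorProduct.induction_on with
  | zero => simp
  | add s t hs ht => simp only [map_add, hs, ht]; abel
  | tmul x' y' =>
    simp only [insertPair_tmul, Function.update_comm hai, Function.update_comm haj,
      MultilinearMap.map_update_add]

omit [∀ i, LieRingModule Sl2 (W i)] [∀ i, LieModule ℂ Sl2 (W i)] in
theorem insertPair_update_smul {i j a : Fin n} (hij : i ≠ j) (hai : a ≠ i) (haj : a ≠ j)
    (w : ∀ p, W p) (c : ℂ) (x : W a) (t : W i ⊗[ℂ] W j) :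
    insertPair hij (Function.update w a (c • x)) t =
      c • insertPair hij (Function.update w a x) t := by
  induction t using TensorProduct.induction_on with
  | zero => simp
  | add s t hs ht => simp only [map_add, hs, ht, smul_add]
  | tmul x' y' =>
    simp only [insertPair_tmul, Function.update_comm hai, Function.update_comm haj,
      MultilinearMap.map_update_smul]

omit [∀ i, LieRingModule Sl2 (W i)] [∀ i, LieModule ℂ Sl2 (W i)] in
theorem insertPair_update_self {i j a : Fin n} (hij : i ≠ j) (ha : a = i ∨ a = j)
    (w : ∀ p, W p) (x : W a) (t : W i ⊗[ℂ] W j) :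
    insertPair hij (Function.update w a x) t = insertPair hij w t := by
  induction t using TensorProduct.induction_on with
  | zero => simp
  | add s t hs ht => simp only [map_add, hs, ht]
  | tmul x' y' =>
    rw [insertPair_tmul, insertPair_tmul]
    rcases ha with rfl | rfl
    · rw [Function.update_idem]
    · rw [Function.update_comm hij, Function.update_idem, Function.update_comm hij]

variable [∀ i, FiniteDimensional ℂ (W i)] [∀ i, LieModule.IsIrreducible ℂ Sl2 (W i)]
  {d : Fin n → ℕ} (hw : ∀ i, IsPrimitive (u i) (d i))

include hw

/-- The entries at sites other than i, j are changed from u_a to an arbitrary vector one site at a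
time, since the powers of e applied to u_a span W_a. -/
theorem insertPair_mem_of_raise {i j : Fin n} (hij : i ≠ j) {K : Submodule ℂ (Tens W)}
    (hK : ∀ a, a ≠ i → a ≠ j → ∀ t ∈ K,
      atSite a (LieModule.toEnd ℂ Sl2 (W a) sl2E) t ∈ K) {t : W i ⊗[ℂ] W j}
    (ht : insertPair hij u t ∈ K) (w : ∀ p, W p) : insertPair hij w t ∈ K := by
  have key : ∀ s : Finset (Fin n), ∀ w : ∀ p, W p, (∀ q ∉ s, w q = u q) →
      insertPair hij w t ∈ K := by
    intro s
    induction s using Finset.induction_on with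
    | empty =>
      intro w h
      rwa [show w = u from funext fun q => h q (Finset.notMem_empty q)]
    | insert a s _ ih =>
      intro w h
      have hbase : insertPair hij (Function.update w a (u a)) t ∈ K := by
        refine ih _ fun q hq => ?_
        by_cases hqa : q = a
        · subst hqa; simp
        · rw [Function.update_of_ne hqa]
          exact h q (by simp [hqa, hq])
      by_cases ha : a = i ∨ a = j
      · rwa [insertPair_update_self hij ha] at hbase
      · push Not at ha
        have hx : ∀ x ∈ Submodule.span ℂ (Set.range (raisedBasis (hw a))),
            insertPair hij (Function.update w a x) t ∈ K := by
          intro x hx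
          induction hx using Submodule.span_induction with
          | zero =>
            rw [← zero_smul ℂ (0 : W a), insertPair_update_smul hij ha.1 ha.2, zero_smul]
            exact K.zero_mem
          | add x y _ _ hx hy =>
            rw [insertPair_update_add hij ha.1 ha.2]
            exact K.add_mem hx hy
          | smul c x _ hx =>
            rw [insertPair_update_smul hij ha.1 ha.2]
            exact K.smul_mem c hx
          | mem x hx =>
            obtain ⟨p, rfl⟩ := hx
            rw [raisedBasis_apply]
            generalize (p : ℕ) = r
            induction r with
            | zero => exact hbase
            | succ r ihr =>
              have := hK a ha.1 ha.2 _ ihr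
              rwa [atSite_insertPair_of_ne hij ha.1 ha.2, Function.update_self,
                Function.update_idem, LieModule.toEnd_apply_apply, lie_e_raised] at this
        have := hx (w a) (by rw [Module.Basis.span_eq]; trivial)
        rwa [Function.update_eq_self] at this
  exact key Finset.univ w fun q hq => absurd (Finset.mem_univ q) hq

/-- Up to a factor which is coprime to `z_i - z_j`, the submodule `fusionSpan` contains the vectors
`(z_i - z_j)ᵏ t` with `t` in the `k`-th step of the filtration at `i`, `j`. -/
theorem exists_pairImage_le_conductor {i j : Fin n} (hij : i ≠ j) :
    ∃ G : Pol n, ¬(MvPolynomial.X i - MvPolynomial.X j) ∣ G ∧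
      ∀ k, pairImage hij (hybridSpan (u i) (u j) k) ≤
        conductor u G (MvPolynomial.X i - MvPolynomial.X j) k := by
  obtain ⟨G, hG, hq, hsum, hi⟩ := exists_not_diff_dvd (siteGen W)
    (fun p hp a ha => siteAlgebra_torsionFree hw hp ha) hij
  refine ⟨G, hG, fun k => pairImage_le hij fun w t ht => ?_⟩
  set s : Pol n := MvPolynomial.X i - MvPolynomial.X j
  refine insertPair_mem_of_raise hw hij (fun a hai haj t ht => ?_) ?_ w
  · exact conductor_map (l := 0) (siteVal_siteGen_tmul a)
      (by rw [pow_zero, one_mul]; exact hq a hai haj) ht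
  -- Each use of e^(i) alone costs a factor z_i - z_j, so p uses land in the p-th conductor; e^(i) +
  -- e^(j) below is free of this cost.
  · have hmixed : ∀ p, insertPair hij u (mixed (u i) (u j) p 0) ∈ conductor u G s p := by
      intro p
      induction p with
      | zero =>
        refine ⟨0, ?_⟩
        rw [mixed, raised_zero, raised_zero, insertPair_apply_self, pow_zero, pow_zero, one_mul,
          one_smul]
        simpa using siteVal_apply_mem_fusionSpan u (Subalgebra.one_mem _)
      | succ p ih =>
        have := conductor_map (l := 1) (siteVal_siteGen_tmul i) (by rwa [pow_one]) ih
        rwa [atSite_insertPair_left, mixed, LinearMap.rTensor_tmul, LieModule.toEnd_apply_apply,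
          lie_e_raised] at this
    have hle : hybridSpan (u i) (u j) k ≤ (conductor u G s k).comap (insertPair hij u) := by
      refine Submodule.span_le.2 ?_
      rintro _ ⟨p, hp, a, rfl⟩
      rw [SetLike.mem_coe, Submodule.mem_comap]
      induction a with
      | zero => exact conductor_mono hp (hmixed p)
      | succ a ih =>
        have hb : ∀ t : Tens W, siteVal W (siteGen W i + siteGen W j) (1 ⊗ₜ[ℂ] t) =
            1 ⊗ₜ[ℂ] (atSite i (LieModule.toEnd ℂ Sl2 (W i) sl2E) t +
              atSite j (LieModule.toEnd ℂ Sl2 (W j) sl2E) t) := by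
          intro t
          rw [map_add, LinearMap.add_apply, siteVal_siteGen_tmul, siteVal_siteGen_tmul,
            TensorProduct.tmul_add]
        have := conductor_map (l := 0) hb (by rwa [pow_zero, one_mul]) ih
        rw [atSite_insertPair_left, atSite_insertPair_right, ← map_add] at this
        rw [← lie_e_raised, lie_eq_leftAct_add_rightAct]
        exact this
    exact hle ht

end PairSpan

/-! ### Dual families in F^c and F̂^c -/

section Duality

variable {n : ℕ} {W : Fin n → Type*} [∀ i, AddCommGroup (W i)] [∀ i, Module ℂ (W i)]

instance (P : Submodule (Pol n) (ValPol W)) : Module (Pol n) P := P.module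

instance (P : Submodule (Pol n) (ValPol W)) : SMul (Pol n) P := P.module.toSMul

theorem chi_tprod (β : ∀ i, LinearMap.BilinForm ℂ (W i)) (x y : ∀ i, W i) :
    chi β (1 ⊗ₜ[ℂ] PiTensorProduct.tprod ℂ x) (1 ⊗ₜ[ℂ] PiTensorProduct.tprod ℂ y) =
      MvPolynomial.C (∏ i, β i (x i) (y i)) := by
  refine MvPolynomial.funext fun Z => ?_
  rw [eval_chi, MvPolynomial.eval_C]
  simp [evalAt, prodForm_tprod]

theorem prod_ite_eq_ite {ι : Fin n → Type*} [∀ i, DecidableEq (ι i)] (r q : ∀ i, ι i) :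
    ∏ i, (if r i = q i then (1 : ℂ) else 0) = if r = q then 1 else 0 := by
  split_ifs with h
  · subst h; simp
  · obtain ⟨i, hi⟩ := Function.ne_iff.1 h
    exact Finset.prod_eq_zero (Finset.mem_univ i) (if_neg hi)

theorem diff_pow_dvd_diagDenominator {i j : Fin n} (hij : i < j) :
    (MvPolynomial.X i - MvPolynomial.X j : Pol n) ^
      (min (Module.finrank ℂ (W i)) (Module.finrank ℂ (W j)) - 1) ∣ diagDenominator W := by
  have h1 := Finset.dvd_prod_of_mem (fun j : Fin n => (MvPolynomial.X i - MvPolynomial.X j : Pol n) ^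
    (min (Module.finrank ℂ (W i)) (Module.finrank ℂ (W j)) - 1)) (Finset.mem_Ioi.2 hij)
  have h2 := Finset.dvd_prod_of_mem (fun i : Fin n => ∏ j ∈ Finset.Ioi i,
    (MvPolynomial.X i - MvPolynomial.X j : Pol n) ^
      (min (Module.finrank ℂ (W i)) (Module.finrank ℂ (W j)) - 1)) (Finset.mem_univ i)
  exact h1.trans h2

theorem diagDenominator_ne_zero : diagDenominator W ≠ 0 :=
  Finset.prod_ne_zero_iff.2 fun _ _ => Finset.prod_ne_zero_iff.2 fun _ hj =>
    pow_ne_zero _ (diff_ne_zero (Finset.mem_Ioi.1 hj).ne)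

theorem diff_pow_dvd_diagProd_pow {i j : Fin n} (hij : i ≠ j) (M : ℕ) :
    (MvPolynomial.X i - MvPolynomial.X j : Pol n) ^ M ∣ diagProd n ^ M :=
  pow_dvd_pow_of_dvd (diff_dvd_diagProd hij) M

variable [∀ i, LieRingModule Sl2 (W i)] [∀ i, LieModule ℂ Sl2 (W i)]
  [∀ i, FiniteDimensional ℂ (W i)] [∀ i, LieModule.IsIrreducible ℂ Sl2 (W i)]
  {u v : ∀ i, W i} (hu : ∀ i, IsHighest (u i)) (hv : ∀ i, IsLowest (v i))
  {β : ∀ i, LinearMap.BilinForm ℂ (W i)}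
  (hβ : ∀ i, (β i).lieInvariant Sl2 ∧ β i (u i) (v i) = 1)

include hu hv hβ

theorem exists_left_dual (i : Fin n) : ∃ b' : Fin (Module.finrank ℂ (W i) - 1 + 1) → W i,
    ∀ p q, β i (b' p) (raisedBasis (hu i).isPrimitive q) = if p = q then 1 else 0 := by
  refine ⟨fun p => raisedDual (β i) (u i) (Module.finrank ℂ (W i) - 1) p, fun p q => ?_⟩
  rw [raisedBasis_apply, raisedDual_apply (hβ i).1 (hu i).isPrimitive
    (lieInvariant_top_ne_zero (hu i).isPrimitive (hv i) (hβ i).2) (Nat.lt_succ_iff.1 p.2)]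
  simp only [Fin.ext_iff]

/-- The flipped form is again invariant and its top value differs only by a sign, so left dual
families for it are right dual families for the given form. -/
theorem exists_right_dual (i : Fin n) : ∃ b' : Fin (Module.finrank ℂ (W i) - 1 + 1) → W i,
    ∀ p q, β i (raisedBasis (hu i).isPrimitive p) (b' q) = if p = q then 1 else 0 := by
  obtain ⟨b', hb'⟩ := exists_left_dual hu hv hβ i
  have hw := (hu i).isPrimitive
  have hflip : (β i).flip.lieInvariant Sl2 := fun x y z => by
    have := (hβ i).1 x z y
    simp only [LinearMap.BilinForm.flip_apply, this, neg_neg]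
  have htop : (β i).flip (u i) (raised (u i) (Module.finrank ℂ (W i) - 1)) ≠ 0 := by
    have := lieInvariant_raisedBasis (hβ i).1 hw (Module.finrank ℂ (W i) - 1) 0
    rw [raised_zero] at this
    change β i (raised (u i) _) (u i) ≠ 0
    rw [this, if_pos (by omega)]
    exact mul_ne_zero (pow_ne_zero _ (by norm_num))
      (lieInvariant_top_ne_zero hw (hv i) (hβ i).2)
  refine ⟨fun q => raisedDual (β i).flip (u i) (Module.finrank ℂ (W i) - 1) q, fun p q => ?_⟩
  have := raisedDual_apply hflip hw htop (p := q) (q := p) (Nat.lt_succ_iff.1 q.2)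
  rw [raisedBasis_apply]
  refine Eq.trans this ?_
  simp only [Fin.ext_iff, eq_comm]

theorem pairImage_cgFiltration_le {i j : Fin n} (hij : i ≠ j) (k : ℕ) :
    pairImage hij (cgFiltration W i j k) ≤ pairImage hij (hybridSpan (u i) (u j) k) :=
  pairImage_mono hij (componentSum_le_hybridSpan (hu i).isPrimitive (hu j).isPrimitive
    (tensorForm_lieInvariant (hβ i).1 (hβ j).1) (tensorForm_nondeg hu hv hβ i j) k)

omit hv hβ in
theorem cgFiltration_eq_top (i j : Fin n) :
    cgFiltration W i j (min (Module.finrank ℂ (W i)) (Module.finrank ℂ (W j)) - 1) = ⊤ := by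
  have := componentSum_Iic_eq_top (hu i).isPrimitive (hu j).isPrimitive
    (l := min (Module.finrank ℂ (W i)) (Module.finrank ℂ (W j)) - 1) (by omega)
  change (componentSum (W i) (W j) _).toSubmodule = ⊤
  rw [this]
  rfl

omit hv hβ in
theorem oppFiltration_eq_top (i j : Fin n) {l : ℕ}
    (hl : min (Module.finrank ℂ (W i)) (Module.finrank ℂ (W j)) - 1 ≤ l) :
    oppFiltration W i j l = ⊤ := by
  rw [eq_top_iff, ← cgFiltration_eq_top hu i j]
  refine componentSum_mono _ _ fun k _ => ?_
  change _ ≤ k + l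
  omega

/-- Every linear form on `fusionSpan` is, up to the factor `diagDenominator`, the pairing with an
element of `F̂^c`. -/
theorem exists_mem_FcHat_of_linearForm (φ : fusionSpan u →ₗ[Pol n] Pol n) :
    ∃ h ∈ FcHat W, ∀ f : fusionSpan u, chi β f h = diagDenominator W * φ f := by
  classical
  have hw : ∀ i, IsPrimitive (u i) (Module.finrank ℂ (W i) - 1) := fun i => (hu i).isPrimitive
  obtain ⟨M, hM⟩ := exists_diagProd_pow_smul_mem hw
  have hE : diagProd n ^ M ≠ 0 := pow_ne_zero _ diagProd_ne_zero
  let lift : ValPol W →ₗ[Pol n] fusionSpan u :=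
    (diagProd n ^ M • (LinearMap.id : ValPol W →ₗ[Pol n] ValPol W)).codRestrict _ hM
  have hlift : ∀ f : fusionSpan u, lift f = diagProd n ^ M • f := fun f => rfl
  have hcond : ∀ {i j : Fin n} (hij : i ≠ j), ∃ G : Pol n,
      ¬(MvPolynomial.X i - MvPolynomial.X j) ∣ G ∧ ∀ k, ∀ t ∈ pairImage hij (cgFiltration W i j k),
        ∃ m, (G ^ m * (MvPolynomial.X i - MvPolynomial.X j) ^ k) • (1 ⊗ₜ[ℂ] t : ValPol W) ∈
          fusionSpan u := by
    intro i j hij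
    obtain ⟨G, hG, hle⟩ := exists_pairImage_le_conductor hw hij
    exact ⟨G, hG, fun k t ht => hle k (pairImage_cgFiltration_le hu hv hβ hij k ht)⟩
  -- This says that the form D φ, defined on all of F after division by Δ^M, takes polynomial
  -- values. It is checked one diagonal at a time, up to factors prime to z_i - z_j.
  have hdvd : ∀ f : ValPol W, diagProd n ^ M ∣ diagDenominator W * φ (lift f) := by
    intro f
    induction f using TensorProduct.induction_on with
    | zero => simp
    | add f g hf hg => rw [map_add, map_add, mul_add]; exact dvd_add hf hg
    | tmul p t =>
      have e : (p ⊗ₜ[ℂ] t : ValPol W) = p • (1 ⊗ₜ[ℂ] t) := by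
        rw [TensorProduct.smul_tmul', smul_eq_mul, mul_one]
      rw [e, map_smul, map_smul, smul_eq_mul, mul_left_comm]
      refine Dvd.dvd.mul_left ?_ p
      rw [diagProd_pow]
      refine prod_diff_pow_dvd (fun _ _ => M) fun i j hij => ?_
      obtain ⟨G, hG, hGt⟩ := hcond hij.ne
      -- The step s_ij of the filtration is everything, so every constant t enters `fusionSpan u`
      -- after multiplication by s^(s_ij) and a factor prime to s.
      obtain ⟨m, hm⟩ := hGt (min (Module.finrank ℂ (W i)) (Module.finrank ℂ (W j)) - 1) t
        (by rw [cgFiltration_eq_top hu, pairImage_top]; trivial)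
      set s : Pol n := MvPolynomial.X i - MvPolynomial.X j
      have h1 : G ^ m * s ^ (min (Module.finrank ℂ (W i)) (Module.finrank ℂ (W j)) - 1) *
          φ (lift (1 ⊗ₜ[ℂ] t)) = diagProd n ^ M * φ ⟨_, hm⟩ := by
        rw [← smul_eq_mul, ← map_smul, ← map_smul, hlift ⟨_, hm⟩, map_smul, smul_eq_mul]
      have h2 : s ^ M ∣ G ^ m *
          (s ^ (min (Module.finrank ℂ (W i)) (Module.finrank ℂ (W j)) - 1) *
            φ (lift (1 ⊗ₜ[ℂ] t))) := by
        rw [← mul_assoc, h1]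
        exact (diff_pow_dvd_diagProd_pow hij.ne M).mul_right _
      have h3 := (diff_prime hij.ne).pow_dvd_of_dvd_mul_left M
        (fun h => hG ((diff_prime hij.ne).dvd_of_dvd_pow h)) h2
      exact h3.trans (mul_dvd_mul_right (diff_pow_dvd_diagDenominator hij) _)
  choose b' hb' using fun i => exists_right_dual hu hv hβ i
  choose bl hbl using fun i => exists_left_dual hu hv hβ i
  choose c hc using fun r => hdvd (valBasis hw r)
  -- The c_r are the values of D φ on the basis, so combining them with the dual basis gives the
  -- element that represents D φ.
  let h : ValPol W := ∑ r, c r • (1 ⊗ₜ[ℂ] PiTensorProduct.tprod ℂ fun i => b' i (r i))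
  have hchi : ∀ f : ValPol W, diagProd n ^ M * chi β f h = diagDenominator W * φ (lift f) := by
    have key : (diagProd n ^ M) • (chi β).flip h = (diagDenominator W) • (φ ∘ₗ lift) := by
      refine (valBasis hw).ext fun q => ?_
      rw [LinearMap.smul_apply, LinearMap.smul_apply, LinearMap.comp_apply, smul_eq_mul,
        smul_eq_mul, hc]
      congr 1
      change chi β (valBasis hw q) h = c q
      simp only [h, map_sum, map_smul]
      rw [Finset.sum_eq_single q]
      · rw [valBasis_apply, chi_tprod]
        have : ∏ i, β i (raised (u i) (q i)) (b' i (q i)) = 1 := Finset.prod_eq_one fun i _ => by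
          rw [← raisedBasis_apply (hw i), hb', if_pos rfl]
        rw [this, map_one, smul_eq_mul, mul_one]
      · intro r _ hr
        rw [valBasis_apply, chi_tprod]
        have : ∏ i, β i (raised (u i) (q i)) (b' i (r i)) = 0 := by
          simp only [← raisedBasis_apply (hw _), hb', prod_ite_eq_ite, if_neg hr.symm]
        rw [this, map_zero, smul_zero]
      · simp
    intro f
    exact congrArg (fun ψ => ψ f) key
  have hval : ∀ f : fusionSpan u, chi β f h = diagDenominator W * φ f := by
    intro f
    refine mul_left_cancel₀ hE ?_
    rw [hchi, hlift, map_smul, smul_eq_mul, mul_left_comm]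
  refine ⟨h, fun i j hij => ?_, hval⟩
  obtain ⟨G, hG, hGt⟩ := hcond hij.ne
  refine diagCondition_of_diff_pow_dvd (fun p => raisedBasis (hw p)) bl hbl (fun _ => 0) hij.ne
    (V := cgFiltration W i j)
    (M := min (Module.finrank ℂ (W i)) (Module.finrank ℂ (W j)) - 1)
    (fun k l hkl t ht => ?_) (fun l hl => oppFiltration_eq_top hu i j hl) fun k hk t ht => ?_
  · refine mem_componentSum_of_orthogonal (hw i) (hw j)
      (tensorForm_lieInvariant (hβ i).1 (hβ j).1) (tensorForm_nondeg hu hv hβ i j)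
      (fun m hm => ?_) ht
    change ¬m ≤ k at hm
    change _ ≤ m + l
    omega
  -- G^m s^k t lies in `fusionSpan u`, so its pairing with h is divisible by D. Cancelling G^m and
  -- s^k leaves the divisibility of χ(t, h) by s^(s_ij - k) that characterizes F̂^c.
  · obtain ⟨m, hm⟩ := hGt k t ht
    set s : Pol n := MvPolynomial.X i - MvPolynomial.X j
    have h1 := hval ⟨_, hm⟩
    rw [map_smul, LinearMap.smul_apply, smul_eq_mul, mul_assoc] at h1
    have h2 : s ^ (min (Module.finrank ℂ (W i)) (Module.finrank ℂ (W j)) - 1) ∣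
        G ^ m * (s ^ k * chi β (1 ⊗ₜ[ℂ] t) h) := by
      rw [h1]
      exact (diff_pow_dvd_diagDenominator hij).mul_right _
    have h3 := (diff_prime hij.ne).pow_dvd_of_dvd_mul_left _
      (fun h => hG ((diff_prime hij.ne).dvd_of_dvd_pow h)) h2
    rw [← Nat.add_sub_cancel' hk.le, pow_add] at h3
    exact (mul_dvd_mul_iff_left (pow_ne_zero k (diff_ne_zero hij.ne))).1 h3

omit hv hβ in
theorem tprod_mem_Fc : (1 ⊗ₜ[ℂ] PiTensorProduct.tprod ℂ u : ValPol W) ∈ Fc W := by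
  intro i j hij
  refine diagCondition_tmul hij.ne ?_
  rw [← insertPair_apply_self hij.ne]
  refine insertPair_mem_pairImage _ _ ?_
  exact mixed_mem_componentSum (hu i).isPrimitive (hu j).isPrimitive (p := 0) (q := 0)
    (Nat.zero_le _) (Nat.zero_le _)

theorem fusionSpan_le_Fc : fusionSpan u ≤ Fc W :=
  fusionSpan_le u (Fc_isCurrentStable hu hv hβ) (tprod_mem_Fc hu)

/-- `F^c` and `F̂^c` have finite families which are dual with respect to the pairing, up to the
factor `diagDenominator`, and the elements of `F^c` and `F̂^c` are the combinations of these families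
with the coefficients given by the pairing. -/
theorem exists_dual_families : ∃ (ι : Type) (_ : Fintype ι) (b : ι → Fc W) (b' : ι → FcHat W),
    (∀ (f : Fc W) (q : ι → Pol n), (∀ r, chi β f (b' r) = diagDenominator W * q r) →
      f = ∑ r, q r • b r) ∧
    ∀ (h : FcHat W) (q : ι → Pol n), (∀ r, chi β (b r) h = diagDenominator W * q r) →
      h = ∑ r, q r • b' r := by
  classical
  have hw : ∀ i, IsPrimitive (u i) (Module.finrank ℂ (W i) - 1) := fun i => (hu i).isPrimitive
  obtain ⟨M, hM⟩ := exists_diagProd_pow_smul_mem hw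
  have hE : diagProd n ^ M ≠ 0 := pow_ne_zero _ diagProd_ne_zero
  have hD : diagDenominator W ≠ 0 := diagDenominator_ne_zero
  obtain ⟨B⟩ := nonempty_fusionBasis hw
  choose h' hh' hval using fun r => exists_mem_FcHat_of_linearForm hu hv hβ (B.coord r)
  choose bl hbl using fun i => exists_left_dual hu hv hβ i
  have hcoord : ∀ (f : fusionSpan u) r, chi β f (h' r) = diagDenominator W * B.repr f r := fun f r => hval r f
  refine ⟨_, inferInstance, fun r => ⟨B r, fusionSpan_le_Fc hu hv hβ (B r).2⟩,
    fun r => ⟨h' r, hh' r⟩, fun f q hq => ?_, fun h q hq => ?_⟩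
  · have hb : ∀ s r, chi β (B s : ValPol W) (h' r) =
        diagDenominator W * if s = r then 1 else 0 := by
      intro s r
      rw [hcoord, B.repr_self, Finsupp.single_apply]
    -- The difference pairs to zero with every h'_r. Its multiple by a power of `diagProd n` lies in
    -- `fusionSpan u`, where these pairings are D times the coordinates, so the difference is zero.
    set g : ValPol W := f - ∑ r, q r • (B r : ValPol W) with hg
    have hg0 : ∀ r, chi β g (h' r) = 0 := by
      intro r
      rw [hg, map_sub, LinearMap.sub_apply, hq, map_sum, LinearMap.sum_apply]
      simp [hb, mul_comm]
    have h1 : (⟨diagProd n ^ M • g, hM g⟩ : fusionSpan u) = 0 := by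
      refine B.ext_elem fun r => mul_left_cancel₀ hD ?_
      rw [← hcoord]
      simp [hg0]
    have h2 : diagProd n ^ M • g = 0 := congrArg Subtype.val h1
    have h3 := ((valBasis hw).smul_eq_zero.1 h2).resolve_left hE
    apply Subtype.ext
    rw [AddSubmonoidClass.coe_finsetSum]
    exact sub_eq_zero.1 h3
  · have hb : ∀ s r, chi β (B s : ValPol W) (h' r) =
        diagDenominator W * if s = r then 1 else 0 := by
      intro s r
      rw [hcoord, B.repr_self, Finsupp.single_apply]
    -- The difference is orthogonal to `fusionSpan u`, hence to a non-zero polynomial multiple of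
    -- every vector-valued polynomial, hence to all of them; non-degeneracy of χ finishes.
    set g : ValPol W := h - ∑ r, q r • h' r with hg
    have hg0 : ∀ r, chi β (B r : ValPol W) g = 0 := by
      intro r
      rw [hg, map_sub, hq, map_sum]
      simp [hb, mul_comm]
    have h1 : ∀ f : fusionSpan u, chi β f g = 0 := by
      have : ((chi β).flip g).comp (fusionSpan u).subtype = 0 := B.ext fun r => hg0 r
      exact fun f => congrArg (fun ψ => ψ f) this
    have h2 : ∀ f : ValPol W, chi β f g = 0 := by
      intro f
      have := h1 ⟨_, hM f⟩
      rw [map_smul, LinearMap.smul_apply, smul_eq_mul] at this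
      exact (mul_eq_zero.1 this).resolve_left hE
    have h3 : g = 0 := by
      refine (valBasis hw).ext_elem fun r => ?_
      rw [repr_eq_of_biorthogonal (valBasis hw) (chi β)
        (fun r => 1 ⊗ₜ[ℂ] PiTensorProduct.tprod ℂ fun i => bl i (r i)), h2, map_zero]
      · rfl
      · intro r q
        rw [valBasis_apply, chi_tprod]
        simp only [← raisedBasis_apply (hw _), hbl, prod_ite_eq_ite]
        split_ifs <;> simp
    apply Subtype.ext
    rw [AddSubmonoidClass.coe_finsetSum]
    exact sub_eq_zero.1 h3

end Duality

/-! ### Invariance of χ -/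

section Invariance

variable {n : ℕ} {W : Fin n → Type*} [∀ i, AddCommGroup (W i)] [∀ i, Module ℂ (W i)]
  {β : ∀ i, LinearMap.BilinForm ℂ (W i)}

theorem prodForm_atSite {i : Fin n} {A A' : Module.End ℂ (W i)}
    (h : ∀ x y, β i (A x) y = β i x (A' y)) (t t' : Tens W) :
    prodForm β (atSite i A t) t' = prodForm β t (atSite i A' t') := by
  induction t using PiTensorProduct.induction_on with
  | add s t hs ht => simp only [map_add, LinearMap.add_apply, hs, ht]
  | smul_tprod c x =>
    induction t' using PiTensorProduct.induction_on with
    | add s t hs ht => simp only [map_add, hs, ht]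
    | smul_tprod c' y =>
      simp only [map_smul, LinearMap.smul_apply, atSite_tprod, prodForm_tprod]
      congr 2
      refine Finset.prod_congr rfl fun p _ => ?_
      by_cases hp : p = i
      · subst hp; simp [h]
      · simp [Function.update_of_ne hp]

theorem chi_onSite {i : Fin n} {A A' : Module.End ℂ (W i)}
    (h : ∀ x y, β i (A x) y = β i x (A' y)) (f g : ValPol W) :
    chi β (onSite i A f) g = chi β f (onSite i A' g) := by
  refine MvPolynomial.funext fun Z => ?_
  rw [eval_chi, eval_chi, onSite_apply, onSite_apply, evalAt_baseChange, evalAt_baseChange,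
    prodForm_atSite h]

variable [∀ i, LieRingModule Sl2 (W i)] [∀ i, LieModule ℂ Sl2 (W i)]

/-- At the i-th site both arguments are multiplied by the same polynomial p(z_i), and x^(i) is skew
for the product form. -/
theorem chi_currentAct (hβ : ∀ i, (β i).lieInvariant Sl2) (a : Current Sl2) (f g : ValPol W) :
    chi β (currentAct W Sl2 a f) g = -chi β f (currentAct W Sl2 a g) := by
  induction a using TensorProduct.induction_on with
  | zero => simp
  | add a b ha hb =>
    simp only [map_add, LinearMap.add_apply, ha, hb, neg_add]
  | tmul p x =>
    rw [currentAct_tmul, LinearMap.sum_apply, LinearMap.sum_apply, map_sum, map_sum,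
      LinearMap.sum_apply, ← Finset.sum_neg_distrib]
    refine Finset.sum_congr rfl fun i _ => ?_
    have h : ∀ y z, β i (LieModule.toEnd ℂ Sl2 (W i) x y) z =
        β i y ((-LieModule.toEnd ℂ Sl2 (W i) x) z) := fun y z => by
      rw [LinearMap.neg_apply, map_neg]
      exact hβ i x y z
    rw [LinearMap.smul_apply, LinearMap.smul_apply, map_smul, map_smul, LinearMap.smul_apply,
      chi_onSite h, map_neg, LinearMap.neg_apply, map_neg, smul_neg]

end Invariance

/-! ### The fibres and the induced pairing -/

section Fibre

variable {n : ℕ}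

theorem sub_C_eval_mem (T : Fin n → ℂ) (q : Pol n) :
    q - MvPolynomial.C (MvPolynomial.eval T q) ∈
      Ideal.span (Set.range fun i => (MvPolynomial.X i - MvPolynomial.C (T i) : Pol n)) := by
  induction q using MvPolynomial.induction_on with
  | C c => simp
  | add p q hp hq =>
    rw [map_add, map_add, add_sub_add_comm]
    exact Ideal.add_mem _ hp hq
  | mul_X p i hp =>
    have e : p * MvPolynomial.X i - MvPolynomial.C (MvPolynomial.eval T (p * MvPolynomial.X i)) =
        p * (MvPolynomial.X i - MvPolynomial.C (T i)) +
          MvPolynomial.C (T i) * (p - MvPolynomial.C (MvPolynomial.eval T p)) := by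
      rw [map_mul, MvPolynomial.eval_X, map_mul]
      ring
    rw [e]
    exact Ideal.add_mem _ (Ideal.mul_mem_left _ _ (Ideal.subset_span (Set.mem_range_self i)))
      (Ideal.mul_mem_left _ _ hp)

theorem span_le_ker_eval (T : Fin n → ℂ) :
    Ideal.span (Set.range fun i => (MvPolynomial.X i - MvPolynomial.C (T i) : Pol n)) ≤
      RingHom.ker (MvPolynomial.eval T) := by
  rw [Ideal.span_le]
  rintro _ ⟨i, rfl⟩
  simp [RingHom.mem_ker]

variable {W : Fin n → Type*} [∀ i, AddCommGroup (W i)] [∀ i, Module ℂ (W i)]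

theorem eval_eq_zero_of_mem_idealMul {P : Submodule (Pol n) (ValPol W)} {T : Fin n → ℂ}
    (φ : P →ₗ[Pol n] Pol n) {f : P} (hf : f ∈ idealMul P T) : MvPolynomial.eval T (φ f) = 0 := by
  refine Submodule.smul_induction_on hf (fun q hq g _ => ?_) fun f g hf hg => ?_
  · rw [map_smul, smul_eq_mul, map_mul, RingHom.mem_ker.1 (span_le_ker_eval T hq), zero_mul]
  · rw [map_add, map_add, hf, hg, add_zero]

variable [∀ i, LieRingModule Sl2 (W i)] [∀ i, LieModule ℂ Sl2 (W i)]

namespace IsCurrentStable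

variable {P : Submodule (Pol n) (ValPol W)} (hP : IsCurrentStable Sl2 P) (T : Fin n → ℂ)

theorem toFiber_eq_zero_iff (f : P) : hP.toFiber T f = 0 ↔ f ∈ idealMul P T :=
  Submodule.Quotient.mk_eq_zero _

theorem toFiber_smul (q : Pol n) (f : P) :
    hP.toFiber T (q • f) = MvPolynomial.eval T q • hP.toFiber T f := by
  have h : hP.toFiber T ((q - MvPolynomial.C (MvPolynomial.eval T q)) • f) = 0 :=
    (hP.toFiber_eq_zero_iff T _).2 (Submodule.smul_mem_smul (sub_C_eval_mem T q) trivial)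
  rw [sub_smul, map_sub, sub_eq_zero, map_smul _ (MvPolynomial.C _)] at h
  rw [h]
  exact algebraMap_smul (Pol n) (MvPolynomial.eval T q) (hP.toFiber T f)

/-- A representative of an element of the fibre. -/
def lift (x : hP.FiberAt T) : P := Function.surjInv (hP.toFiber_surjective T) x

theorem toFiber_lift (x : hP.FiberAt T) : hP.toFiber T (hP.lift T x) = x :=
  Function.surjInv_eq _ _

variable {T} in
theorem eval_eq_of_toFiber_eq (φ : P →ₗ[Pol n] Pol n) {f g : P}
    (h : hP.toFiber T f = hP.toFiber T g) :
    MvPolynomial.eval T (φ f) = MvPolynomial.eval T (φ g) := by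
  rw [← sub_eq_zero, ← map_sub, hP.toFiber_eq_zero_iff] at h
  have := eval_eq_zero_of_mem_idealMul φ h
  rwa [map_sub, map_sub, sub_eq_zero] at this

/-- The pairing of the fibres which is induced by a pairing with polynomial values. -/
def fiberPairing {L : Submodule (Pol n) (ValPol W)} (hL : IsCurrentStable Sl2 L)
    (b : P →ₗ[Pol n] L →ₗ[Pol n] Pol n) :
    hL.FiberAt T →ₗ[ℂ] hP.FiberAt T →ₗ[ℂ] ℂ :=
  LinearMap.mk₂ ℂ (fun y x => MvPolynomial.eval T (b (hP.lift T x) (hL.lift T y)))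
    (fun y y' x => by
      rw [← map_add, ← map_add]
      refine hL.eval_eq_of_toFiber_eq _ ?_
      rw [map_add, toFiber_lift, toFiber_lift, toFiber_lift])
    (fun c y x => by
      have h := hL.eval_eq_of_toFiber_eq (b (hP.lift T x)) (T := T)
        (f := hL.lift T (c • y)) (g := MvPolynomial.C c • hL.lift T y)
        (by rw [toFiber_smul, toFiber_lift, toFiber_lift, MvPolynomial.eval_C])
      rw [h, map_smul, smul_eq_mul, map_mul, MvPolynomial.eval_C, smul_eq_mul])
    (fun y x x' => by
      have h := hP.eval_eq_of_toFiber_eq (b.flip (hL.lift T y)) (T := T)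
        (f := hP.lift T (x + x')) (g := hP.lift T x + hP.lift T x')
        (by rw [map_add, toFiber_lift, toFiber_lift, toFiber_lift])
      rw [map_add, map_add] at h
      exact h)
    (fun c y x => by
      have h := hP.eval_eq_of_toFiber_eq (b.flip (hL.lift T y)) (T := T)
        (f := hP.lift T (c • x)) (g := MvPolynomial.C c • hP.lift T x)
        (by rw [toFiber_smul, toFiber_lift, toFiber_lift, MvPolynomial.eval_C])
      rw [map_smul, smul_eq_mul, map_mul, MvPolynomial.eval_C] at h
      exact h)

theorem fiberPairing_toFiber {L : Submodule (Pol n) (ValPol W)} (hL : IsCurrentStable Sl2 L)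
    (b : P →ₗ[Pol n] L →ₗ[Pol n] Pol n) (f : P) (h : L) :
    hP.fiberPairing T hL b (hL.toFiber T h) (hP.toFiber T f) = MvPolynomial.eval T (b f h) := by
  have h1 := hL.eval_eq_of_toFiber_eq (b (hP.lift T (hP.toFiber T f))) (T := T)
    (f := hL.lift T (hL.toFiber T h)) (g := h) (toFiber_lift _ _ _)
  have h2 := hP.eval_eq_of_toFiber_eq (b.flip h) (T := T)
    (f := hP.lift T (hP.toFiber T f)) (g := f) (toFiber_lift _ _ _)
  exact h1.trans h2

/-- A pairing with polynomial values, invariant and with dual families, induces an isomorphism of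
each fibre with the contragredient of the other. -/
theorem exists_fiberEquiv {L : Submodule (Pol n) (ValPol W)} (hL : IsCurrentStable Sl2 L)
    (b : P →ₗ[Pol n] L →ₗ[Pol n] Pol n)
    (hinv : ∀ (a : Current Sl2) (f : P) (h : L),
      b ⟨currentAct W Sl2 a f, hP a f f.2⟩ h = -b f ⟨currentAct W Sl2 a h, hL a h h.2⟩)
    {ι : Type*} [Fintype ι] (p : ι → P) (l : ι → L) (hp : ∀ f, f = ∑ r, b f (l r) • p r)
    (hl : ∀ h, h = ∑ r, b (p r) h • l r) :
    ∃ Φ : hL.FiberAt T ≃ₗ⁅ℂ, Current Sl2⁆ Module.Dual ℂ (hP.FiberAt T),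
      ∀ (f : P) (h : L), Φ (hL.toFiber T h) (hP.toFiber T f) = MvPolynomial.eval T (b f h) := by
  let φ : hL.FiberAt T →ₗ⁅ℂ, Current Sl2⁆ Module.Dual ℂ (hP.FiberAt T) :=
    { hP.fiberPairing T hL b with
      map_lie' := by
        intro a y
        obtain ⟨h, rfl⟩ := hL.toFiber_surjective T y
        refine LinearMap.ext fun x => ?_
        obtain ⟨f, rfl⟩ := hP.toFiber_surjective T x
        rw [Module.Dual.lie_apply, lie_toFiber, lie_toFiber]
        change hP.fiberPairing T hL b _ _ = -hP.fiberPairing T hL b _ _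
        rw [fiberPairing_toFiber, fiberPairing_toFiber, hinv, map_neg, neg_neg] }
  have hφ : ∀ (f : P) (h : L), φ (hL.toFiber T h) (hP.toFiber T f) =
      MvPolynomial.eval T (b f h) := hP.fiberPairing_toFiber T hL b
  have hbij : Function.Bijective φ := by
    constructor
    · refine (injective_iff_map_eq_zero φ).2 fun y hy => ?_
      obtain ⟨h, rfl⟩ := hL.toFiber_surjective T y
      -- The coefficients of h in the dual family evaluate at T to the values of the induced
      -- functional on the classes of the p_r, which are zero.
      rw [hl h, map_sum]
      refine Finset.sum_eq_zero fun r _ => ?_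
      rw [toFiber_smul, ← hφ, hy, LinearMap.zero_apply, zero_smul]
    · intro ψ
      -- A functional ψ is hit by the combination of the l_r with constant coefficients ψ(p_r).
      refine ⟨hL.toFiber T (∑ r, (MvPolynomial.C (ψ (hP.toFiber T (p r))) : Pol n) • l r), ?_⟩
      refine LinearMap.ext fun x => ?_
      obtain ⟨f, rfl⟩ := hP.toFiber_surjective T x
      rw [hφ, map_sum, map_sum]
      conv_rhs => rw [hp f, map_sum, map_sum]
      refine Finset.sum_congr rfl fun r _ => ?_
      rw [map_smul, smul_eq_mul, map_mul, MvPolynomial.eval_C, toFiber_smul, map_smul,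
        smul_eq_mul, mul_comm]
  exact ⟨{ φ with
    invFun := Function.surjInv hbij.2
    left_inv := Function.leftInverse_surjInv hbij
    right_inv := Function.rightInverse_surjInv hbij.2 }, hφ⟩

end IsCurrentStable

variable [∀ i, FiniteDimensional ℂ (W i)]

/-- The pairing of `F^c` and `F̂^c` obtained from `χ` on division by `diagDenominator`. -/
theorem exists_reducedChi {β : ∀ i, LinearMap.BilinForm ℂ (W i)}
    (hβ : ∀ i, (β i).lieInvariant Sl2) :
    ∃ b : Fc W →ₗ[Pol n] FcHat W →ₗ[Pol n] Pol n,
      ∀ (f : Fc W) (h : FcHat W), chi β f h = diagDenominator W * b f h := by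
  choose q hq using fun (f : Fc W) (h : FcHat W) => diagDenominator_dvd_chi hβ f.2 h.2
  have hD : diagDenominator W ≠ 0 := diagDenominator_ne_zero
  refine ⟨LinearMap.mk₂ (Pol n) q (fun f f' h => ?_) (fun c f h => ?_) (fun f h h' => ?_)
    (fun c f h => ?_), fun f h => hq f h⟩ <;> refine mul_left_cancel₀ hD ?_
  · rw [mul_add, ← hq, ← hq, ← hq, Submodule.coe_add, map_add, LinearMap.add_apply]
  · rw [smul_eq_mul, mul_left_comm, ← hq, ← hq, Submodule.coe_smul, map_smul,
      LinearMap.smul_apply, smul_eq_mul]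
  · rw [mul_add, ← hq, ← hq, ← hq, Submodule.coe_add, map_add]
  · rw [smul_eq_mul, mul_left_comm, ← hq, ← hq, Submodule.coe_smul, map_smul, smul_eq_mul]

end Fibre

end FusionSl2
end

/-! ### The proposition -/

open FusionSl2 in
theorem proposition4p1 {n : ℕ} (W : Fin n → Type*)
    [∀ i, AddCommGroup (W i)] [∀ i, Module ℂ (W i)]
    [∀ i, LieRingModule Sl2 (W i)] [∀ i, LieModule ℂ Sl2 (W i)]
    [∀ i, FiniteDimensional ℂ (W i)] [∀ i, LieModule.IsIrreducible ℂ Sl2 (W i)]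
    (u v : ∀ i, W i) (hu : ∀ i, IsHighest (u i)) (hv : ∀ i, IsLowest (v i)) :
    (∀ i, ∃! β : LinearMap.BilinForm ℂ (W i), β.lieInvariant Sl2 ∧ β (u i) (v i) = 1) ∧
    ∃ (hM : IsCurrentStable Sl2 (Fc W)) (hL : IsCurrentStable Sl2 (FcHat W)),
      ∀ (β : ∀ i, LinearMap.BilinForm ℂ (W i)),
        (∀ i, (β i).lieInvariant Sl2 ∧ β i (u i) (v i) = 1) →
        ∀ T : Fin n → ℂ,
          ∃ Φ : hL.FiberAt T ≃ₗ⁅ℂ, Current Sl2⁆ Module.Dual ℂ (hM.FiberAt T),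
            ∀ (f : Fc W) (h : FcHat W), ∃ q : Pol n,
              chi β f h = diagDenominator W * q ∧
              Φ (hL.toFiber T h) (hM.toFiber T f) = MvPolynomial.eval T q := by
  have hex : ∀ i, ∃! β : LinearMap.BilinForm ℂ (W i), β.lieInvariant Sl2 ∧ β (u i) (v i) = 1 :=
    fun i => existsUnique_lieInvariant (hu i) (hv i)
  -- Stability of F^c and F̂^c does not involve the forms, but its proof uses orthogonality for some
  -- non-degenerate invariant forms, so one choice is fixed beforehand.
  choose β₀ hβ₀ _ using id hex
  refine ⟨hex, Fc_isCurrentStable hu hv hβ₀, FcHat_isCurrentStable hu hv hβ₀, fun β hβ T => ?_⟩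
  obtain ⟨b, hb⟩ := exists_reducedChi fun i => (hβ i).1
  obtain ⟨ι, _, p, l, hp, hl⟩ := exists_dual_families hu hv hβ
  have hD : diagDenominator W ≠ 0 := diagDenominator_ne_zero
  obtain ⟨Φ, hΦ⟩ := IsCurrentStable.exists_fiberEquiv (Fc_isCurrentStable hu hv hβ₀) T
    (FcHat_isCurrentStable hu hv hβ₀) b (fun a f h => mul_left_cancel₀ hD (by
      rw [← hb, mul_neg, ← hb]
      exact chi_currentAct (fun i => (hβ i).1) a f h)) p l
    (fun f => hp f _ fun r => hb f (l r)) (fun h => hl h _ fun r => hb (p r) h)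
  exact ⟨Φ, fun f h => ⟨b f h, hb f h, hΦ f h⟩⟩
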